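/- Let $q\in\mathbb C$ with $q\neq 0$ and $q^4\neq 1$, and fix a square root $q^{1/2}$. Let $\mathcal A=\mathcal O(SL_q(2))$ be the complex Hopf algebra with generators $A,B,C,D$, defined by the relations in (1) below together with $AD-qBC=1$, with $\Delta(u^i_j)=\sum_k u^i_k\otimes u^k_j$, $\varepsilon(u^i_j)=\delta_{ij}$ for $u=\begin{pmatrix}A&B\\ C&D\end{pmatrix}$, and $S(A)=D$, $S(B)=-q^{-1}B$, $S(C)=-qC$, $S(D)=A$. Let $\breve{\mathcal U}=\breve{\mathcal U}_q(\mathfrak{sl}_2)$ be the complex Hopf algebra with generators $E,F,K,K^{-1}$, relations $KK^{-1}=K^{-1}K=1$, $KEK^{-1}=qE$, $KFK^{-1}=q^{-1}F$, $EF-FE=\frac{K^2-K^{-2}}{q-q^{-1}}$, and the Hopf structure in (3) below. Let $\langle\,,\rangle$ be the dual pairing of $\breve{\mathcal U}$ and $\mathcal A$ with $\langle K,A\rangle=q^{-1/2}$, $\langle K,D\rangle=q^{1/2}$, $\langle E,C\rangle=\langle F,B\rangle=1$ and all other pairings of $E,F,K$ with $A,B,C,D$ equal to $0$. Elements of $\breve{\mathcal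 U}$ are also regarded as linear functionals on $\mathcal A$; functionals are multiplied by convolution, and the unit is $\varepsilon$. A left-covariant first order differential calculus over $\mathcal A$ is an $\mathcal A$-bimodule $\Gamma$ with a linear map $d:\mathcal A\to\Gamma$ such that $d(xy)=x\,dy+dx\,y$ and $\Gamma$ is the span of the elements $x\,dy\,z$, and with a linear map $\Delta_L:\Gamma\to\mathcal A\otimes\Gamma$ such that $\Delta_L(x\,dy)=\Delta(x)(\mathrm{id}\otimes d)\Delta(y)$. For such $\Gamma$ put $\omega(x)=\sum S(x_{1})\,dx_{2}$ and $R_\Gamma=\{x\in\ker\varepsilon:\omega(x)=0\}$; the quantum tangent space $T_\Gamma$ is the space of linear functionals on $\mathcal A$ that vanish at $1$ and on $R_\Gamma$. Let $\Gamma^\wedge$ be the quotient of the tensor algebra $T_{\mathcal A}(\Gamma)$ by the two-sided ideal generated by the elements $\sum\omega(x_1)\otimes\omega(x_2)$, $x\in R_\Gamma$; its product is written $\wedge$. Let $X_0,X_1,X_2$ be as in (2) below. There is a left-covariant first order differential calculus $\Gamma$ over $\mathcal A$ with $T_\Gamma=\mathrm{Lin}\{X_0,X_1,X_2\}$ (the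 3-D calculus). For every such $\Gamma$ there is a unique basis $\omega_0,\omega_1,\omega_2$ of the space $\{\rho:\Delta_L(\rho)=1\otimes\rho\}$ of left-invariant one-forms that is dual to $X_0,X_1,X_2$ for the pairing $(X,x\,dy)=\varepsilon(x)X(y)$, and there is a unique linear map $d$ on $\Gamma^\wedge$ that extends $d:\mathcal A\to\Gamma$, has degree one, satisfies the graded Leibniz rule, and has $d^2=0$. Moreover: 1. $AB=qBA$, $AC=qCA$, $BD=qDB$, $CD=qDC$, $BC=CB$, $AD-DA=(q-q^{-1})BC$. 2. $X_0=q^{-1/2}FK$, $X_2=q^{1/2}EK$, $X_1=(1-q^{-2})^{-1}(\varepsilon-K^4)$. 3. $\Delta(K)=K\otimes K$, $\Delta(E)=E\otimes K+K^{-1}\otimes E$, $\Delta(F)=F\otimes K+K^{-1}\otimes F$, $S(K)=K^{-1}$, $S(E)=-qE$, $S(F)=-q^{-1}F$, $\varepsilon(K)=1$, $\varepsilon(E)=\varepsilon(F)=0$. 4. $\Delta(X_j)=\varepsilon\otimes X_j+X_j\otimes K^2$ for $j=0,2$, and $\Delta(X_1)=\varepsilon\otimes X_1+X_1\otimes K^4$,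 in $\breve{\mathcal U}\otimes\breve{\mathcal U}$; for the functionals, $X_j(xy)=\varepsilon(x)X_j(y)+X_j(x)\langle K^{2},y\rangle$ for $j=0,2$, and likewise with $K^4$ for $j=1$. 5. $\omega_0=\omega(B)$, $\omega_2=\omega(C)$, $\omega_1=\omega(A)=-q^{-2}\omega(D)$, $dA=B\omega_2+A\omega_1$, $dB=A\omega_0-q^2B\omega_1$, $dC=C\omega_1+D\omega_2$, $dD=-q^2D\omega_1+C\omega_0$. 6. $\omega_jA=q^{-1}A\omega_j$, $\omega_jB=qB\omega_j$, $\omega_jC=q^{-1}C\omega_j$, $\omega_jD=qD\omega_j$ for $j=0,2$; $\omega_1A=q^{-2}A\omega_1$, $\omega_1B=q^2B\omega_1$, $\omega_1C=q^{-2}C\omega_1$, $\omega_1D=q^2D\omega_1$. 7. $q^2X_1X_0-q^{-2}X_0X_1=(1+q^2)X_0$, $q^2X_2X_1-q^{-2}X_1X_2=(1+q^2)X_2$, $qX_2X_0-q^{-1}X_0X_2=-q^{-1}X_1$, in $\breve{\mathcal U}$ and as functionals on $\mathcal A$. These relations are equivalent to the Maurer–Cartan equations: in $\Gamma^\wedge$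 one has $d\omega(x)=-\sum\omega(x_1)\wedge\omega(x_2)$ for all $x\in\mathcal A$, and a triple $Y_0,Y_1,Y_2$ of linear functionals on $\mathcal A$ satisfies the three relations (with $Y_i$ in place of $X_i$) if and only if $\sum_iY_i(x)\,d\omega_i=-\sum_{i,j}(Y_iY_j)(x)\,\omega_i\wedge\omega_j$ for all $x\in\mathcal A$. 8. In $\Gamma^\wedge$: $\omega_j\wedge\omega_j=0$ for $j=0,1,2$, $\omega_2\wedge\omega_0=-q^2\omega_0\wedge\omega_2$, $\omega_1\wedge\omega_0=-q^4\omega_0\wedge\omega_1$, $\omega_2\wedge\omega_1=-q^4\omega_1\wedge\omega_2$. 9. $\omega_1=D\,dA-q^{-1}B\,dC$, $\omega_2=A\,dC-qC\,dA$, $\omega_0=D\,dB-q^{-1}B\,dD$. -/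

import Mathlib

open scoped TensorProduct

/-- An admissible deformation parameter: a complex number `q` with `q ≠ 0` and `q ^ 4 ≠ 1`,
together with a choice `r` of the square root `q ^ (1/2)`. -/
structure QuantumParameter where
  q : ℂ
  r : ℂ
  r_sq : r ^ 2 = q
  q_ne_zero : q ≠ 0
  q_pow_four_ne_one : q ^ 4 ≠ 1

namespace QuantumParameter
theorem r_ne_zero (P : QuantumParameter) : P.r ≠ 0 := by
  intro h
  apply P.q_ne_zero
  rw [← P.r_sq, h]
  simp

theorem q_sq_ne_one (P : QuantumParameter) : P.q ^ 2 ≠ 1 := by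
  intro h
  apply P.q_pow_four_ne_one
  linear_combination (P.q ^ 2 + 1) * h

theorem q_sub_inv_ne_zero (P : QuantumParameter) : P.q - P.q⁻¹ ≠ 0 := by
  intro h
  apply P.q_sq_ne_one
  have := P.q_ne_zero
  field_simp at h
  linear_combination h
end QuantumParameter

/-- If an anti-multiplicative map on a bialgebra satisfies the antipode axioms on a set of algebra
generators, then it satisfies them everywhere. -/
theorem antipode_axioms_of_adjoin {H : Type*} [Ring H] [Bialgebra ℂ H] (S : H →ₐ[ℂ] Hᵐᵒᵖ)
    (S' : H →ₗ[ℂ] H) (hS' : ∀ x, S' x = (S x).unop)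
    (s : Set H) (hs : Algebra.adjoin ℂ s = ⊤)
    (h : ∀ x ∈ s, LinearMap.mul' ℂ H (S'.rTensor H (Coalgebra.comul x)) =
        algebraMap ℂ H (Coalgebra.counit x) ∧
      LinearMap.mul' ℂ H (S'.lTensor H (Coalgebra.comul x)) =
        algebraMap ℂ H (Coalgebra.counit x)) (x : H) :
    LinearMap.mul' ℂ H (S'.rTensor H (Coalgebra.comul x)) =
        algebraMap ℂ H (Coalgebra.counit x) ∧
      LinearMap.mul' ℂ H (S'.lTensor H (Coalgebra.comul x)) =
        algebraMap ℂ H (Coalgebra.counit x) := by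
  have hm : ∀ x y, S' (x * y) = S' y * S' x := fun x y ↦ by simp [hS']
  have h1 : S' 1 = 1 := by simp [hS']
  have key1 : ∀ (t : H ⊗[ℂ] H) (y z : H), LinearMap.mul' ℂ H (S'.rTensor H (t * (y ⊗ₜ z))) =
      S' y * LinearMap.mul' ℂ H (S'.rTensor H t) * z := by
    intro t y z
    induction t with
    | zero => simp
    | tmul u v => simp [hm, mul_assoc]
    | add u v hu hv => simp only [add_mul, map_add, hu, hv, mul_add]
  have key2 : ∀ (t : H ⊗[ℂ] H) (y z : H), LinearMap.mul' ℂ H (S'.lTensor H ((y ⊗ₜ z) * t)) =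
      y * LinearMap.mul' ℂ H (S'.lTensor H t) * S' z := by
    intro t y z
    induction t with
    | zero => simp
    | tmul u v => simp [hm, mul_assoc]
    | add u v hu hv => simp only [add_mul, map_add, hu, hv, mul_add]
  have hx : x ∈ Algebra.adjoin ℂ s := by rw [hs]; trivial
  induction hx using Algebra.adjoin_induction with
  | mem x hx => exact h x hx
  | algebraMap c =>
    simp [Algebra.TensorProduct.one_def, Algebra.algebraMap_eq_smul_one, h1]
  | add x y _ _ hx hy =>
    simp only [map_add, hx.1, hx.2, hy.1, hy.2, and_self]
  | mul x y _ _ hx hy =>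
    have e1 : ∀ u, LinearMap.mul' ℂ H (S'.rTensor H (Coalgebra.comul x * u)) =
        algebraMap ℂ H (Coalgebra.counit x) * LinearMap.mul' ℂ H (S'.rTensor H u) := by
      intro u
      induction u with
      | zero => simp
      | tmul a b =>
        rw [key1, hx.1]
        simp [Algebra.algebraMap_eq_smul_one]
      | add a b ha hb => simp only [mul_add, map_add, ha, hb]
    have e2 : ∀ u, LinearMap.mul' ℂ H (S'.lTensor H (u * Coalgebra.comul y)) =
        LinearMap.mul' ℂ H (S'.lTensor H u) * algebraMap ℂ H (Coalgebra.counit y) := by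
      intro u
      induction u with
      | zero => simp
      | tmul a b =>
        rw [key2, hy.2]
        simp [Algebra.algebraMap_eq_smul_one]
      | add a b ha hb => simp only [add_mul, map_add, ha, hb]
    rw [Bialgebra.comul_mul, Bialgebra.counit_mul, map_mul (algebraMap ℂ H)]
    exact ⟨by rw [e1, hy.1], by rw [e2, hx.2]⟩

/-- Names of the four generators of `𝒪(SL_q(2))`. -/
inductive SLqGen
  | a | b | c | d

open FreeAlgebra in
/-- The defining relations of `𝒪(SL_q(2))`: those of `𝒪(M_q(2))`, and quantum determinant `1`. -/
inductive SLqRel (q : ℂ) : FreeAlgebra ℂ SLqGen → FreeAlgebra ℂ SLqGen → Prop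
  | ab : SLqRel q (ι ℂ .a * ι ℂ .b) (q • (ι ℂ .b * ι ℂ .a))
  | ac : SLqRel q (ι ℂ .a * ι ℂ .c) (q • (ι ℂ .c * ι ℂ .a))
  | bd : SLqRel q (ι ℂ .b * ι ℂ .d) (q • (ι ℂ .d * ι ℂ .b))
  | cd : SLqRel q (ι ℂ .c * ι ℂ .d) (q • (ι ℂ .d * ι ℂ .c))
  | bc : SLqRel q (ι ℂ .b * ι ℂ .c) (ι ℂ .c * ι ℂ .b)
  | ad : SLqRel q (ι ℂ .a * ι ℂ .d - ι ℂ .d * ι ℂ .a) ((q - q⁻¹) • (ι ℂ .b * ι ℂ .c))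
  | det : SLqRel q (ι ℂ .a * ι ℂ .d - q • (ι ℂ .b * ι ℂ .c)) 1

/-- The coordinate algebra `𝒪(SL_q(2))`, by generators and relations. -/
def SLq (P : QuantumParameter) : Type := RingQuot (SLqRel P.q)

/-- A quadruple of elements of an algebra that satisfies the relations of `𝒪(SL_q(2))`. -/
structure IsSLqMatrix {R : Type*} [Ring R] [Algebra ℂ R] (q : ℂ) (a b c d : R) : Prop where
  ab : a * b = q • (b * a)
  ac : a * c = q • (c * a)
  bd : b * d = q • (d * b)
  cd : c * d = q • (d * c)
  bc : b * c = c * b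
  ad : a * d - d * a = (q - q⁻¹) • (b * c)
  det : a * d - q • (b * c) = 1

namespace SLq

variable (P : QuantumParameter)

noncomputable instance : Ring (SLq P) := inferInstanceAs (Ring (RingQuot (SLqRel P.q)))
noncomputable instance : Algebra ℂ (SLq P) :=
  inferInstanceAs (Algebra ℂ (RingQuot (SLqRel P.q)))

/-- The quotient map from the free algebra. -/
noncomputable def mk : FreeAlgebra ℂ SLqGen →ₐ[ℂ] SLq P := RingQuot.mkAlgHom ℂ (SLqRel P.q)

/-- The generator `A`. -/
noncomputable def A : SLq P := mk P (FreeAlgebra.ι ℂ .a)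
/-- The generator `B`. -/
noncomputable def B : SLq P := mk P (FreeAlgebra.ι ℂ .b)
/-- The generator `C`. -/
noncomputable def C : SLq P := mk P (FreeAlgebra.ι ℂ .c)
/-- The generator `D`. -/
noncomputable def D : SLq P := mk P (FreeAlgebra.ι ℂ .d)

theorem isSLqMatrix : IsSLqMatrix P.q (A P) (B P) (C P) (D P) := by
  have h : ∀ {x y}, SLqRel P.q x y → mk P x = mk P y := fun h ↦ RingQuot.mkAlgHom_rel ℂ h
  constructor
  · simpa [A, B] using h .ab
  · simpa [A, C] using h .ac
  · simpa [B, D] using h .bd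
  · simpa [C, D] using h .cd
  · simpa [B, C] using h .bc
  · simpa [A, B, C, D] using h .ad
  · simpa [A, B, C, D] using h .det

variable {P}

/-- The universal property of `𝒪(SL_q(2))`. -/
noncomputable def lift {R : Type*} [Ring R] [Algebra ℂ R] {a b c d : R}
    (h : IsSLqMatrix P.q a b c d) : SLq P →ₐ[ℂ] R :=
  RingQuot.liftAlgHom ℂ ⟨FreeAlgebra.lift ℂ (fun
    | .a => a
    | .b => b
    | .c => c
    | .d => d), by
      intro x y hxy
      cases hxy
      · simpa using h.ab
      · simpa using h.ac
      · simpa using h.bd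
      · simpa using h.cd
      · simpa using h.bc
      · simpa using h.ad
      · simpa using h.det⟩

section lift
variable {R : Type*} [Ring R] [Algebra ℂ R] {a b c d : R} (h : IsSLqMatrix P.q a b c d)

@[simp] theorem lift_A : lift h (A P) = a :=
  (RingQuot.liftAlgHom_mkAlgHom_apply ℂ _ _ _).trans (FreeAlgebra.lift_ι_apply _ _)
@[simp] theorem lift_B : lift h (B P) = b :=
  (RingQuot.liftAlgHom_mkAlgHom_apply ℂ _ _ _).trans (FreeAlgebra.lift_ι_apply _ _)
@[simp] theorem lift_C : lift h (C P) = c :=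
  (RingQuot.liftAlgHom_mkAlgHom_apply ℂ _ _ _).trans (FreeAlgebra.lift_ι_apply _ _)
@[simp] theorem lift_D : lift h (D P) = d :=
  (RingQuot.liftAlgHom_mkAlgHom_apply ℂ _ _ _).trans (FreeAlgebra.lift_ι_apply _ _)

end lift

theorem algHom_ext {R : Type*} [Ring R] [Algebra ℂ R] {f g : SLq P →ₐ[ℂ] R}
    (hA : f (A P) = g (A P)) (hB : f (B P) = g (B P)) (hC : f (C P) = g (C P))
    (hD : f (D P) = g (D P)) : f = g := by
  apply RingQuot.ringQuot_ext'
  apply FreeAlgebra.hom_ext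
  funext x
  cases x
  · exact hA
  · exact hB
  · exact hC
  · exact hD

theorem adjoin_generators : Algebra.adjoin ℂ ({A P, B P, C P, D P} : Set (SLq P)) = ⊤ := by
  have h : (⊤ : Subalgebra ℂ (SLq P)) = (⊤ : Subalgebra ℂ (FreeAlgebra ℂ SLqGen)).map (mk P) := by
    rw [Algebra.map_top]
    exact ((AlgHom.range_eq_top _).2 (RingQuot.mkAlgHom_surjective ℂ (SLqRel P.q))).symm
  rw [h, ← FreeAlgebra.adjoin_range_ι, AlgHom.map_adjoin]
  apply le_antisymm <;> apply Algebra.adjoin_mono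
  · rintro x (rfl | rfl | rfl | rfl)
    · exact ⟨_, ⟨.a, rfl⟩, rfl⟩
    · exact ⟨_, ⟨.b, rfl⟩, rfl⟩
    · exact ⟨_, ⟨.c, rfl⟩, rfl⟩
    · exact ⟨_, ⟨.d, rfl⟩, rfl⟩
  · rintro x ⟨_, ⟨g, rfl⟩, rfl⟩
    cases g
    · exact Or.inl rfl
    · exact Or.inr (Or.inl rfl)
    · exact Or.inr (Or.inr (Or.inl rfl))
    · exact Or.inr (Or.inr (Or.inr rfl))

section relations
variable (P)
theorem rel_ba : A P * B P = P.q • (B P * A P) := (isSLqMatrix P).ab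
theorem rel_ca : A P * C P = P.q • (C P * A P) := (isSLqMatrix P).ac
theorem rel_db : D P * B P = P.q⁻¹ • (B P * D P) := by
  rw [(isSLqMatrix P).bd, smul_smul, inv_mul_cancel₀ P.q_ne_zero, one_smul]
theorem rel_dc : D P * C P = P.q⁻¹ • (C P * D P) := by
  rw [(isSLqMatrix P).cd, smul_smul, inv_mul_cancel₀ P.q_ne_zero, one_smul]
theorem rel_cb : C P * B P = B P * C P := (isSLqMatrix P).bc.symm
theorem rel_ad : A P * D P = 1 + P.q • (B P * C P) := by
  rw [← (isSLqMatrix P).det]; abel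
theorem rel_da : D P * A P = 1 + P.q⁻¹ • (B P * C P) := by
  have h := (isSLqMatrix P).ad
  rw [rel_ad, sub_eq_iff_eq_add] at h
  rw [← sub_eq_iff_eq_add'] at h
  rw [← h]; module
end relations

theorem comul_isSLqMatrix : IsSLqMatrix P.q
    (A P ⊗ₜ[ℂ] A P + B P ⊗ₜ[ℂ] C P) (A P ⊗ₜ[ℂ] B P + B P ⊗ₜ[ℂ] D P)
    (C P ⊗ₜ[ℂ] A P + D P ⊗ₜ[ℂ] C P) (C P ⊗ₜ[ℂ] B P + D P ⊗ₜ[ℂ] D P) := by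
  have hq := P.q_ne_zero
  constructor <;>
  simp only [mul_add, add_mul, Algebra.TensorProduct.tmul_mul_tmul, rel_ba, rel_ca, rel_db, rel_dc,
    rel_cb, rel_ad, rel_da, TensorProduct.tmul_add, TensorProduct.add_tmul,
    TensorProduct.tmul_smul, ← TensorProduct.smul_tmul', Algebra.TensorProduct.one_def] <;>
  match_scalars <;> field_simp <;> ring

theorem counit_isSLqMatrix : IsSLqMatrix P.q (1 : ℂ) 0 0 1 := by
  constructor <;> simp

theorem antipode_isSLqMatrix : IsSLqMatrix P.q (MulOpposite.op (D P))
    (MulOpposite.op (-P.q⁻¹ • B P)) (MulOpposite.op (-P.q • C P)) (MulOpposite.op (A P)) := by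
  have hq := P.q_ne_zero
  constructor <;> apply MulOpposite.unop_injective <;>
  simp only [MulOpposite.unop_mul, MulOpposite.unop_op, MulOpposite.unop_smul,
    MulOpposite.unop_sub, MulOpposite.unop_one, smul_mul_assoc, mul_smul_comm, rel_ba, rel_ca,
    rel_db, rel_dc, rel_cb, rel_ad, rel_da] <;>
  match_scalars <;> field_simp <;> ring

/-- The bialgebra structure with `Δ(u i j) = ∑ k, u i k ⊗ u k j` and `ε(u i j) = δ i j`, where
`u` is the matrix with rows `(A, B)` and `(C, D)`. -/
noncomputable instance : Bialgebra ℂ (SLq P) :=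
  Bialgebra.ofAlgHom (lift comul_isSLqMatrix) (lift counit_isSLqMatrix)
    (by
      apply algHom_ext <;>
      simp [TensorProduct.add_tmul, TensorProduct.tmul_add] <;> abel)
    (by apply algHom_ext <;> simp)
    (by apply algHom_ext <;> simp)

@[simp] theorem comul_A : Coalgebra.comul (R := ℂ) (A P) = A P ⊗ₜ[ℂ] A P + B P ⊗ₜ[ℂ] C P :=
  lift_A comul_isSLqMatrix
@[simp] theorem comul_B : Coalgebra.comul (R := ℂ) (B P) = A P ⊗ₜ[ℂ] B P + B P ⊗ₜ[ℂ] D P :=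
  lift_B comul_isSLqMatrix
@[simp] theorem comul_C : Coalgebra.comul (R := ℂ) (C P) = C P ⊗ₜ[ℂ] A P + D P ⊗ₜ[ℂ] C P :=
  lift_C comul_isSLqMatrix
@[simp] theorem comul_D : Coalgebra.comul (R := ℂ) (D P) = C P ⊗ₜ[ℂ] B P + D P ⊗ₜ[ℂ] D P :=
  lift_D comul_isSLqMatrix
@[simp] theorem counit_A : Coalgebra.counit (R := ℂ) (A P) = 1 := lift_A counit_isSLqMatrix
@[simp] theorem counit_B : Coalgebra.counit (R := ℂ) (B P) = 0 := lift_B counit_isSLqMatrix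
@[simp] theorem counit_C : Coalgebra.counit (R := ℂ) (C P) = 0 := lift_C counit_isSLqMatrix
@[simp] theorem counit_D : Coalgebra.counit (R := ℂ) (D P) = 1 := lift_D counit_isSLqMatrix

/-- The antipode `S(A) = D`, `S(B) = -q⁻¹ B`, `S(C) = -q C`, `S(D) = A`. -/
noncomputable def antipodeMap (P : QuantumParameter) : SLq P →ₗ[ℂ] SLq P :=
  (MulOpposite.opLinearEquiv ℂ).symm.toLinearMap ∘ₗ (lift (antipode_isSLqMatrix (P := P))).toLinearMap

/-- The Hopf algebra `𝒪(SL_q(2))`. -/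
noncomputable instance : HopfAlgebra ℂ (SLq P) :=
  have h := antipode_axioms_of_adjoin (lift (antipode_isSLqMatrix (P := P))) (antipodeMap P)
    (fun _ ↦ rfl) _ adjoin_generators (by
      have hq := P.q_ne_zero
      rintro x (rfl | rfl | rfl | rfl) <;>
      simp [antipodeMap, rel_ba, rel_ca, rel_db, rel_dc, rel_cb, rel_ad, rel_da, smul_smul, hq])
  { antipode := antipodeMap P
    mul_antipode_rTensor_comul := LinearMap.ext fun x ↦ (h x).1
    mul_antipode_lTensor_comul := LinearMap.ext fun x ↦ (h x).2 }

end SLq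

/-- Names of the generators `E, F, K, K⁻¹`; here `L` stands for `K⁻¹`. -/
inductive UqGen
  | E | F | K | L

open FreeAlgebra in
/-- The defining relations: `K K⁻¹ = K⁻¹ K = 1`, `K E K⁻¹ = q E`, `K F K⁻¹ = q⁻¹ F`,
`E F - F E = (K² - K⁻²) / (q - q⁻¹)`. -/
inductive UqRel (q : ℂ) : FreeAlgebra ℂ UqGen → FreeAlgebra ℂ UqGen → Prop
  | KL : UqRel q (ι ℂ .K * ι ℂ .L) 1
  | LK : UqRel q (ι ℂ .L * ι ℂ .K) 1
  | KEL : UqRel q (ι ℂ .K * ι ℂ .E * ι ℂ .L) (q • ι ℂ .E)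
  | KFL : UqRel q (ι ℂ .K * ι ℂ .F * ι ℂ .L) (q⁻¹ • ι ℂ .F)
  | EF : UqRel q (ι ℂ .E * ι ℂ .F - ι ℂ .F * ι ℂ .E)
      ((q - q⁻¹)⁻¹ • (ι ℂ .K ^ 2 - ι ℂ .L ^ 2))

/-- The quantized enveloping algebra `Ŭ_q(sl₂)`, by generators and relations. -/
def Uq (P : QuantumParameter) : Type := RingQuot (UqRel P.q)

/-- A quadruple of elements of an algebra that satisfies the relations of `Ŭ_q(sl₂)`. -/
structure IsUqTuple {R : Type*} [Ring R] [Algebra ℂ R] (q : ℂ) (e f k l : R) : Prop where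
  kl : k * l = 1
  lk : l * k = 1
  kel : k * e * l = q • e
  kfl : k * f * l = q⁻¹ • f
  ef : e * f - f * e = (q - q⁻¹)⁻¹ • (k ^ 2 - l ^ 2)

namespace Uq

variable (P : QuantumParameter)

noncomputable instance : Ring (Uq P) := inferInstanceAs (Ring (RingQuot (UqRel P.q)))
noncomputable instance : Algebra ℂ (Uq P) :=
  inferInstanceAs (Algebra ℂ (RingQuot (UqRel P.q)))

/-- The quotient map from the free algebra. -/
noncomputable def mk : FreeAlgebra ℂ UqGen →ₐ[ℂ] Uq P := RingQuot.mkAlgHom ℂ (UqRel P.q)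

/-- The generator `E`. -/
noncomputable def E : Uq P := mk P (FreeAlgebra.ι ℂ .E)
/-- The generator `F`. -/
noncomputable def F : Uq P := mk P (FreeAlgebra.ι ℂ .F)
/-- The generator `K`. -/
noncomputable def K : Uq P := mk P (FreeAlgebra.ι ℂ .K)
/-- The generator `K⁻¹`. -/
noncomputable def Kinv : Uq P := mk P (FreeAlgebra.ι ℂ .L)

theorem isUqTuple : IsUqTuple P.q (E P) (F P) (K P) (Kinv P) := by
  have h : ∀ {x y}, UqRel P.q x y → mk P x = mk P y := fun h ↦ RingQuot.mkAlgHom_rel ℂ h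
  constructor
  · simpa [K, Kinv] using h .KL
  · simpa [K, Kinv] using h .LK
  · simpa [K, Kinv, E] using h .KEL
  · simpa [K, Kinv, F] using h .KFL
  · simpa [K, Kinv, E, F] using h .EF

variable {P}

/-- The universal property of `Ŭ_q(sl₂)`. -/
noncomputable def lift {R : Type*} [Ring R] [Algebra ℂ R] {e f k l : R}
    (h : IsUqTuple P.q e f k l) : Uq P →ₐ[ℂ] R :=
  RingQuot.liftAlgHom ℂ ⟨FreeAlgebra.lift ℂ (fun
    | .E => e
    | .F => f
    | .K => k
    | .L => l), by
      intro x y hxy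
      cases hxy
      · simpa using h.kl
      · simpa using h.lk
      · simpa using h.kel
      · simpa using h.kfl
      · simpa using h.ef⟩

section lift
variable {R : Type*} [Ring R] [Algebra ℂ R] {e f k l : R} (h : IsUqTuple P.q e f k l)

@[simp] theorem lift_E : lift h (E P) = e :=
  (RingQuot.liftAlgHom_mkAlgHom_apply ℂ _ _ _).trans (FreeAlgebra.lift_ι_apply _ _)
@[simp] theorem lift_F : lift h (F P) = f :=
  (RingQuot.liftAlgHom_mkAlgHom_apply ℂ _ _ _).trans (FreeAlgebra.lift_ι_apply _ _)
@[simp] theorem lift_K : lift h (K P) = k :=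
  (RingQuot.liftAlgHom_mkAlgHom_apply ℂ _ _ _).trans (FreeAlgebra.lift_ι_apply _ _)
@[simp] theorem lift_Kinv : lift h (Kinv P) = l :=
  (RingQuot.liftAlgHom_mkAlgHom_apply ℂ _ _ _).trans (FreeAlgebra.lift_ι_apply _ _)

end lift

theorem algHom_ext {R : Type*} [Ring R] [Algebra ℂ R] {f g : Uq P →ₐ[ℂ] R}
    (hE : f (E P) = g (E P)) (hF : f (F P) = g (F P)) (hK : f (K P) = g (K P))
    (hL : f (Kinv P) = g (Kinv P)) : f = g := by
  apply RingQuot.ringQuot_ext'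
  apply FreeAlgebra.hom_ext
  funext x
  cases x
  · exact hE
  · exact hF
  · exact hK
  · exact hL

theorem adjoin_generators : Algebra.adjoin ℂ ({E P, F P, K P, Kinv P} : Set (Uq P)) = ⊤ := by
  have h : (⊤ : Subalgebra ℂ (Uq P)) = (⊤ : Subalgebra ℂ (FreeAlgebra ℂ UqGen)).map (mk P) := by
    rw [Algebra.map_top]
    exact ((AlgHom.range_eq_top _).2 (RingQuot.mkAlgHom_surjective ℂ (UqRel P.q))).symm
  rw [h, ← FreeAlgebra.adjoin_range_ι, AlgHom.map_adjoin]
  apply le_antisymm <;> apply Algebra.adjoin_mono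
  · rintro x (rfl | rfl | rfl | rfl)
    · exact ⟨_, ⟨.E, rfl⟩, rfl⟩
    · exact ⟨_, ⟨.F, rfl⟩, rfl⟩
    · exact ⟨_, ⟨.K, rfl⟩, rfl⟩
    · exact ⟨_, ⟨.L, rfl⟩, rfl⟩
  · rintro x ⟨_, ⟨g, rfl⟩, rfl⟩
    cases g
    · exact Or.inl rfl
    · exact Or.inr (Or.inl rfl)
    · exact Or.inr (Or.inr (Or.inl rfl))
    · exact Or.inr (Or.inr (Or.inr rfl))

section relations
variable (P)
theorem rel_kl : K P * Kinv P = 1 := (isUqTuple P).kl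
theorem rel_lk : Kinv P * K P = 1 := (isUqTuple P).lk
theorem rel_ke : K P * E P = P.q • (E P * K P) := by
  rw [← smul_mul_assoc, ← (isUqTuple P).kel, mul_assoc, rel_lk, mul_one]
theorem rel_kf : K P * F P = P.q⁻¹ • (F P * K P) := by
  rw [← smul_mul_assoc, ← (isUqTuple P).kfl, mul_assoc, rel_lk, mul_one]
theorem rel_le : Kinv P * E P = P.q⁻¹ • (E P * Kinv P) := by
  have h : E P = P.q⁻¹ • (K P * E P * Kinv P) := by
    rw [(isUqTuple P).kel, smul_smul, inv_mul_cancel₀ P.q_ne_zero, one_smul]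
  nth_rw 1 [h]
  rw [mul_smul_comm, ← mul_assoc, ← mul_assoc, rel_lk, one_mul]
theorem rel_lf : Kinv P * F P = P.q • (F P * Kinv P) := by
  have h : F P = P.q • (K P * F P * Kinv P) := by
    rw [(isUqTuple P).kfl, smul_smul, mul_inv_cancel₀ P.q_ne_zero, one_smul]
  nth_rw 1 [h]
  rw [mul_smul_comm, ← mul_assoc, ← mul_assoc, rel_lk, one_mul]
theorem rel_ef : E P * F P = F P * E P + (P.q - P.q⁻¹)⁻¹ • (K P * K P - Kinv P * Kinv P) := by
  have h := (isUqTuple P).ef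
  rw [sub_eq_iff_eq_add'] at h
  rw [h, sq, sq]
theorem rel_kel : K P * (E P * Kinv P) = P.q • E P := by rw [← mul_assoc, (isUqTuple P).kel]
theorem rel_kfl : K P * (F P * Kinv P) = P.q⁻¹ • F P := by rw [← mul_assoc, (isUqTuple P).kfl]
end relations

theorem comul_isUqTuple : IsUqTuple P.q
    (E P ⊗ₜ[ℂ] K P + Kinv P ⊗ₜ[ℂ] E P) (F P ⊗ₜ[ℂ] K P + Kinv P ⊗ₜ[ℂ] F P)
    (K P ⊗ₜ[ℂ] K P) (Kinv P ⊗ₜ[ℂ] Kinv P) := by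
  have hq := P.q_ne_zero
  constructor
  · simp [rel_kl, Algebra.TensorProduct.one_def]
  · simp [rel_lk, Algebra.TensorProduct.one_def]
  · simp [mul_add, add_mul, mul_assoc, rel_kel, rel_kl, TensorProduct.smul_tmul']
  · simp [mul_add, add_mul, mul_assoc, rel_kfl, rel_kl, TensorProduct.smul_tmul']
  · generalize hc : (P.q - P.q⁻¹)⁻¹ = c
    simp only [mul_add, add_mul, Algebra.TensorProduct.tmul_mul_tmul, rel_ke, rel_kf, rel_le,
      rel_lf, rel_ef, hc, sq, TensorProduct.tmul_add, TensorProduct.add_tmul,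
      TensorProduct.tmul_sub, TensorProduct.sub_tmul,
      TensorProduct.tmul_smul, ← TensorProduct.smul_tmul']
    module

theorem counit_isUqTuple : IsUqTuple P.q (0 : ℂ) 0 1 1 := by
  constructor <;> simp

theorem antipode_isUqTuple : IsUqTuple P.q (MulOpposite.op (-P.q • E P))
    (MulOpposite.op (-P.q⁻¹ • F P)) (MulOpposite.op (Kinv P)) (MulOpposite.op (K P)) := by
  have hq := P.q_ne_zero
  constructor <;> apply MulOpposite.unop_injective
  · simp [rel_kl]
  · simp [rel_lk]
  · simp [rel_kel]
  · simp [rel_kfl]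
  · generalize hc : (P.q - P.q⁻¹)⁻¹ = c
    simp only [MulOpposite.unop_mul, MulOpposite.unop_op, MulOpposite.unop_smul,
      MulOpposite.unop_sub, smul_mul_assoc, mul_smul_comm, rel_ef, sq, hc]
    match_scalars <;> field_simp <;> ring

/-- The bialgebra structure with `Δ(K) = K ⊗ K`, `Δ(E) = E ⊗ K + K⁻¹ ⊗ E`,
`Δ(F) = F ⊗ K + K⁻¹ ⊗ F`, `ε(K) = 1`, `ε(E) = ε(F) = 0`. -/
noncomputable instance : Bialgebra ℂ (Uq P) :=
  Bialgebra.ofAlgHom (lift comul_isUqTuple) (lift counit_isUqTuple)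
    (by
      apply algHom_ext
      · simp [TensorProduct.add_tmul, TensorProduct.tmul_add]; abel
      · simp [TensorProduct.add_tmul, TensorProduct.tmul_add]; abel
      · simp
      · simp)
    (by apply algHom_ext <;> simp)
    (by apply algHom_ext <;> simp)

@[simp] theorem comul_E : Coalgebra.comul (R := ℂ) (E P) = E P ⊗ₜ[ℂ] K P + Kinv P ⊗ₜ[ℂ] E P :=
  lift_E comul_isUqTuple
@[simp] theorem comul_F : Coalgebra.comul (R := ℂ) (F P) = F P ⊗ₜ[ℂ] K P + Kinv P ⊗ₜ[ℂ] F P :=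
  lift_F comul_isUqTuple
@[simp] theorem comul_K : Coalgebra.comul (R := ℂ) (K P) = K P ⊗ₜ[ℂ] K P :=
  lift_K comul_isUqTuple
@[simp] theorem comul_Kinv : Coalgebra.comul (R := ℂ) (Kinv P) = Kinv P ⊗ₜ[ℂ] Kinv P :=
  lift_Kinv comul_isUqTuple
@[simp] theorem counit_E : Coalgebra.counit (R := ℂ) (E P) = 0 := lift_E counit_isUqTuple
@[simp] theorem counit_F : Coalgebra.counit (R := ℂ) (F P) = 0 := lift_F counit_isUqTuple
@[simp] theorem counit_K : Coalgebra.counit (R := ℂ) (K P) = 1 := lift_K counit_isUqTuple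
@[simp] theorem counit_Kinv : Coalgebra.counit (R := ℂ) (Kinv P) = 1 := lift_Kinv counit_isUqTuple

/-- The antipode `S(K) = K⁻¹`, `S(E) = -q E`, `S(F) = -q⁻¹ F`. -/
noncomputable def antipodeMap (P : QuantumParameter) : Uq P →ₗ[ℂ] Uq P :=
  (MulOpposite.opLinearEquiv ℂ).symm.toLinearMap ∘ₗ (lift (antipode_isUqTuple (P := P))).toLinearMap

/-- The Hopf algebra `Ŭ_q(sl₂)`. -/
noncomputable instance : HopfAlgebra ℂ (Uq P) :=
  have h := antipode_axioms_of_adjoin (lift (antipode_isUqTuple (P := P))) (antipodeMap P)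
    (fun _ ↦ rfl) _ adjoin_generators (by
      have hq := P.q_ne_zero
      rintro x (rfl | rfl | rfl | rfl) <;>
      simp [antipodeMap, rel_kl, rel_lk, rel_ke, rel_kf, rel_le, rel_lf, smul_smul, hq])
  { antipode := antipodeMap P
    mul_antipode_rTensor_comul := LinearMap.ext fun x ↦ (h x).1
    mul_antipode_lTensor_comul := LinearMap.ext fun x ↦ (h x).2 }

end Uq

namespace DualPairing
variable (P : QuantumParameter)

theorem rep_isUqTuple : IsUqTuple P.q (!![0, 0; 1, 0] : Matrix (Fin 2) (Fin 2) ℂ) !![0, 1; 0, 0]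
    !![P.r⁻¹, 0; 0, P.r] !![P.r, 0; 0, P.r⁻¹] := by
  have hr := P.r_ne_zero
  have hq := P.q_ne_zero
  have h := P.q_sub_inv_ne_zero
  have hs := P.r_sq
  constructor
  · simp [hr, Matrix.one_fin_two]
  · simp [hr, Matrix.one_fin_two]
  · ext i j
    fin_cases i <;> fin_cases j <;> simp [← sq, hs]
  · ext i j
    fin_cases i <;> fin_cases j <;> simp [← sq, hs]
  · have hk : P.r * P.r = P.q := by rw [← sq, hs]
    have hk' : P.r⁻¹ * P.r⁻¹ = P.q⁻¹ := by rw [← mul_inv, hk]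
    have h2 : (P.q - P.q⁻¹)⁻¹ * (P.q⁻¹ - P.q) = -1 := by
      rw [← neg_sub P.q, mul_neg, inv_mul_cancel₀ h]
    ext i j
    fin_cases i <;> fin_cases j <;> simp [sq, hk, hk', h, h2]

/-- The two-dimensional representation of `Ŭ_q(sl₂)`. -/
noncomputable def rep : Uq P →ₐ[ℂ] Matrix (Fin 2) (Fin 2) ℂ := Uq.lift (rep_isUqTuple P)

/-- The matrix coefficients of the two-dimensional representation, as elements of the convolution
algebra of linear functionals on `Ŭ_q(sl₂)`. -/
noncomputable def coeff (i j : Fin 2) : WithConv (Uq P →ₗ[ℂ] ℂ) :=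
  WithConv.toConv (Matrix.entryLinearMap ℂ ℂ i j ∘ₗ (rep P).toLinearMap)

theorem coeff_apply (i j : Fin 2) (u : Uq P) : coeff P i j u = rep P u i j := rfl

theorem coeff_mul_apply_mul (i j k l : Fin 2) (u v : Uq P) :
    (coeff P i k * coeff P j l) (u * v) =
      ∑ m, ∑ n, (coeff P i m * coeff P j n) u * (coeff P m k * coeff P n l) v := by
  simp only [LinearMap.convMul_apply, Bialgebra.comul_mul]
  generalize Coalgebra.comul (R := ℂ) u = s
  generalize Coalgebra.comul (R := ℂ) v = t
  induction s with
  | zero => simp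
  | add s₁ s₂ h₁ h₂ => simp only [add_mul, map_add, h₁, h₂, Finset.sum_add_distrib]
  | tmul a b =>
    induction t with
    | zero => simp
    | add s₁ s₂ h₁ h₂ => simp only [mul_add, map_add, h₁, h₂, Finset.sum_add_distrib]
    | tmul c d =>
      simp [coeff, Matrix.mul_apply, Fin.sum_univ_two]
      ring

theorem coeff_det (u : Uq P) :
    ∀ i j : Fin 2, (coeff P i 0 * coeff P j 1) u - P.q * (coeff P i 1 * coeff P j 0) u =
        Coalgebra.counit (R := ℂ) u * !![0, 1; -P.q, 0] i j ∧
      (coeff P 0 i * coeff P 1 j) u - P.q * (coeff P 1 i * coeff P 0 j) u =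
        Coalgebra.counit (R := ℂ) u * !![0, 1; -P.q, 0] i j := by
  have hu : u ∈ Algebra.adjoin ℂ ({Uq.E P, Uq.F P, Uq.K P, Uq.Kinv P} : Set (Uq P)) := by
    rw [Uq.adjoin_generators]; trivial
  have hr := P.r_ne_zero
  have hs := P.r_sq
  induction hu using Algebra.adjoin_induction with
  | mem x hx =>
    rcases hx with (rfl | rfl | rfl | rfl) <;> simp [coeff, rep, Fin.forall_fin_two, ← hs] <;>
    field_simp <;> simp
  | algebraMap c =>
    simp [Fin.forall_fin_two, Algebra.algebraMap_eq_smul_one, Algebra.TensorProduct.one_def, coeff,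
      mul_comm]
  | add x y _ _ hx hy =>
    intro i j
    have h1 := hx i j
    have h2 := hy i j
    simp only [map_add]
    constructor
    · linear_combination h1.1 + h2.1
    · linear_combination h1.2 + h2.2
  | mul x y _ _ hx hy =>
    intro i j
    simp only [coeff_mul_apply_mul, Bialgebra.counit_mul, Fin.sum_univ_two]
    have a := (hx i j).1
    have a' := (hy i j).2
    have b := fun m n ↦ (hy m n).1
    have b' := fun m n ↦ (hx m n).2
    simp only [Fin.forall_fin_two] at b b'
    obtain ⟨⟨b00, b01⟩, b10, b11⟩ := b
    obtain ⟨⟨c00, c01⟩, c10, c11⟩ := b'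
    simp at b00 b01 b10 b11 c00 c01 c10 c11
    constructor
    · linear_combination (coeff P i 0 * coeff P j 0) x * b00 +
        (coeff P i 0 * coeff P j 1) x * b01 + (coeff P i 1 * coeff P j 0) x * b10 +
        (coeff P i 1 * coeff P j 1) x * b11 + Coalgebra.counit (R := ℂ) y * a
    · linear_combination (coeff P 0 i * coeff P 0 j) y * c00 +
        (coeff P 0 i * coeff P 1 j) y * c01 + (coeff P 1 i * coeff P 0 j) y * c10 +
        (coeff P 1 i * coeff P 1 j) y * c11 + Coalgebra.counit (R := ℂ) x * a'

theorem coeff_isSLqMatrix :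
    IsSLqMatrix P.q (coeff P 0 0) (coeff P 0 1) (coeff P 1 0) (coeff P 1 1) := by
  have hq := P.q_ne_zero
  have hqq : P.q * P.q⁻¹ = 1 := mul_inv_cancel₀ hq
  constructor <;> ext u <;> have h := coeff_det P u <;> simp [Fin.forall_fin_two] at h ⊢ <;>
    obtain ⟨⟨⟨h1, h2⟩, h3, h4⟩, ⟨h5, h6⟩, h7, h8⟩ := h
  · linear_combination h1
  · linear_combination h2
  · linear_combination h8
  · linear_combination h7
  · apply mul_left_cancel₀ hq
    linear_combination h4 - h3
  · generalize LinearMap.mul' ℂ ℂ (TensorProduct.map (coeff P 0 1).ofConv (coeff P 1 0).ofConv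
      (Coalgebra.comul u)) = z at *
    apply mul_left_cancel₀ hq
    linear_combination P.q * h3 + h6 + z * hqq
  · linear_combination h3

end DualPairing
/-- The dual pairing `⟨f, x⟩` of `Ŭ_q(sl₂)` and `𝒪(SL_q(2))`: the generators `A, B, C, D` are paired
with `f` as the matrix coefficients of the two-dimensional representation, and products in
`𝒪(SL_q(2))` are sent to convolution products of functionals on `Ŭ_q(sl₂)`. -/
noncomputable def dualPairing (P : QuantumParameter) : Uq P →ₗ[ℂ] SLq P →ₗ[ℂ] ℂ :=
  ((WithConv.linearEquiv ℂ (Uq P →ₗ[ℂ] ℂ)).toLinearMap ∘ₗ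
    (SLq.lift (DualPairing.coeff_isSLqMatrix P)).toLinearMap).flip

/-- A dual pairing of two bialgebras. -/
structure IsDualPairing {U H : Type*} [Ring U] [Bialgebra ℂ U] [Ring H] [Bialgebra ℂ H]
    (p : U →ₗ[ℂ] H →ₗ[ℂ] ℂ) : Prop where
  apply_mul : ∀ f a b, p f (a * b) =
    LinearMap.mul' ℂ ℂ (TensorProduct.map (p.flip a) (p.flip b) (Coalgebra.comul f))
  mul_apply : ∀ f g a, p (f * g) a =
    LinearMap.mul' ℂ ℂ (TensorProduct.map (p f) (p g) (Coalgebra.comul a))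
  apply_one : ∀ f, p f 1 = Coalgebra.counit f
  one_apply : ∀ a, p 1 a = Coalgebra.counit a

/-- The elements `X₀ = q^(-1/2) F K`, `X₁ = (1 - q⁻²)⁻¹ (ε - K⁴)`, `X₂ = q^(1/2) E K` of
`Ŭ_q(sl₂)`. The counit `ε` of `𝒪(SL_q(2))` is the functional given by the unit of `Ŭ_q(sl₂)`. -/
noncomputable def tangentVector (P : QuantumParameter) : Fin 3 → Uq P :=
  ![P.r⁻¹ • (Uq.F P * Uq.K P), (1 - (P.q ^ 2)⁻¹)⁻¹ • (1 - Uq.K P ^ 4), P.r • (Uq.E P * Uq.K P)]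

/-- The three `q`-commutation relations for a triple `X₀, X₁, X₂` in an algebra:
`q² X₁ X₀ - q⁻² X₀ X₁ = (1 + q²) X₀`, `q² X₂ X₁ - q⁻² X₁ X₂ = (1 + q²) X₂`,
`q X₂ X₀ - q⁻¹ X₀ X₂ = -q⁻¹ X₁`. -/
def QCommutationRelations {R : Type*} [Ring R] [Algebra ℂ R] (q : ℂ) (X : Fin 3 → R) : Prop :=
  q ^ 2 • (X 1 * X 0) - (q ^ 2)⁻¹ • (X 0 * X 1) = (1 + q ^ 2) • X 0 ∧
  q ^ 2 • (X 2 * X 1) - (q ^ 2)⁻¹ • (X 1 * X 2) = (1 + q ^ 2) • X 2 ∧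
  q • (X 2 * X 0) - q⁻¹ • (X 0 * X 2) = -q⁻¹ • X 1

/-- The linear functionals on `𝒪(SL_q(2))` given by the elements `X₀, X₁, X₂`. -/
noncomputable def tangentFunctional (P : QuantumParameter) (j : Fin 3) : SLq P →ₗ[ℂ] ℂ :=
  dualPairing P (tangentVector P j)

section Calculus

variable (H : Type*) [Ring H] [HopfAlgebra ℂ H]
  (Γ : Type*) [AddCommGroup Γ] [Module ℂ Γ] [Module H Γ] [Module Hᵐᵒᵖ Γ]
  [IsScalarTower ℂ H Γ] [IsScalarTower ℂ Hᵐᵒᵖ Γ] [SMulCommClass H Hᵐᵒᵖ Γ]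

/-- A left-covariant first order differential calculus over the Hopf algebra `H`, on the
`H`-bimodule `Γ`. The right action of `x` on `ρ` is written `MulOpposite.op x • ρ`. -/
structure LeftCovariantFODC where
  /-- The differential. -/
  d : H →ₗ[ℂ] Γ
  leibniz : ∀ x y, d (x * y) = x • d y + MulOpposite.op y • d x
  span_eq_top : Submodule.span ℂ {ρ : Γ | ∃ x y z : H, ρ = x • MulOpposite.op z • d y} = ⊤
  /-- The left coaction `Δ_L`. -/
  coact : Γ →ₗ[ℂ] H ⊗[ℂ] Γ
  /-- `Δ_L(x dy) = Δ(x) (id ⊗ d)(Δ(y))`, where `(x ⊗ y) (z ⊗ ρ) = x z ⊗ y ρ`. -/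
  coact_smul_d : ∀ x y, coact (x • d y) =
    TensorProduct.map₂ (LinearMap.mul ℂ H) (Algebra.lsmul ℂ ℂ Γ).toLinearMap
      (Coalgebra.comul x) (TensorProduct.map LinearMap.id d (Coalgebra.comul y))

/-- The defining relations of the tensor algebra of the `H`-bimodule `Γ` over `H`: its degree zero
part is the algebra `H`, and products of elements of `H` and `Γ` are given by the bimodule
structure. -/
inductive BimoduleTensorRel : TensorAlgebra ℂ (H × Γ) → TensorAlgebra ℂ (H × Γ) → Prop
  | one : BimoduleTensorRel (TensorAlgebra.ι ℂ ((1 : H), (0 : Γ))) 1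
  | mul (x y : H) : BimoduleTensorRel
      (TensorAlgebra.ι ℂ (x, (0 : Γ)) * TensorAlgebra.ι ℂ (y, (0 : Γ)))
      (TensorAlgebra.ι ℂ (x * y, (0 : Γ)))
  | left (x : H) (ρ : Γ) : BimoduleTensorRel
      (TensorAlgebra.ι ℂ (x, (0 : Γ)) * TensorAlgebra.ι ℂ ((0 : H), ρ))
      (TensorAlgebra.ι ℂ ((0 : H), x • ρ))
  | right (ρ : Γ) (x : H) : BimoduleTensorRel
      (TensorAlgebra.ι ℂ ((0 : H), ρ) * TensorAlgebra.ι ℂ (x, (0 : Γ)))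
      (TensorAlgebra.ι ℂ ((0 : H), MulOpposite.op x • ρ))

/-- The tensor algebra `T_H(Γ) = H ⊕ Γ ⊕ (Γ ⊗_H Γ) ⊕ ⋯` of the `H`-bimodule `Γ`. -/
def BimoduleTensorAlgebra : Type _ := RingQuot (BimoduleTensorRel H Γ)

noncomputable instance : Ring (BimoduleTensorAlgebra H Γ) :=
  inferInstanceAs (Ring (RingQuot (BimoduleTensorRel H Γ)))

noncomputable instance : Algebra ℂ (BimoduleTensorAlgebra H Γ) :=
  inferInstanceAs (Algebra ℂ (RingQuot (BimoduleTensorRel H Γ)))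

/-- The map `H → T_H(Γ)`. -/
noncomputable def BimoduleTensorAlgebra.ofScalar : H →ₗ[ℂ] BimoduleTensorAlgebra H Γ :=
  (RingQuot.mkAlgHom ℂ (BimoduleTensorRel H Γ)).toLinearMap ∘ₗ TensorAlgebra.ι ℂ ∘ₗ
    LinearMap.inl ℂ H Γ

/-- The map `Γ → T_H(Γ)`. -/
noncomputable def BimoduleTensorAlgebra.ofForm : Γ →ₗ[ℂ] BimoduleTensorAlgebra H Γ :=
  (RingQuot.mkAlgHom ℂ (BimoduleTensorRel H Γ)).toLinearMap ∘ₗ TensorAlgebra.ι ℂ ∘ₗ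
    LinearMap.inr ℂ H Γ

namespace LeftCovariantFODC

variable {H Γ} (c : LeftCovariantFODC H Γ)

/-- The space of left-invariant one-forms: those `ρ` with `Δ_L(ρ) = 1 ⊗ ρ`. -/
noncomputable def inv : Submodule ℂ Γ := LinearMap.eqLocus c.coact (TensorProduct.mk ℂ H Γ 1)

/-- The map `ω(x) = ∑ S(x₁) dx₂` from `H` to one-forms. -/
noncomputable def omega : H →ₗ[ℂ] Γ :=
  TensorProduct.lift ((Algebra.lsmul ℂ ℂ Γ).toLinearMap.compl₁₂ (HopfAlgebra.antipode ℂ) c.d) ∘ₗ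
    Coalgebra.comul

/-- The right ideal `R = {x ∈ ker ε | ω(x) = 0}` associated with the calculus. -/
noncomputable def idealR : Submodule ℂ H :=
  LinearMap.ker (Coalgebra.counit (R := ℂ) (A := H)) ⊓ LinearMap.ker c.omega

/-- The quantum tangent space: the functionals that vanish at `1` and on `R`. -/
def tangentSpace : Submodule ℂ (H →ₗ[ℂ] ℂ) where
  carrier := {X | X 1 = 0 ∧ ∀ x ∈ c.idealR, X x = 0}
  add_mem' hX hY := ⟨by simp [hX.1, hY.1], fun x hx ↦ by simp [hX.2 x hx, hY.2 x hx]⟩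
  zero_mem' := ⟨rfl, fun _ _ ↦ rfl⟩
  smul_mem' a X hX := ⟨by simp [hX.1], fun x hx ↦ by simp [hX.2 x hx]⟩

/-- `θ` is a basis of the space of left-invariant one-forms which is dual to the family `X` of
functionals for the pairing given by `(X, x dy) = ε(x) X(y)`. -/
structure IsDualBasis {ι : Type*} [DecidableEq ι] (X : ι → H →ₗ[ℂ] ℂ) (θ : ι → Γ) : Prop where
  linearIndependent : LinearIndependent ℂ θ
  span_eq : Submodule.span ℂ (Set.range θ) = c.inv
  dual : ∀ i, ∃ φ : Γ →ₗ[ℂ] ℂ, (∀ x y : H, φ (x • c.d y) = Coalgebra.counit x * X i y) ∧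
    ∀ j, φ (θ j) = if i = j then 1 else 0

/-- The relations `∑ ω(x₁) ⊗ ω(x₂) = 0`, `x ∈ R`, imposed on the tensor algebra. -/
inductive WedgeRel : BimoduleTensorAlgebra H Γ → BimoduleTensorAlgebra H Γ → Prop
  | of (x : H) (hx : x ∈ c.idealR) : WedgeRel
      (LinearMap.mul' ℂ _ (TensorProduct.map (BimoduleTensorAlgebra.ofForm H Γ ∘ₗ c.omega)
        (BimoduleTensorAlgebra.ofForm H Γ ∘ₗ c.omega) (Coalgebra.comul x))) 0

/-- The universal differential calculus of the left-covariant calculus: the quotient of the tensor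
algebra `T_H(Γ)` by the two-sided ideal generated by the elements `∑ ω(x₁) ⊗ ω(x₂)` with `x ∈ R`.
Its product is the wedge product. -/
def Forms : Type _ := RingQuot c.WedgeRel

noncomputable instance : Ring c.Forms := inferInstanceAs (Ring (RingQuot c.WedgeRel))

noncomputable instance : Algebra ℂ c.Forms := inferInstanceAs (Algebra ℂ (RingQuot c.WedgeRel))

/-- Elements of `H` as forms of degree zero. -/
noncomputable def ofScalar : H →ₗ[ℂ] c.Forms :=
  (RingQuot.mkAlgHom ℂ c.WedgeRel).toLinearMap ∘ₗ BimoduleTensorAlgebra.ofScalar H Γ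

/-- Elements of `Γ` as forms of degree one. -/
noncomputable def ofForm : Γ →ₗ[ℂ] c.Forms :=
  (RingQuot.mkAlgHom ℂ c.WedgeRel).toLinearMap ∘ₗ BimoduleTensorAlgebra.ofForm H Γ

/-- The forms of degree `n`: the span of the products `x ρ₁ ∧ ⋯ ∧ ρₙ`. -/
noncomputable def degree (n : ℕ) : Submodule ℂ c.Forms :=
  LinearMap.range c.ofScalar * LinearMap.range c.ofForm ^ n

/-- `δ` is an exterior derivative: it extends `d`, has degree one, satisfies the graded Leibniz
rule, and squares to zero. -/
structure IsExteriorDerivative (δ : c.Forms →ₗ[ℂ] c.Forms) : Prop where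
  apply_scalar : ∀ x, δ (c.ofScalar x) = c.ofForm (c.d x)
  map_degree : ∀ n, ∀ α ∈ c.degree n, δ α ∈ c.degree (n + 1)
  leibniz : ∀ n, ∀ α ∈ c.degree n, ∀ β, δ (α * β) = δ α * β + (-1 : ℂ) ^ n • (α * δ β)
  square : ∀ α, δ (δ α) = 0

end LeftCovariantFODC

end Calculus

set_option linter.unusedSectionVars false

/-! The pairing sends `Uq P` multiplicatively into the convolution algebra of functionals on `SLq
P`, so relations between the `X_j`, proved in `Uq P` by reordering monomials, also hold for
functionals.

The calculus is governed by its tangent space. By a double annihilator argument R is the common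
kernel of ε, X₀, X₁, X₂. Since B, A, C are dual to X₀, X₁, X₂, this gives ω(x) = ∑ X_j(x) ω_j with
ω₀, ω₁, ω₂ = ω(B), ω(A), ω(C) (`omega_eq_sum`). Then dx = ∑ x₁ ω(x₂) yields the differentials, and
the coproduct of X_j yields the rule ω_j y = ∑ y₁⟨Kⁿ, y₂⟩ ω_j (`op_smul_basisForm`). Linear maps out
of Γ may be prescribed on the elements x ω(a), because x ω(a) ↦ x ⊗ ω(a) is well defined (`split`,
`exists_linearMap`).

A graded derivation δ amounts to a homomorphism into upper triangular matrices with diagonal (±α, α)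
and corner δα. The universal property of the forms produces this homomorphism (`derivationHom`), and
its corner is the exterior derivative. Uniqueness holds because δ(x dy) = dx ∧ dy is forced.

Six elements of R give the wedge relations. To recover the commutation relations from the
Maurer–Cartan equations, the two-forms ω₀∧ω₁, ω₀∧ω₂, ω₁∧ω₂ must be linearly independent. This is
seen in a representation on a free module of rank seven, the expected algebra of forms cut off above
degree two (`twoForms_independent`); it respects the relations imposed by R precisely because the
X_j satisfy the commutation relations.

The calculus exists because the free module of rank three, with dx = (∑ X_j(x₂) x₁)_j and the right
action twisted by powers of K, satisfies all axioms. -/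

/-! ### The dual pairing and the relations between the `X_j` -/

theorem dualPairing_apply_mul (P : QuantumParameter) (f : Uq P) (a b : SLq P) :
    dualPairing P f (a * b) = LinearMap.mul' ℂ ℂ (TensorProduct.map ((dualPairing P).flip a)
      ((dualPairing P).flip b) (Coalgebra.comul f)) := by
  simp only [dualPairing, LinearMap.flip_flip, LinearMap.flip_apply, LinearMap.comp_apply,
    AlgHom.toLinearMap_apply, map_mul]
  rfl

theorem dualPairing_apply_one (P : QuantumParameter) (f : Uq P) :
    dualPairing P f 1 = Coalgebra.counit f := by
  simp only [dualPairing, LinearMap.flip_apply, LinearMap.comp_apply,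
    AlgHom.toLinearMap_apply, map_one]
  rfl

theorem dualPairing_A (P : QuantumParameter) (f : Uq P) :
    dualPairing P f (SLq.A P) = DualPairing.rep P f 0 0 := by
  simp only [dualPairing, LinearMap.flip_apply, LinearMap.comp_apply,
    AlgHom.toLinearMap_apply, SLq.lift_A]
  rfl

theorem dualPairing_B (P : QuantumParameter) (f : Uq P) :
    dualPairing P f (SLq.B P) = DualPairing.rep P f 0 1 := by
  simp only [dualPairing, LinearMap.flip_apply, LinearMap.comp_apply,
    AlgHom.toLinearMap_apply, SLq.lift_B]
  rfl

theorem dualPairing_C (P : QuantumParameter) (f : Uq P) :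
    dualPairing P f (SLq.C P) = DualPairing.rep P f 1 0 := by
  simp only [dualPairing, LinearMap.flip_apply, LinearMap.comp_apply,
    AlgHom.toLinearMap_apply, SLq.lift_C]
  rfl

theorem dualPairing_D (P : QuantumParameter) (f : Uq P) :
    dualPairing P f (SLq.D P) = DualPairing.rep P f 1 1 := by
  simp only [dualPairing, LinearMap.flip_apply, LinearMap.comp_apply,
    AlgHom.toLinearMap_apply, SLq.lift_D]
  rfl

open Coalgebra in
-- On the generators this is multiplicativity of the two-dimensional representation. The induction
-- on `a` keeps `f` and `g` general, since the product case applies the hypothesis to the legs of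
-- their coproducts.
theorem dualPairing_mul_apply (P : QuantumParameter) (a : SLq P) : ∀ f g : Uq P,
    dualPairing P (f * g) a = LinearMap.mul' ℂ ℂ (TensorProduct.map (dualPairing P f)
      (dualPairing P g) (Coalgebra.comul a)) := by
  have ha : a ∈ Algebra.adjoin ℂ ({SLq.A P, SLq.B P, SLq.C P, SLq.D P} : Set (SLq P)) := by
    rw [SLq.adjoin_generators]; trivial
  induction ha using Algebra.adjoin_induction with
  | mem x hx =>
    intro f g
    rcases hx with (rfl | rfl | rfl | rfl) <;>
    simp [dualPairing_A, dualPairing_B, dualPairing_C, dualPairing_D, Matrix.mul_apply]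
  | algebraMap c =>
    intro f g
    simp [Algebra.algebraMap_eq_smul_one, Algebra.TensorProduct.one_def, dualPairing_apply_one]
  | add x y _ _ hx hy =>
    intro f g
    simp only [map_add, hx, hy]
  | mul a b _ _ ha hb =>
    intro f g
    have key : ∀ (f : Uq P) (a b : SLq P), dualPairing P f (a * b) = ∑ i ∈ (ℛ ℂ f).index,
        dualPairing P ((ℛ ℂ f).left i) a * dualPairing P ((ℛ ℂ f).right i) b := by
      intro f a b
      rw [dualPairing_apply_mul, ← (ℛ ℂ f).eq]
      simp [map_sum]
    have expand : ∀ (f g : Uq P) (a : SLq P), LinearMap.mul' ℂ ℂ (TensorProduct.map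
        (dualPairing P f) (dualPairing P g) (Coalgebra.comul a)) = ∑ i ∈ (ℛ ℂ a).index,
        dualPairing P f ((ℛ ℂ a).left i) * dualPairing P g ((ℛ ℂ a).right i) := by
      intro f g a
      rw [← (ℛ ℂ a).eq]
      simp [map_sum]
    have lhs : dualPairing P (f * g) (a * b) = ∑ i ∈ (ℛ ℂ f).index, ∑ j ∈ (ℛ ℂ g).index,
        dualPairing P ((ℛ ℂ f).left i * (ℛ ℂ g).left j) a *
          dualPairing P ((ℛ ℂ f).right i * (ℛ ℂ g).right j) b := by
      rw [dualPairing_apply_mul, Bialgebra.comul_mul, ← (ℛ ℂ f).eq, ← (ℛ ℂ g).eq]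
      simp [Finset.sum_mul_sum, map_sum]
    have rhs : LinearMap.mul' ℂ ℂ (TensorProduct.map (dualPairing P f) (dualPairing P g)
        (Coalgebra.comul (a * b))) = ∑ k ∈ (ℛ ℂ a).index, ∑ l ∈ (ℛ ℂ b).index,
        dualPairing P f ((ℛ ℂ a).left k * (ℛ ℂ b).left l) *
          dualPairing P g ((ℛ ℂ a).right k * (ℛ ℂ b).right l) := by
      rw [Bialgebra.comul_mul, ← (ℛ ℂ a).eq, ← (ℛ ℂ b).eq]
      simp [Finset.sum_mul_sum, map_sum]
    rw [lhs, rhs]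
    simp_rw [ha, hb, key, expand, Finset.sum_mul_sum]
    -- Both sides are now the same fourfold sum, over i, j, k, l on the left and k, l, i, j on the
    -- right; only the order of summation differs.
    refine Eq.trans (Finset.sum_congr rfl fun i _ ↦ Finset.sum_comm.trans
      (Finset.sum_congr rfl fun k _ ↦ Finset.sum_comm)) ?_
    refine Finset.sum_comm.trans (Finset.sum_congr rfl fun k _ ↦ Finset.sum_comm.trans
      (Finset.sum_congr rfl fun l _ ↦ Finset.sum_congr rfl fun i _ ↦
        Finset.sum_congr rfl fun j _ ↦ ?_))
    ring

/-- As 1 is grouplike, pairing with it is a character, so it may be compared with ε on generators.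
-/
theorem dualPairing_one_apply (P : QuantumParameter) (a : SLq P) :
    dualPairing P 1 a = Coalgebra.counit a := by
  let φ : SLq P →ₐ[ℂ] ℂ := AlgHom.ofLinearMap (dualPairing P 1)
    (by simp [dualPairing_apply_one])
    (fun a b ↦ by simp [dualPairing_apply_mul, Algebra.TensorProduct.one_def])
  have h : φ = Bialgebra.counitAlgHom ℂ (SLq P) := by
    apply SLq.algHom_ext <;> 
    simp [φ, dualPairing_A, dualPairing_B, dualPairing_C, dualPairing_D]
  exact DFunLike.congr_fun h a

theorem dualPairing_isDualPairing (P : QuantumParameter) : IsDualPairing (dualPairing P) :=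
  ⟨dualPairing_apply_mul P, fun f g a ↦ dualPairing_mul_apply P a f g, dualPairing_apply_one P,
    dualPairing_one_apply P⟩

/-- The algebra homomorphism from `Ŭ_q(sl₂)` to the convolution algebra of functionals on
`𝒪(SL_q(2))` given by the dual pairing. -/
noncomputable def dualPairingHom (P : QuantumParameter) :
    Uq P →ₐ[ℂ] WithConv (SLq P →ₗ[ℂ] ℂ) :=
  AlgHom.ofLinearMap ((WithConv.linearEquiv ℂ (SLq P →ₗ[ℂ] ℂ)).symm.toLinearMap ∘ₗ dualPairing P)
    (by ext a; exact dualPairing_one_apply P a)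
    (fun f g ↦ by ext a; exact dualPairing_mul_apply P a f g)

theorem QCommutationRelations.map {R S : Type*} [Ring R] [Algebra ℂ R] [Ring S] [Algebra ℂ S]
    {q : ℂ} {X : Fin 3 → R} (h : QCommutationRelations q X) (φ : R →ₐ[ℂ] S) :
    QCommutationRelations q (fun j ↦ φ (X j)) := by
  refine ⟨?_, ?_, ?_⟩
  · simpa using congr(φ $(h.1))
  · simpa using congr(φ $(h.2.1))
  · simpa using congr(φ $(h.2.2))

namespace Uq
variable (P : QuantumParameter)

theorem K_pow_mul_E (n : ℕ) : K P ^ n * E P = P.q ^ n • (E P * K P ^ n) := by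
  induction n with
  | zero => simp
  | succ n ih =>
    rw [pow_succ, mul_assoc, rel_ke, mul_smul_comm, ← mul_assoc, ih, smul_mul_assoc, mul_assoc,
      smul_smul, pow_succ']

theorem K_pow_mul_F (n : ℕ) : K P ^ n * F P = P.q⁻¹ ^ n • (F P * K P ^ n) := by
  induction n with
  | zero => simp
  | succ n ih =>
    rw [pow_succ, mul_assoc, rel_kf, mul_smul_comm, ← mul_assoc, ih, smul_mul_assoc, mul_assoc,
      smul_smul, pow_succ']

end Uq

theorem QuantumParameter.one_sub_inv_ne_zero (P : QuantumParameter) : 1 - (P.q ^ 2)⁻¹ ≠ 0 := by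
  have := P.q_ne_zero
  have := P.q_sq_ne_one
  rw [sub_ne_zero]
  intro h
  apply this
  rw [← inv_inv (P.q ^ 2), ← h, inv_one]

theorem QuantumParameter.one_add_sq_ne_zero (P : QuantumParameter) : 1 + P.q ^ 2 ≠ 0 := by
  intro h
  apply P.q_pow_four_ne_one
  linear_combination (P.q ^ 2 - 1) * h

/-- All products are put in the normal order F, E, K. Powers of K only contribute powers of q; the
one reordering of E and F contributes K⁴ − 1, a multiple of X₁. -/
theorem tangentVector_commutation (P : QuantumParameter) :
    QCommutationRelations P.q (tangentVector P) := by
  have hq := P.q_ne_zero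
  have hr := P.r_ne_zero
  have h1 := P.one_sub_inv_ne_zero
  have h2 := P.q_sub_inv_ne_zero
  have h3 := P.q_sq_ne_one
  have h3' : P.q ^ 2 - 1 ≠ 0 := sub_ne_zero.2 h3
  have hc : (1 - (P.q ^ 2)⁻¹)⁻¹ = P.q ^ 2 / (P.q ^ 2 - 1) := by
    rw [inv_eq_iff_eq_inv, inv_div]; field_simp
  have hc' : (P.q - P.q⁻¹)⁻¹ = P.q / (P.q ^ 2 - 1) := by
    rw [inv_eq_iff_eq_inv, inv_div]; field_simp
  have k1 : Uq.K P ^ 4 * (Uq.F P * Uq.K P) = (P.q⁻¹) ^ 4 • (Uq.F P * Uq.K P ^ 5) := by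
    rw [← mul_assoc, Uq.K_pow_mul_F, smul_mul_assoc, mul_assoc, ← pow_succ]
  have k2 : Uq.F P * Uq.K P * Uq.K P ^ 4 = Uq.F P * Uq.K P ^ 5 := by
    rw [mul_assoc, ← pow_succ']
  have k3 : Uq.K P ^ 4 * (Uq.E P * Uq.K P) = P.q ^ 4 • (Uq.E P * Uq.K P ^ 5) := by
    rw [← mul_assoc, Uq.K_pow_mul_E, smul_mul_assoc, mul_assoc, ← pow_succ]
  have k4 : Uq.E P * Uq.K P * Uq.K P ^ 4 = Uq.E P * Uq.K P ^ 5 := by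
    rw [mul_assoc, ← pow_succ']
  have k5 : Uq.F P * Uq.K P * (Uq.E P * Uq.K P) = P.q • (Uq.F P * Uq.E P * Uq.K P ^ 2) := by
    rw [mul_assoc, ← mul_assoc (Uq.K P), Uq.rel_ke, sq]
    simp [mul_assoc]
  -- The commutator of E and F, multiplied by the K² coming from the two factors K: this is where X₁
  -- arises.
  have k7 : (Uq.K P * Uq.K P - Uq.Kinv P * Uq.Kinv P) * Uq.K P ^ 2 = Uq.K P ^ 4 - 1 := by
    rw [sub_mul]
    congr 1
    · rw [← sq, ← pow_add]
    · rw [sq, mul_assoc, ← mul_assoc (Uq.Kinv P) (Uq.K P), Uq.rel_lk, one_mul, Uq.rel_lk]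
  have k6 : Uq.E P * Uq.K P * (Uq.F P * Uq.K P) = P.q⁻¹ • (Uq.F P * Uq.E P * Uq.K P ^ 2 +
      (P.q - P.q⁻¹)⁻¹ • (Uq.K P ^ 4 - 1)) := by
    rw [mul_assoc, ← mul_assoc (Uq.K P), Uq.rel_kf, ← k7]
    simp only [smul_mul_assoc, mul_smul_comm]
    rw [mul_assoc (Uq.F P) (Uq.K P), ← sq, ← mul_assoc, Uq.rel_ef, add_mul, smul_mul_assoc,
      sq (Uq.K P)]
  refine ⟨?_, ?_, ?_⟩ <;> simp only [tangentVector, Matrix.cons_val] <;>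
  simp only [smul_mul_assoc, mul_smul_comm, sub_mul, mul_sub, one_mul, mul_one, k1, k2, k3, k4,
    k5, k6, hc, hc'] <;> match_scalars <;> field_simp <;> ring

theorem tangentFunctional_commutation (P : QuantumParameter) :
    QCommutationRelations P.q (R := WithConv (SLq P →ₗ[ℂ] ℂ))
      (fun j ↦ WithConv.toConv (tangentFunctional P j)) :=
  (tangentVector_commutation P).map (dualPairingHom P)

/-- The factor K in X₀ and X₂ cancels the K⁻¹ in the coproducts of F and E; for X₁ the element K⁴ is
grouplike. -/
theorem comul_tangentVector (P : QuantumParameter) (j : Fin 3) :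
    Coalgebra.comul (R := ℂ) (tangentVector P j) =
      1 ⊗ₜ tangentVector P j + tangentVector P j ⊗ₜ (Uq.K P ^ (if j = 1 then 4 else 2)) := by
  have h := Uq.rel_lk P
  fin_cases j
  · simp [tangentVector, add_mul, h, TensorProduct.tmul_smul, TensorProduct.smul_tmul', sq, add_comm]
  · simp [tangentVector, Algebra.TensorProduct.one_def, TensorProduct.tmul_smul,
      TensorProduct.smul_tmul', Bialgebra.comul_pow, TensorProduct.tmul_sub,
      TensorProduct.sub_tmul, smul_sub]
  · simp [tangentVector, add_mul, h, TensorProduct.tmul_smul, TensorProduct.smul_tmul', sq, add_comm]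

theorem tangentFunctional_mul (P : QuantumParameter) (j : Fin 3) (x y : SLq P) :
    tangentFunctional P j (x * y) = Coalgebra.counit x * tangentFunctional P j y +
      tangentFunctional P j x * dualPairing P (Uq.K P ^ (if j = 1 then 4 else 2)) y := by
  rw [tangentFunctional, dualPairing_apply_mul, comul_tangentVector]
  simp [dualPairing_one_apply]

/-! ### Convolutions in Sweedler notation -/

section Sweedler

variable {H : Type*} [Ring H] [Bialgebra ℂ H]
  {M N Q M' N' Q' T : Type*} [AddCommGroup M] [Module ℂ M] [AddCommGroup N] [Module ℂ N]
  [AddCommGroup Q] [Module ℂ Q] [AddCommGroup M'] [Module ℂ M'] [AddCommGroup N'] [Module ℂ N']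
  [AddCommGroup Q'] [Module ℂ Q'] [AddCommGroup T] [Module ℂ T]

/-- The convolution `x ↦ ∑ μ (f x₁) (g x₂)` of two linear maps with respect to a bilinear map. -/
noncomputable def sweedler (μ : M →ₗ[ℂ] N →ₗ[ℂ] Q) (f : H →ₗ[ℂ] M) (g : H →ₗ[ℂ] N) : H →ₗ[ℂ] Q :=
  TensorProduct.lift (μ.compl₁₂ f g) ∘ₗ Coalgebra.comul

theorem sweedler_apply (μ : M →ₗ[ℂ] N →ₗ[ℂ] Q) (f : H →ₗ[ℂ] M) (g : H →ₗ[ℂ] N) (x : H) :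
    sweedler μ f g x = TensorProduct.lift (μ.compl₁₂ f g) (Coalgebra.comul x) := rfl

theorem lift_lift_left_eq (μ : M →ₗ[ℂ] N →ₗ[ℂ] Q) (ν : M' →ₗ[ℂ] N' →ₗ[ℂ] M)
    (μ' : M' →ₗ[ℂ] Q' →ₗ[ℂ] Q) (ν' : N' →ₗ[ℂ] N →ₗ[ℂ] Q')
    (h : ∀ a b c, μ (ν a b) c = μ' a (ν' b c))
    (f : H →ₗ[ℂ] M') (g : H →ₗ[ℂ] N') (k : H →ₗ[ℂ] N) (x : H) (t : H ⊗[ℂ] H) :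
    μ (TensorProduct.lift (ν.compl₁₂ f g) t) (k x) =
      TensorProduct.lift (μ'.compl₁₂ f (TensorProduct.lift (ν'.compl₁₂ g k)))
        (TensorProduct.assoc ℂ H H H (t ⊗ₜ x)) := by
  induction t with
  | zero => simp
  | add a b ha hb => simp only [map_add, LinearMap.add_apply, ha, hb, TensorProduct.add_tmul]
  | tmul a b => simp [h]

/-- Coassociativity. The four bilinear maps may differ, so that the lemma covers products, actions
on one-forms, scalar multiples and pure tensors alike. -/
theorem sweedler_assoc (μ : M →ₗ[ℂ] N →ₗ[ℂ] Q) (ν : M' →ₗ[ℂ] N' →ₗ[ℂ] M)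
    (μ' : M' →ₗ[ℂ] Q' →ₗ[ℂ] Q) (ν' : N' →ₗ[ℂ] N →ₗ[ℂ] Q')
    (h : ∀ a b c, μ (ν a b) c = μ' a (ν' b c))
    (f : H →ₗ[ℂ] M') (g : H →ₗ[ℂ] N') (k : H →ₗ[ℂ] N) :
    sweedler μ (sweedler ν f g) k = sweedler μ' f (sweedler ν' g k) := by
  ext x
  have h1 : ∀ t : H ⊗[ℂ] H, TensorProduct.lift (μ.compl₁₂ (sweedler ν f g) k) t =
      TensorProduct.lift (μ'.compl₁₂ f (TensorProduct.lift (ν'.compl₁₂ g k)))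
        (TensorProduct.assoc ℂ H H H (Coalgebra.comul.rTensor H t)) := by
    intro t
    induction t with
    | zero => simp
    | add a b ha hb => simp only [map_add, ha, hb]
    | tmul a b =>
      simp only [TensorProduct.lift.tmul, LinearMap.compl₁₂_apply, sweedler_apply,
        LinearMap.rTensor_tmul]
      exact lift_lift_left_eq μ ν μ' ν' h f g k b _
  have h2 : ∀ t : H ⊗[ℂ] H, TensorProduct.lift (μ'.compl₁₂ f (sweedler ν' g k)) t =
      TensorProduct.lift (μ'.compl₁₂ f (TensorProduct.lift (ν'.compl₁₂ g k)))
        (Coalgebra.comul.lTensor H t) := by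
    intro t
    induction t with
    | zero => simp
    | add a b ha hb => simp only [map_add, ha, hb]
    | tmul a b => simp [sweedler_apply]
  rw [sweedler_apply, h1, Coalgebra.coassoc_apply, ← h2, sweedler_apply]

/-- The element `u` is not required to be a unit: `f` is often a collapsed sum such as ∑ S(x₁) x₂ u
= ε(x) u. -/
theorem sweedler_counit_left (μ : M →ₗ[ℂ] N →ₗ[ℂ] Q) (f : H →ₗ[ℂ] M) (g : H →ₗ[ℂ] N) (u : M)
    (hf : ∀ x, f x = Coalgebra.counit (R := ℂ) x • u) (x : H) :
    sweedler μ f g x = μ u (g x) := by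
  have h : ∀ t : H ⊗[ℂ] H, TensorProduct.lift (μ.compl₁₂ f g) t =
      μ u (g (TensorProduct.lid ℂ H (Coalgebra.counit.rTensor H t))) := by
    intro t
    induction t with
    | zero => simp
    | add a b ha hb => simp only [map_add, ha, hb]
    | tmul a b => simp [hf]
  rw [sweedler_apply, h, Coalgebra.rTensor_counit_comul]
  simp

theorem sweedler_counit_right (μ : M →ₗ[ℂ] N →ₗ[ℂ] Q) (f : H →ₗ[ℂ] M) (g : H →ₗ[ℂ] N) (u : N)
    (hg : ∀ x, g x = Coalgebra.counit (R := ℂ) x • u) (x : H) :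
    sweedler μ f g x = μ (f x) u := by
  have h : ∀ t : H ⊗[ℂ] H, TensorProduct.lift (μ.compl₁₂ f g) t =
      μ (f (TensorProduct.rid ℂ H (Coalgebra.counit.lTensor H t))) u := by
    intro t
    induction t with
    | zero => simp
    | add a b ha hb => simp only [map_add, LinearMap.add_apply, ha, hb]
    | tmul a b => simp [hg]
  rw [sweedler_apply, h, Coalgebra.lTensor_counit_comul]
  simp

theorem map_sweedler (F : Q →ₗ[ℂ] T) (μ : M →ₗ[ℂ] N →ₗ[ℂ] Q) (f : H →ₗ[ℂ] M) (g : H →ₗ[ℂ] N)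
    (μ' : M' →ₗ[ℂ] N' →ₗ[ℂ] T) (f' : H →ₗ[ℂ] M') (g' : H →ₗ[ℂ] N')
    (h : ∀ a b, F (μ (f a) (g b)) = μ' (f' a) (g' b)) (x : H) :
    F (sweedler μ f g x) = sweedler μ' f' g' x := by
  have : ∀ t : H ⊗[ℂ] H, F (TensorProduct.lift (μ.compl₁₂ f g) t) =
      TensorProduct.lift (μ'.compl₁₂ f' g') t := by
    intro t
    induction t with
    | zero => simp
    | add a b ha hb => simp only [map_add, ha, hb]
    | tmul a b => simp [h]
  exact this _

open Coalgebra in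
-- Only the coproduct of `y` is expanded; the dependence on `x` stays a convolution, to which
-- associativity and the antipode axioms still apply.
theorem sweedler_mul (μ : M →ₗ[ℂ] N →ₗ[ℂ] Q) (f : H →ₗ[ℂ] M) (g : H →ₗ[ℂ] N) (x y : H) :
    sweedler μ f g (x * y) = ∑ i ∈ (ℛ ℂ y).index,
      sweedler μ (f ∘ₗ LinearMap.mulRight ℂ ((ℛ ℂ y).left i))
        (g ∘ₗ LinearMap.mulRight ℂ ((ℛ ℂ y).right i)) x := by
  have h : ∀ (t : H ⊗[ℂ] H), TensorProduct.lift (μ.compl₁₂ f g) (t * Coalgebra.comul y) =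
      ∑ i ∈ (ℛ ℂ y).index, TensorProduct.lift
        (μ.compl₁₂ (f ∘ₗ LinearMap.mulRight ℂ ((ℛ ℂ y).left i))
          (g ∘ₗ LinearMap.mulRight ℂ ((ℛ ℂ y).right i))) t := by
    intro t
    induction t with
    | zero => simp
    | add a b ha hb => simp only [add_mul, map_add, ha, hb, Finset.sum_add_distrib]
    | tmul a b =>
      rw [← (ℛ ℂ y).eq]
      simp [Finset.mul_sum]
  rw [sweedler_apply, Bialgebra.comul_mul, h]
  rfl

open Coalgebra in
theorem sweedler_eq_sum (μ : M →ₗ[ℂ] N →ₗ[ℂ] Q) (f : H →ₗ[ℂ] M) (g : H →ₗ[ℂ] N) (x : H) :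
    sweedler μ f g x = ∑ i ∈ (ℛ ℂ x).index, μ (f ((ℛ ℂ x).left i)) (g ((ℛ ℂ x).right i)) := by
  rw [sweedler_apply, ← (ℛ ℂ x).eq]
  simp

theorem sweedler_mul'_eq {R : Type*} [Ring R] [Algebra ℂ R] (f g : H →ₗ[ℂ] R) (x : H) :
    LinearMap.mul' ℂ R (TensorProduct.map f g (Coalgebra.comul x)) =
      sweedler (LinearMap.mul ℂ R) f g x := by
  rw [sweedler_eq_sum]
  conv_lhs => rw [← (Coalgebra.Repr.arbitrary ℂ x).eq]
  simp

end Sweedler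

section antipode
variable {H : Type*} [Ring H] [HopfAlgebra ℂ H]

theorem sweedler_antipode_id (x : H) :
    sweedler (LinearMap.mul ℂ H) (HopfAlgebra.antipode ℂ) LinearMap.id x =
      Coalgebra.counit (R := ℂ) x • (1 : H) := by
  rw [← sweedler_mul'_eq, ← Algebra.algebraMap_eq_smul_one]
  exact HopfAlgebra.mul_antipode_rTensor_comul_apply x

theorem sweedler_id_antipode (x : H) :
    sweedler (LinearMap.mul ℂ H) LinearMap.id (HopfAlgebra.antipode ℂ) x =
      Coalgebra.counit (R := ℂ) x • (1 : H) := by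
  rw [← sweedler_mul'_eq, ← Algebra.algebraMap_eq_smul_one]
  exact HopfAlgebra.mul_antipode_lTensor_comul_apply x

end antipode

/-! ### Left-covariant calculi: invariant forms and the bimodule structure -/

namespace LeftCovariantFODC

variable {H : Type*} [Ring H] [HopfAlgebra ℂ H]
  {Γ : Type*} [AddCommGroup Γ] [Module ℂ Γ] [Module H Γ] [Module Hᵐᵒᵖ Γ]
  [IsScalarTower ℂ H Γ] [IsScalarTower ℂ Hᵐᵒᵖ Γ] [SMulCommClass H Hᵐᵒᵖ Γ]
  (c : LeftCovariantFODC H Γ)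

variable (H Γ) in
/-- The left action of `H` on `Γ` as a bilinear map. -/
noncomputable abbrev leftAction : H →ₗ[ℂ] Γ →ₗ[ℂ] Γ := (Algebra.lsmul ℂ ℂ Γ).toLinearMap

theorem d_one : c.d 1 = 0 := by
  have h := c.leibniz 1 1
  rw [mul_one, one_smul, MulOpposite.op_one, one_smul] at h
  exact left_eq_add.1 h

theorem omega_eq : c.omega = sweedler (leftAction H Γ) (HopfAlgebra.antipode ℂ) c.d := rfl

theorem omega_one : c.omega 1 = 0 := by
  simp [omega, Algebra.TensorProduct.one_def, d_one]

/-- Substituting the definition of ω gives ∑ x₁ S(x₂) dx₃, and the antipode axiom collapses the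
first two legs. -/
theorem d_eq_sweedler : c.d = sweedler (leftAction H Γ) LinearMap.id c.omega := by
  rw [omega_eq, ← sweedler_assoc (leftAction H Γ) (LinearMap.mul ℂ H) (leftAction H Γ)
    (leftAction H Γ) (fun a b ρ ↦ by simp)]
  ext x
  rw [sweedler_counit_left _ _ _ 1 sweedler_id_antipode]
  simp

/-- The Leibniz rule removes right multiplications: (dy) z = d(yz) − y dz. -/
theorem span_smul_d : Submodule.span ℂ {ρ : Γ | ∃ x y : H, ρ = x • c.d y} = ⊤ := by
  rw [eq_top_iff, ← c.span_eq_top, Submodule.span_le]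
  rintro _ ⟨x, y, z, rfl⟩
  have h : MulOpposite.op z • c.d y = c.d (y * z) - y • c.d z := by rw [c.leibniz]; abel
  rw [h, smul_sub, ← mul_smul]
  exact sub_mem (Submodule.subset_span ⟨_, _, rfl⟩) (Submodule.subset_span ⟨_, _, rfl⟩)

open Coalgebra in
theorem span_smul_omega : Submodule.span ℂ {ρ : Γ | ∃ x a : H, ρ = x • c.omega a} = ⊤ := by
  rw [eq_top_iff, ← c.span_smul_d, Submodule.span_le]
  rintro _ ⟨x, y, rfl⟩
  rw [d_eq_sweedler, sweedler_eq_sum, Finset.smul_sum]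
  refine sum_mem fun i _ ↦ Submodule.subset_span ⟨x * (ℛ ℂ y).left i, (ℛ ℂ y).right i, ?_⟩
  simp [mul_smul]

theorem smul_d_induction {p : Γ → Prop} (h : ∀ x y : H, p (x • c.d y)) (zero : p 0)
    (add : ∀ ρ τ, p ρ → p τ → p (ρ + τ)) (ρ : Γ) : p ρ := by
  have hρ : ρ ∈ Submodule.span ℂ {ρ : Γ | ∃ x y : H, ρ = x • c.d y} := by
    rw [span_smul_d]; trivial
  induction hρ using Submodule.closure_induction with
  | zero => exact zero
  | add x y _ _ hx hy => exact add x y hx hy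
  | smul_mem a x hx =>
    obtain ⟨x, y, rfl⟩ := hx
    rw [← smul_assoc]
    exact h _ _

theorem smul_omega_induction {p : Γ → Prop} (h : ∀ x a : H, p (x • c.omega a)) (zero : p 0)
    (add : ∀ ρ τ, p ρ → p τ → p (ρ + τ)) (ρ : Γ) : p ρ := by
  have hρ : ρ ∈ Submodule.span ℂ {ρ : Γ | ∃ x a : H, ρ = x • c.omega a} := by
    rw [span_smul_omega]; trivial
  induction hρ using Submodule.closure_induction with
  | zero => exact zero
  | add x y _ _ hx hy => exact add x y hx hy
  | smul_mem a x hx =>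
    obtain ⟨x, y, rfl⟩ := hx
    rw [← smul_assoc]
    exact h _ _

variable (H Γ) in
/-- The left action of `H ⊗ H` on `H ⊗ Γ`. -/
noncomputable abbrev tensorAction : H ⊗[ℂ] H →ₗ[ℂ] H ⊗[ℂ] Γ →ₗ[ℂ] H ⊗[ℂ] Γ :=
  TensorProduct.map₂ (LinearMap.mul ℂ H) (leftAction H Γ)

theorem tensorAction_mul (s t : H ⊗[ℂ] H) (u : H ⊗[ℂ] Γ) :
    tensorAction H Γ (s * t) u = tensorAction H Γ s (tensorAction H Γ t u) := by
  induction s with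
  | zero => simp
  | add a b ha hb => simp only [add_mul, map_add, LinearMap.add_apply, ha, hb]
  | tmul s₁ s₂ =>
    induction t with
    | zero => simp
    | add a b ha hb => simp only [mul_add, map_add, LinearMap.add_apply, ha, hb]
    | tmul t₁ t₂ =>
      induction u with
      | zero => simp
      | add a b ha hb => simp only [map_add, ha, hb]
      | tmul u₁ u₂ => simp [mul_assoc]

theorem tensorAction_one (u : H ⊗[ℂ] Γ) : tensorAction H Γ 1 u = u := by
  induction u with
  | zero => simp
  | add a b ha hb => simp only [map_add, ha, hb]
  | tmul u₁ u₂ => simp [Algebra.TensorProduct.one_def]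

theorem coact_smul (x : H) (ρ : Γ) :
    c.coact (x • ρ) = tensorAction H Γ (Coalgebra.comul x) (c.coact ρ) := by
  induction ρ using c.smul_d_induction with
  | h y z => rw [← mul_smul, coact_smul_d, coact_smul_d, Bialgebra.comul_mul, tensorAction_mul]
  | zero => simp
  | add ρ τ h₁ h₂ => rw [smul_add, map_add, h₁, h₂, map_add, map_add]

theorem coact_d (x : H) : c.coact (c.d x) =
    TensorProduct.map LinearMap.id c.d (Coalgebra.comul x) := by
  have h := c.coact_smul_d 1 x
  rwa [one_smul, Bialgebra.comul_one, tensorAction_one] at h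

/-- Since Δ is multiplicative, Δ ∘ S is a convolution inverse of Δ. Hence convolving with Δ is
injective, and maps into H ⊗ Γ may be compared after doing so. -/
theorem sweedler_tensorAction_inverse (g : H →ₗ[ℂ] H ⊗[ℂ] Γ) :
    sweedler (tensorAction H Γ) (Coalgebra.comul ∘ₗ HopfAlgebra.antipode ℂ)
      (sweedler (tensorAction H Γ) Coalgebra.comul g) = g := by
  rw [← sweedler_assoc (tensorAction H Γ) (LinearMap.mul ℂ (H ⊗[ℂ] H)) (tensorAction H Γ)
    (tensorAction H Γ) (fun s t u ↦ tensorAction_mul s t u)]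
  ext x
  rw [sweedler_counit_left _ _ _ 1, tensorAction_one]
  intro y
  rw [← map_sweedler (Coalgebra.comul (R := ℂ) (A := H)) (LinearMap.mul ℂ H)
    (HopfAlgebra.antipode ℂ) LinearMap.id, sweedler_antipode_id, map_smul, Bialgebra.comul_one]
  simp

/-- Both Δ_L ∘ ω and 1 ⊗ ω become Δ_L ∘ d after convolution with Δ, which is injective. No formula
for Δ ∘ S is needed. -/
theorem coact_omega (x : H) : c.coact (c.omega x) = 1 ⊗ₜ c.omega x := by
  have h1 : sweedler (tensorAction H Γ) Coalgebra.comul (c.coact ∘ₗ c.omega) =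
      c.coact ∘ₗ c.d := by
    ext y
    rw [d_eq_sweedler, LinearMap.comp_apply]
    refine (map_sweedler _ _ _ _ _ _ _ (fun a b ↦ ?_) y).symm
    simpa using c.coact_smul a (c.omega b)
  -- Here Δ(x₁)(1 ⊗ ω(x₂)) = x₁ ⊗ x₂ ω(x₃) = x₁ ⊗ dx₂ by coassociativity and the inversion formula
  -- for d.
  have h2 : sweedler (tensorAction H Γ) Coalgebra.comul (TensorProduct.mk ℂ H Γ 1 ∘ₗ c.omega) =
      c.coact ∘ₗ c.d := by
    have e : Coalgebra.comul (R := ℂ) (A := H) =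
        sweedler (TensorProduct.mk ℂ H H) LinearMap.id LinearMap.id := by
      ext y
      rw [sweedler_eq_sum]
      exact (Coalgebra.Repr.arbitrary ℂ y).eq.symm
    have e' : sweedler (tensorAction H Γ) Coalgebra.comul (TensorProduct.mk ℂ H Γ 1 ∘ₗ c.omega) =
      sweedler ((tensorAction H Γ).compl₂ (TensorProduct.mk ℂ H Γ 1)) Coalgebra.comul c.omega := rfl
    rw [e', e, sweedler_assoc _ (TensorProduct.mk ℂ H H) (TensorProduct.mk ℂ H Γ)
      (leftAction H Γ) (fun a b ρ ↦ by simp), ← d_eq_sweedler]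
    ext y
    rw [LinearMap.comp_apply, coact_d, sweedler_eq_sum]
    conv_rhs => rw [← (Coalgebra.Repr.arbitrary ℂ y).eq]
    simp
  have h := sweedler_tensorAction_inverse (Γ := Γ) (c.coact ∘ₗ c.omega)
  rw [h1, ← h2, sweedler_tensorAction_inverse] at h
  exact (LinearMap.congr_fun h x).symm

theorem coact_smul_omega (x a : H) : c.coact (x • c.omega a) =
    tensorAction H Γ (Coalgebra.comul x) (1 ⊗ₜ c.omega a) := by
  rw [coact_smul, coact_omega]

/-- The projection `ρ ↦ ∑ S(ρ₋₁) ρ₀` onto the left-invariant forms. -/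
noncomputable def proj : Γ →ₗ[ℂ] Γ :=
  TensorProduct.lift (leftAction H Γ ∘ₗ HopfAlgebra.antipode ℂ) ∘ₗ c.coact

theorem proj_smul_omega (x a : H) :
    c.proj (x • c.omega a) = Coalgebra.counit (R := ℂ) x • c.omega a := by
  have h : ∀ t : H ⊗[ℂ] H, TensorProduct.lift (leftAction H Γ ∘ₗ HopfAlgebra.antipode ℂ)
      (tensorAction H Γ t (1 ⊗ₜ c.omega a)) =
      TensorProduct.lift ((LinearMap.mul ℂ H).compl₁₂ (HopfAlgebra.antipode ℂ) LinearMap.id) t •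
        c.omega a := by
    intro t
    induction t with
    | zero => simp
    | add a b ha hb => simp only [map_add, LinearMap.add_apply, ha, hb, add_smul]
    | tmul t₁ t₂ => simp [mul_smul]
  rw [proj, LinearMap.comp_apply, coact_smul_omega, h, ← sweedler_apply, sweedler_antipode_id]
  simp

/-- The isomorphism `x ω(a) ↦ x ⊗ ω(a)` onto the tensor product with the left-invariant forms. -/
noncomputable def split : Γ →ₗ[ℂ] H ⊗[ℂ] Γ := c.proj.lTensor H ∘ₗ c.coact

theorem split_smul_omega (x a : H) : c.split (x • c.omega a) = x ⊗ₜ c.omega a := by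
  have h : ∀ t : H ⊗[ℂ] H, c.proj.lTensor H (tensorAction H Γ t (1 ⊗ₜ c.omega a)) =
      TensorProduct.rid ℂ H (Coalgebra.counit.lTensor H t) ⊗ₜ c.omega a := by
    intro t
    induction t with
    | zero => simp
    | add a b ha hb => simp only [map_add, LinearMap.add_apply, ha, hb, TensorProduct.add_tmul]
    | tmul t₁ t₂ => simp [proj_smul_omega, TensorProduct.smul_tmul]
  rw [split, LinearMap.comp_apply, coact_smul_omega, h, Coalgebra.lTensor_counit_comul]
  simp

theorem inv_eq_range : c.inv = LinearMap.range c.omega := by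
  apply le_antisymm
  · intro ρ hρ
    have h1 : c.proj ρ = ρ := by
      have : c.coact ρ = 1 ⊗ₜ ρ := hρ
      simp [proj, this]
    rw [← h1]
    -- Invariance has done its work: `proj` maps every form into the range of ω, so the induction
    -- need not preserve invariance.
    clear hρ h1
    induction ρ using c.smul_omega_induction with
    | h x a =>
      rw [proj_smul_omega, ← map_smul]
      exact LinearMap.mem_range_self _ _
    | zero => simp
    | add ρ τ h₁ h₂ =>
      rw [map_add]
      exact add_mem h₁ h₂
  · rintro _ ⟨x, rfl⟩
    exact c.coact_omega x

/-- A bilinear map on `H × H` which depends on its second argument `a` only through `ω(a)` induces a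
linear map on `Γ`. -/
theorem exists_linearMap {N : Type*} [AddCommGroup N] [Module ℂ N] (b : H →ₗ[ℂ] H →ₗ[ℂ] N)
    (hb : ∀ a, c.omega a = 0 → ∀ x, b x a = 0) :
    ∃ F : Γ →ₗ[ℂ] N, ∀ x a, F (x • c.omega a) = b x a := by
  have hk : LinearMap.ker c.omega ≤ LinearMap.ker b.flip := fun a ha ↦
    LinearMap.ext fun x ↦ hb a ha x
  -- The map factors through the range of ω, and over a field it extends from that subspace to all
  -- of Γ; the composite with `split` only sees its values on the range.
  obtain ⟨g, hg⟩ := LinearMap.exists_extend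
    (((LinearMap.ker c.omega).liftQ b.flip hk) ∘ₗ c.omega.quotKerEquivRange.symm.toLinearMap)
  have hg' : ∀ a, g (c.omega a) = b.flip a := by
    intro a
    have := LinearMap.congr_fun hg ⟨c.omega a, LinearMap.mem_range_self _ _⟩
    have e : c.omega.quotKerEquivRange.symm ⟨c.omega a, LinearMap.mem_range_self _ _⟩ =
        Submodule.Quotient.mk a := by
      rw [LinearEquiv.symm_apply_eq]
      rfl
    simpa [e] using this
  refine ⟨TensorProduct.lift g.flip ∘ₗ c.split, fun x a ↦ ?_⟩
  simp [split_smul_omega, hg']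

open Coalgebra in
-- In ω(x) y = ∑ S(x₁)(dx₂) y, the Leibniz rule replaces (dz) y by d(zy) − z dy = ∑ z₁y₁ ω(z₂y₂) − z
-- dy. With z = x₂ the legs S(x₁) x₂ collapse in both terms.
theorem op_smul_omega (x y : H) : MulOpposite.op y • c.omega x =
    ∑ i ∈ (ℛ ℂ y).index, (ℛ ℂ y).left i •
      (c.omega (x * (ℛ ℂ y).right i) - counit (R := ℂ) x • c.omega ((ℛ ℂ y).right i)) := by
  have h1 : ∀ z, MulOpposite.op y • c.d z = ∑ i ∈ (ℛ ℂ y).index,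
      sweedler (leftAction H Γ) (LinearMap.mulRight ℂ ((ℛ ℂ y).left i))
        (c.omega ∘ₗ LinearMap.mulRight ℂ ((ℛ ℂ y).right i)) z - z • c.d y := by
    intro z
    have : MulOpposite.op y • c.d z = c.d (z * y) - z • c.d y := by rw [c.leibniz]; abel
    rw [this]
    nth_rw 1 [d_eq_sweedler]
    rw [sweedler_mul]
    rfl
  have h2 : ∀ u : H, ∀ z, sweedler (LinearMap.mul ℂ H) (HopfAlgebra.antipode ℂ)
      (LinearMap.mulRight ℂ u) z = counit (R := ℂ) z • u := by
    intro u z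
    rw [← map_sweedler (LinearMap.mulRight ℂ u) (LinearMap.mul ℂ H) (HopfAlgebra.antipode ℂ)
      LinearMap.id, sweedler_antipode_id]
    · simp
    · intro a b
      simp [mul_assoc]
  have h3 : ∀ (u : H) (g : H →ₗ[ℂ] Γ), sweedler (leftAction H Γ) (HopfAlgebra.antipode ℂ)
      (sweedler (leftAction H Γ) (LinearMap.mulRight ℂ u) g) x = u • g x := by
    intro u g
    rw [← sweedler_assoc (leftAction H Γ) (LinearMap.mul ℂ H) (leftAction H Γ) (leftAction H Γ)
      (fun a b ρ ↦ by simp), sweedler_counit_left _ _ _ u (h2 u)]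
    rfl
  have h4 : ∀ ρ : Γ, sweedler (leftAction H Γ) (HopfAlgebra.antipode ℂ)
      ((leftAction H Γ).flip ρ) x = counit (R := ℂ) x • ρ := by
    intro ρ
    rw [← map_sweedler ((leftAction H Γ).flip ρ) (LinearMap.mul ℂ H) (HopfAlgebra.antipode ℂ)
      LinearMap.id, sweedler_antipode_id]
    · simp
    · intro a b
      simp
  have h5 : MulOpposite.op y • c.omega x = ∑ i ∈ (ℛ ℂ y).index,
      sweedler (leftAction H Γ) (HopfAlgebra.antipode ℂ)
        (sweedler (leftAction H Γ) (LinearMap.mulRight ℂ ((ℛ ℂ y).left i))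
        (c.omega ∘ₗ LinearMap.mulRight ℂ ((ℛ ℂ y).right i))) x -
      sweedler (leftAction H Γ) (HopfAlgebra.antipode ℂ) ((leftAction H Γ).flip (c.d y)) x := by
    rw [omega_eq, sweedler_eq_sum, Finset.smul_sum]
    have h6 : ∀ u v : H, MulOpposite.op y • u • c.d v = u • MulOpposite.op y • c.d v :=
      fun u v ↦ (smul_comm u _ _).symm
    simp only [AlgHom.toLinearMap_apply, Algebra.lsmul_coe, h6, h1, smul_sub, Finset.smul_sum,
      Finset.sum_sub_distrib]
    rw [Finset.sum_comm, ← omega_eq]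
    congr 1
    · refine Finset.sum_congr rfl fun i _ ↦ ?_
      rw [sweedler_eq_sum]
      rfl
    · rw [sweedler_eq_sum]
      rfl
  rw [h5, h4]
  simp only [h3]
  nth_rw 1 [d_eq_sweedler]
  rw [sweedler_eq_sum]
  simp only [LinearMap.comp_apply, LinearMap.mulRight_apply, smul_sub, Finset.sum_sub_distrib,
    Finset.smul_sum]
  congr 1
  exact Finset.sum_congr rfl fun i _ ↦ smul_comm _ _ _

end LeftCovariantFODC

/-! ### The algebra of forms: universal properties and grading -/

theorem matrix_fin_two_ext {R : Type*} {M N : Matrix (Fin 2) (Fin 2) R} (h₀₀ : M 0 0 = N 0 0)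
    (h₀₁ : M 0 1 = N 0 1) (h₁₀ : M 1 0 = N 1 0) (h₁₁ : M 1 1 = N 1 1) : M = N := by
  rw [Matrix.eta_fin_two M, Matrix.eta_fin_two N, h₀₀, h₀₁, h₁₀, h₁₁]

namespace BimoduleTensorAlgebra

variable {H : Type*} [Ring H] [HopfAlgebra ℂ H]
  {Γ : Type*} [AddCommGroup Γ] [Module ℂ Γ] [Module H Γ] [Module Hᵐᵒᵖ Γ]
  {R : Type*} [Ring R] [Algebra ℂ R]

/-- The universal property of the tensor algebra of a bimodule. -/
noncomputable def lift (f : H →ₐ[ℂ] R) (g : Γ →ₗ[ℂ] R)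
    (hl : ∀ x ρ, g (x • ρ) = f x * g ρ) (hr : ∀ x ρ, g (MulOpposite.op x • ρ) = g ρ * f x) :
    BimoduleTensorAlgebra H Γ →ₐ[ℂ] R :=
  RingQuot.liftAlgHom ℂ ⟨TensorAlgebra.lift ℂ (f.toLinearMap.coprod g), by
    intro s t h
    cases h
    · simp
    · simp
    · simp [hl]
    · simp [hr]⟩

variable (f : H →ₐ[ℂ] R) (g : Γ →ₗ[ℂ] R)
  (hl : ∀ x ρ, g (x • ρ) = f x * g ρ) (hr : ∀ x ρ, g (MulOpposite.op x • ρ) = g ρ * f x)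

theorem lift_ofScalar (x : H) : lift f g hl hr (ofScalar H Γ x) = f x := by
  refine (RingQuot.liftAlgHom_mkAlgHom_apply ℂ _ _ _).trans ?_
  simp

theorem lift_ofForm (ρ : Γ) : lift f g hl hr (ofForm H Γ ρ) = g ρ := by
  refine (RingQuot.liftAlgHom_mkAlgHom_apply ℂ _ _ _).trans ?_
  simp

end BimoduleTensorAlgebra

namespace LeftCovariantFODC

variable {H : Type*} [Ring H] [HopfAlgebra ℂ H]
  {Γ : Type*} [AddCommGroup Γ] [Module ℂ Γ] [Module H Γ] [Module Hᵐᵒᵖ Γ]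
  [IsScalarTower ℂ H Γ] [IsScalarTower ℂ Hᵐᵒᵖ Γ] [SMulCommClass H Hᵐᵒᵖ Γ]
  (c : LeftCovariantFODC H Γ)

/-- The quotient map from the free algebra on `H × Γ` to the algebra of forms. -/
noncomputable def formsMk : TensorAlgebra ℂ (H × Γ) →ₐ[ℂ] c.Forms :=
  (RingQuot.mkAlgHom ℂ c.WedgeRel).comp (RingQuot.mkAlgHom ℂ (BimoduleTensorRel H Γ))

theorem formsMk_rel {s t : TensorAlgebra ℂ (H × Γ)} (h : BimoduleTensorRel H Γ s t) :
    c.formsMk s = c.formsMk t :=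
  congr(RingQuot.mkAlgHom ℂ c.WedgeRel $(RingQuot.mkAlgHom_rel ℂ h))

theorem formsMk_scalar (x : H) : c.formsMk (TensorAlgebra.ι ℂ (x, 0)) = c.ofScalar x := rfl

theorem formsMk_form (ρ : Γ) : c.formsMk (TensorAlgebra.ι ℂ (0, ρ)) = c.ofForm ρ := rfl

theorem ofScalar_one : c.ofScalar 1 = 1 := by
  simpa [formsMk_scalar] using c.formsMk_rel .one

theorem ofScalar_mul (x y : H) : c.ofScalar (x * y) = c.ofScalar x * c.ofScalar y := by
  simpa [formsMk_scalar] using (c.formsMk_rel (.mul x y)).symm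

theorem ofForm_smul (x : H) (ρ : Γ) : c.ofForm (x • ρ) = c.ofScalar x * c.ofForm ρ := by
  simpa [formsMk_scalar, formsMk_form] using (c.formsMk_rel (.left x ρ)).symm

theorem ofForm_op_smul (x : H) (ρ : Γ) :
    c.ofForm (MulOpposite.op x • ρ) = c.ofForm ρ * c.ofScalar x := by
  simpa [formsMk_scalar, formsMk_form] using (c.formsMk_rel (.right ρ x)).symm

theorem sweedler_omega_omega (x : H) (hx : x ∈ c.idealR) :
    sweedler (LinearMap.mul ℂ c.Forms) (c.ofForm ∘ₗ c.omega) (c.ofForm ∘ₗ c.omega) x = 0 := by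
  have h := RingQuot.mkAlgHom_rel ℂ (WedgeRel.of (c := c) x hx)
  rw [map_zero, sweedler_mul'_eq] at h
  refine Eq.trans (map_sweedler (RingQuot.mkAlgHom ℂ c.WedgeRel).toLinearMap _ _ _ _ _ _ ?_ x).symm h
  intro a b
  exact map_mul (RingQuot.mkAlgHom ℂ c.WedgeRel) _ _

section lift
variable {R : Type*} [Ring R] [Algebra ℂ R]

/-- The universal property of the algebra of forms. -/
noncomputable def formsLift (f : H →ₐ[ℂ] R) (g : Γ →ₗ[ℂ] R)
    (hl : ∀ x ρ, g (x • ρ) = f x * g ρ) (hr : ∀ x ρ, g (MulOpposite.op x • ρ) = g ρ * f x)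
    (hw : ∀ x ∈ c.idealR, sweedler (LinearMap.mul ℂ R) (g ∘ₗ c.omega) (g ∘ₗ c.omega) x = 0) :
    c.Forms →ₐ[ℂ] R :=
  RingQuot.liftAlgHom ℂ ⟨BimoduleTensorAlgebra.lift f g hl hr, by
    intro s t h
    cases h with
    | of x hx =>
      rw [map_zero, sweedler_mul'_eq, ← hw x hx, ← AlgHom.toLinearMap_apply]
      refine map_sweedler _ _ _ _ _ _ _ ?_ x
      intro a b
      simp [BimoduleTensorAlgebra.lift_ofForm]⟩

variable (f : H →ₐ[ℂ] R) (g : Γ →ₗ[ℂ] R)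
  (hl : ∀ x ρ, g (x • ρ) = f x * g ρ) (hr : ∀ x ρ, g (MulOpposite.op x • ρ) = g ρ * f x)
  (hw : ∀ x ∈ c.idealR, sweedler (LinearMap.mul ℂ R) (g ∘ₗ c.omega) (g ∘ₗ c.omega) x = 0)

theorem formsLift_ofScalar (x : H) : c.formsLift f g hl hr hw (c.ofScalar x) = f x :=
  (RingQuot.liftAlgHom_mkAlgHom_apply ℂ _ _ _).trans
    (BimoduleTensorAlgebra.lift_ofScalar f g hl hr x)

theorem formsLift_ofForm (ρ : Γ) : c.formsLift f g hl hr hw (c.ofForm ρ) = g ρ :=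
  (RingQuot.liftAlgHom_mkAlgHom_apply ℂ _ _ _).trans
    (BimoduleTensorAlgebra.lift_ofForm f g hl hr ρ)

end lift

theorem ofScalar_mem_degree (x : H) : c.ofScalar x ∈ c.degree 0 := by
  rw [degree, pow_zero, mul_one]
  exact LinearMap.mem_range_self _ _

theorem ofForm_mem_degree (ρ : Γ) : c.ofForm ρ ∈ c.degree 1 := by
  rw [degree, pow_one, ← one_mul (c.ofForm ρ), ← ofScalar_one]
  exact Submodule.mul_mem_mul (LinearMap.mem_range_self _ _) (LinearMap.mem_range_self _ _)

theorem degree_succ (n : ℕ) : c.degree (n + 1) = c.degree n * LinearMap.range c.ofForm := by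
  rw [degree, degree, pow_succ, mul_assoc]

/-- As ρ x is again a one-form, coefficients can be moved to the left past any number of one-forms.
This is what makes `degree` multiplicative. -/
theorem range_ofForm_pow_mul_le (n : ℕ) :
    LinearMap.range c.ofForm ^ n * LinearMap.range c.ofScalar ≤
      LinearMap.range c.ofScalar * LinearMap.range c.ofForm ^ n := by
  induction n with
  | zero => simp
  | succ n ih =>
    have h : LinearMap.range c.ofForm * LinearMap.range c.ofScalar ≤
        LinearMap.range c.ofScalar * LinearMap.range c.ofForm := by
      rw [Submodule.mul_le]
      rintro _ ⟨ρ, rfl⟩ _ ⟨x, rfl⟩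
      rw [← ofForm_op_smul, ← one_mul (c.ofForm _), ← ofScalar_one]
      exact Submodule.mul_mem_mul (LinearMap.mem_range_self _ _) (LinearMap.mem_range_self _ _)
    calc _ = LinearMap.range c.ofForm ^ n * (LinearMap.range c.ofForm *
          LinearMap.range c.ofScalar) := by rw [pow_succ, mul_assoc]
      _ ≤ LinearMap.range c.ofForm ^ n * (LinearMap.range c.ofScalar *
          LinearMap.range c.ofForm) := mul_le_mul_right h _
      _ = LinearMap.range c.ofForm ^ n * LinearMap.range c.ofScalar *
          LinearMap.range c.ofForm := by rw [mul_assoc]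
      _ ≤ LinearMap.range c.ofScalar * LinearMap.range c.ofForm ^ n *
          LinearMap.range c.ofForm := mul_le_mul_left ih _
      _ = _ := by rw [pow_succ, mul_assoc]

theorem degree_mul_degree_le (m n : ℕ) : c.degree m * c.degree n ≤ c.degree (m + n) := by
  have hs : LinearMap.range c.ofScalar * LinearMap.range c.ofScalar ≤
      LinearMap.range c.ofScalar := by
    rw [Submodule.mul_le]
    rintro _ ⟨x, rfl⟩ _ ⟨y, rfl⟩
    exact ⟨x * y, c.ofScalar_mul x y⟩
  calc c.degree m * c.degree n = LinearMap.range c.ofScalar *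
        (LinearMap.range c.ofForm ^ m * LinearMap.range c.ofScalar) *
        LinearMap.range c.ofForm ^ n := by simp only [degree, mul_assoc]
    _ ≤ LinearMap.range c.ofScalar *
        (LinearMap.range c.ofScalar * LinearMap.range c.ofForm ^ m) *
        LinearMap.range c.ofForm ^ n :=
      mul_le_mul_left (mul_le_mul_right (c.range_ofForm_pow_mul_le m) _) _
    _ = (LinearMap.range c.ofScalar * LinearMap.range c.ofScalar) *
        (LinearMap.range c.ofForm ^ m * LinearMap.range c.ofForm ^ n) := by simp only [mul_assoc]
    _ ≤ LinearMap.range c.ofScalar *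
        (LinearMap.range c.ofForm ^ m * LinearMap.range c.ofForm ^ n) := mul_le_mul_left hs _
    _ = c.degree (m + n) := by rw [degree, pow_add]

theorem mul_mem_degree {m n : ℕ} {α β : c.Forms} (hα : α ∈ c.degree m) (hβ : β ∈ c.degree n) :
    α * β ∈ c.degree (m + n) :=
  c.degree_mul_degree_le m n (Submodule.mul_mem_mul hα hβ)

/-- The supremum is closed under products and contains the generators. Only this spanning property
is used below, never directness of the sum. -/
theorem iSup_degree : ⨆ n, c.degree n = ⊤ := by
  have hm : (⨆ n, c.degree n) * (⨆ n, c.degree n) ≤ ⨆ n, c.degree n := by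
    rw [Submodule.iSup_mul, iSup_le_iff]
    intro m
    rw [Submodule.mul_iSup, iSup_le_iff]
    intro n
    exact (c.degree_mul_degree_le m n).trans (le_iSup c.degree _)
  have hs : ∀ x, c.ofScalar x ∈ ⨆ n, c.degree n := fun x ↦
    Submodule.mem_iSup_of_mem 0 (c.ofScalar_mem_degree x)
  have hf : ∀ ρ, c.ofForm ρ ∈ ⨆ n, c.degree n := fun ρ ↦
    Submodule.mem_iSup_of_mem 1 (c.ofForm_mem_degree ρ)
  rw [eq_top_iff]
  rintro α -
  obtain ⟨t, rfl⟩ := RingQuot.mkAlgHom_surjective ℂ c.WedgeRel α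
  obtain ⟨t, rfl⟩ := RingQuot.mkAlgHom_surjective ℂ (BimoduleTensorRel H Γ) t
  change c.formsMk t ∈ _
  induction t using TensorAlgebra.induction with
  | algebraMap r =>
    rw [AlgHom.commutes, Algebra.algebraMap_eq_smul_one, ← ofScalar_one]
    exact Submodule.smul_mem _ _ (hs 1)
  | ι p =>
    have : c.formsMk (TensorAlgebra.ι ℂ p) = c.ofScalar p.1 + c.ofForm p.2 := by
      rw [← formsMk_scalar, ← formsMk_form, ← map_add, ← map_add]
      simp
    rw [this]
    exact add_mem (hs _) (hf _)
  | mul a b ha hb =>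
    rw [map_mul]
    exact hm (Submodule.mul_mem_mul ha hb)
  | add a b ha hb =>
    rw [map_add]
    exact add_mem ha hb

theorem forms_linearMap_ext {N : Type*} [AddCommGroup N] [Module ℂ N] {F G : c.Forms →ₗ[ℂ] N}
    (h : ∀ n, ∀ α ∈ c.degree n, F α = G α) : F = G := by
  have : (⊤ : Submodule ℂ c.Forms) ≤ LinearMap.eqLocus F G := by
    rw [← iSup_degree, iSup_le_iff]
    exact h
  exact LinearMap.ext fun α ↦ this trivial

/-- A predicate holds on all forms of degree `n` if it is additive, holds on elements of `H` and is
preserved under right multiplication by one-forms. -/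
theorem degree_induction {p : ℕ → c.Forms → Prop} (scalar : ∀ x, p 0 (c.ofScalar x))
    (mul : ∀ n α ρ, α ∈ c.degree n → p n α → p (n + 1) (α * c.ofForm ρ))
    (add : ∀ n α β, p n α → p n β → p n (α + β)) :
    ∀ n, ∀ α ∈ c.degree n, p n α := by
  intro n
  induction n with
  | zero =>
    intro α hα
    rw [degree, pow_zero, mul_one] at hα
    obtain ⟨x, rfl⟩ := hα
    exact scalar x
  | succ n ih =>
    intro α hα
    rw [degree_succ] at hα
    induction hα using Submodule.mul_induction_on' with
    | mem_mul_mem m hm n hn =>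
      obtain ⟨ρ, rfl⟩ := hn
      exact mul _ _ _ hm (ih _ hm)
    | add x _ y _ hx hy => exact add _ _ _ hx hy

/-! ### The exterior derivative -/

theorem IsExteriorDerivative.apply_ofForm {c : LeftCovariantFODC H Γ} {δ : c.Forms →ₗ[ℂ] c.Forms}
    (h : c.IsExteriorDerivative δ) (x y : H) :
    δ (c.ofForm (x • c.d y)) = c.ofForm (c.d x) * c.ofForm (c.d y) := by
  rw [ofForm_smul, h.leibniz 0 _ (c.ofScalar_mem_degree x), h.apply_scalar, ← h.apply_scalar y,
    h.square]
  simp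

/-- On one-forms, the Leibniz rule and δ² = 0 force δ(x dy) = dx ∧ dy; higher degrees follow by
Leibniz. -/
theorem IsExteriorDerivative.unique {c : LeftCovariantFODC H Γ} {δ δ' : c.Forms →ₗ[ℂ] c.Forms}
    (h : c.IsExteriorDerivative δ) (h' : c.IsExteriorDerivative δ') : δ' = δ := by
  have hf : ∀ ρ, δ' (c.ofForm ρ) = δ (c.ofForm ρ) := by
    intro ρ
    induction ρ using c.smul_d_induction with
    | h x y => rw [h.apply_ofForm, h'.apply_ofForm]
    | zero => simp
    | add ρ τ h₁ h₂ => simp only [map_add, h₁, h₂]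
  refine c.forms_linearMap_ext (c.degree_induction ?_ ?_ ?_)
  · intro x
    rw [h.apply_scalar, h'.apply_scalar]
  · intro n α ρ hα ih
    rw [h.leibniz n α hα, h'.leibniz n α hα, ih, hf]
  · intro n α β h₁ h₂
    rw [map_add, map_add, h₁, h₂]

/-- The exterior derivative of one-forms. -/
theorem exists_oneForm_derivative : ∃ F : Γ →ₗ[ℂ] c.Forms, ∀ x a,
    F (x • c.omega a) = c.ofForm (c.d x) * c.ofForm (c.omega a) -
      c.ofScalar x * sweedler (LinearMap.mul ℂ c.Forms) (c.ofForm ∘ₗ c.omega)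
        (c.ofForm ∘ₗ c.omega) a := by
  -- The value on x ω(a) is dictated by the Leibniz rule and the Maurer–Cartan formula dω(a) = −∑
  -- ω(a₁) ∧ ω(a₂).
  obtain ⟨F, hF⟩ := c.exists_linearMap
    ((LinearMap.mul ℂ c.Forms).compl₁₂ (c.ofForm ∘ₗ c.d) (c.ofForm ∘ₗ c.omega) -
      (LinearMap.mul ℂ c.Forms).compl₁₂ c.ofScalar
        (sweedler (LinearMap.mul ℂ c.Forms) (c.ofForm ∘ₗ c.omega) (c.ofForm ∘ₗ c.omega))) (by
      intro a ha x
      -- Well-definedness is exactly what the relations imposed by R provide: as ω(1) = 0, an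
      -- element killed by ω lies in R up to a constant.
      have h : a - Coalgebra.counit (R := ℂ) a • (1 : H) ∈ c.idealR := by
        simp [idealR, ha, omega_one]
      have h1 := c.sweedler_omega_omega _ h
      have h2 : sweedler (LinearMap.mul ℂ c.Forms) (c.ofForm ∘ₗ c.omega) (c.ofForm ∘ₗ c.omega)
          (1 : H) = 0 := by
        simp [sweedler_apply, Algebra.TensorProduct.one_def, omega_one]
      rw [map_sub, map_smul, h2, smul_zero, sub_zero] at h1
      simp [ha, h1])
  exact ⟨F, fun x a ↦ by simp [hF]⟩

/-- The exterior derivative of one-forms. -/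
noncomputable def dOne : Γ →ₗ[ℂ] c.Forms := c.exists_oneForm_derivative.choose

theorem dOne_smul_omega (x a : H) : c.dOne (x • c.omega a) =
    c.ofForm (c.d x) * c.ofForm (c.omega a) -
      c.ofScalar x * sweedler (LinearMap.mul ℂ c.Forms) (c.ofForm ∘ₗ c.omega)
        (c.ofForm ∘ₗ c.omega) a :=
  c.exists_oneForm_derivative.choose_spec x a

theorem dOne_omega (a : H) : c.dOne (c.omega a) =
    -sweedler (LinearMap.mul ℂ c.Forms) (c.ofForm ∘ₗ c.omega) (c.ofForm ∘ₗ c.omega) a := by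
  have h := c.dOne_smul_omega 1 a
  rw [one_smul, d_one, map_zero, zero_mul, zero_sub, ofScalar_one, one_mul] at h
  exact h

/-- Expanding dy = ∑ y₁ ω(y₂) gives the terms dx y₁ ω(y₂) and x dy₁ ω(y₂), minus x y₁ ω(y₂) ω(y₃).
The last two cancel, by the identity `h`. -/
theorem dOne_smul_d (x y : H) :
    c.dOne (x • c.d y) = c.ofForm (c.d x) * c.ofForm (c.d y) := by
  have h : sweedler (LinearMap.mul ℂ c.Forms) (c.ofForm ∘ₗ c.d) (c.ofForm ∘ₗ c.omega) =
      sweedler (LinearMap.mul ℂ c.Forms) c.ofScalar (sweedler (LinearMap.mul ℂ c.Forms)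
        (c.ofForm ∘ₗ c.omega) (c.ofForm ∘ₗ c.omega)) := by
    rw [← sweedler_assoc (LinearMap.mul ℂ c.Forms) (LinearMap.mul ℂ c.Forms) (LinearMap.mul ℂ _)
      (LinearMap.mul ℂ _) (fun a b c ↦ by simp [mul_assoc])]
    congr 1
    ext z
    rw [LinearMap.comp_apply, d_eq_sweedler]
    refine map_sweedler _ _ _ _ _ _ _ (fun a b ↦ ?_) z
    simp [ofForm_smul]
  have h' := LinearMap.congr_fun h y
  rw [sweedler_eq_sum, sweedler_eq_sum] at h'
  simp only [LinearMap.mul_apply', LinearMap.comp_apply] at h'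
  nth_rw 1 [d_eq_sweedler]
  rw [sweedler_eq_sum, Finset.smul_sum, map_sum]
  simp only [AlgHom.toLinearMap_apply, Algebra.lsmul_coe, ← mul_smul, dOne_smul_omega,
    LinearMap.id_apply, c.leibniz, map_add, ofForm_smul, ofForm_op_smul, add_mul,
    ofScalar_mul, Finset.sum_sub_distrib, Finset.sum_add_distrib]
  simp only [mul_assoc, ← Finset.mul_sum, h']
  rw [add_sub_cancel_left]
  congr 1
  simp only [← ofForm_smul, ← map_sum]
  congr 1
  conv_rhs => rw [d_eq_sweedler, sweedler_eq_sum]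
  rfl

/-- Together with `dOne_op_smul`, where a sign appears because ρ has degree one, this is the
compatibility with the bimodule structure that `derivationHom` requires. -/
theorem dOne_smul (x : H) (ρ : Γ) :
    c.dOne (x • ρ) = c.ofForm (c.d x) * c.ofForm ρ + c.ofScalar x * c.dOne ρ := by
  induction ρ using c.smul_d_induction with
  | h y z =>
    rw [← mul_smul, dOne_smul_d, dOne_smul_d, c.leibniz, map_add, ofForm_smul, ofForm_op_smul,
      ofForm_smul]
    noncomm_ring
  | zero => simp
  | add ρ τ h₁ h₂ =>
    simp only [smul_add, map_add, h₁, h₂]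
    noncomm_ring

theorem dOne_op_smul (x : H) (ρ : Γ) :
    c.dOne (MulOpposite.op x • ρ) = c.dOne ρ * c.ofScalar x - c.ofForm ρ * c.ofForm (c.d x) := by
  induction ρ using c.smul_d_induction with
  | h y z =>
    have h : MulOpposite.op x • y • c.d z = y • c.d (z * x) - (y * z) • c.d x := by
      rw [c.leibniz, smul_add, ← mul_smul, ← smul_comm]; abel
    rw [h, map_sub, dOne_smul_d, dOne_smul_d, dOne_smul_d, c.leibniz, c.leibniz]
    simp only [map_add, ofForm_smul, ofForm_op_smul]
    noncomm_ring
  | zero => simp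
  | add ρ τ h₁ h₂ =>
    simp only [smul_add, map_add, h₁, h₂]
    noncomm_ring

/-- The algebra homomorphism from forms to upper triangular matrices that encodes the graded
derivation. -/
noncomputable def derivationHom : c.Forms →ₐ[ℂ] Matrix (Fin 2) (Fin 2) c.Forms :=
  c.formsLift
    (AlgHom.ofLinearMap
      { toFun := fun x ↦ !![c.ofScalar x, c.ofForm (c.d x); 0, c.ofScalar x]
        map_add' := fun x y ↦ by apply matrix_fin_two_ext <;> simp
        map_smul' := fun r x ↦ by apply matrix_fin_two_ext <;> simp }
      (by simp [ofScalar_one, d_one, Matrix.one_fin_two])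
      (fun x y ↦ by
        apply matrix_fin_two_ext <;> simp [ofScalar_mul, c.leibniz, ofForm_smul, ofForm_op_smul]))
    -- The sign in the upper left entry makes a product of n one-forms acquire (−1)ⁿ there, which is
    -- the sign in the graded Leibniz rule.
    { toFun := fun ρ ↦ !![-c.ofForm ρ, c.dOne ρ; 0, c.ofForm ρ]
      map_add' := fun x y ↦ by apply matrix_fin_two_ext <;> simp [add_comm]
      map_smul' := fun r x ↦ by apply matrix_fin_two_ext <;> simp }
    (fun x ρ ↦ by
      apply matrix_fin_two_ext <;> simp [ofForm_smul, dOne_smul, add_comm])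
    (fun x ρ ↦ by
      apply matrix_fin_two_ext <;> simp [ofForm_op_smul, dOne_op_smul, sub_eq_neg_add])
    -- For x in R the diagonal entries vanish by the wedge relation. The corner is ∑ dω(x₁) ω(x₂) −
    -- ω(x₁) dω(x₂); by Maurer–Cartan both parts are threefold products, which cancel by
    -- coassociativity.
    (fun x hx ↦ by
      have h := c.sweedler_omega_omega x hx
      rw [sweedler_eq_sum] at h
      have h' := LinearMap.congr_fun (sweedler_assoc (LinearMap.mul ℂ c.Forms)
        (LinearMap.mul ℂ c.Forms) (LinearMap.mul ℂ _) (LinearMap.mul ℂ _)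
        (fun a b c ↦ by simp [mul_assoc]) (c.ofForm ∘ₗ c.omega) (c.ofForm ∘ₗ c.omega)
        (c.ofForm ∘ₗ c.omega)) x
      rw [sweedler_eq_sum _ (sweedler _ _ _), sweedler_eq_sum _ _ (sweedler _ _ _)] at h'
      simp only [LinearMap.mul_apply', LinearMap.comp_apply] at h h'
      rw [sweedler_eq_sum]
      apply matrix_fin_two_ext <;> simp [Matrix.sum_apply, h, dOne_omega, Finset.sum_add_distrib, h'])

theorem derivationHom_ofScalar (x : H) : c.derivationHom (c.ofScalar x) =
    !![c.ofScalar x, c.ofForm (c.d x); 0, c.ofScalar x] :=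
  c.formsLift_ofScalar _ _ _ _ _ x

theorem derivationHom_ofForm (ρ : Γ) : c.derivationHom (c.ofForm ρ) =
    !![-c.ofForm ρ, c.dOne ρ; 0, c.ofForm ρ] :=
  c.formsLift_ofForm _ _ _ _ _ ρ

/-- The exterior derivative. -/
noncomputable def extDeriv : c.Forms →ₗ[ℂ] c.Forms :=
  Matrix.entryLinearMap ℂ c.Forms 0 1 ∘ₗ c.derivationHom.toLinearMap

theorem extDeriv_apply (α : c.Forms) : c.extDeriv α = c.derivationHom α 0 1 := rfl

theorem extDeriv_ofScalar (x : H) : c.extDeriv (c.ofScalar x) = c.ofForm (c.d x) := by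
  simp [extDeriv_apply, derivationHom_ofScalar]

theorem extDeriv_ofForm (ρ : Γ) : c.extDeriv (c.ofForm ρ) = c.dOne ρ := by
  simp [extDeriv_apply, derivationHom_ofForm]

theorem derivationHom_eq : ∀ n, ∀ α ∈ c.degree n,
    c.derivationHom α = !![(-1 : ℂ) ^ n • α, c.extDeriv α; 0, α] := by
  refine c.degree_induction ?_ ?_ ?_
  · intro x
    rw [derivationHom_ofScalar, extDeriv_ofScalar]
    simp
  · intro n α ρ hα h
    rw [extDeriv_apply, map_mul, h, derivationHom_ofForm]
    apply matrix_fin_two_ext <;> simp [pow_succ]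
  · intro n α β hα hβ
    rw [map_add, map_add, hα, hβ]
    apply matrix_fin_two_ext <;> simp

/-- The second factor in the graded Leibniz rule is an arbitrary form, so this entry is needed
without homogeneity. -/
theorem derivationHom_one_one (β : c.Forms) : c.derivationHom β 1 1 = β := by
  have h : Matrix.entryLinearMap ℂ c.Forms 1 1 ∘ₗ c.derivationHom.toLinearMap = LinearMap.id := by
    refine c.forms_linearMap_ext fun n α hα ↦ ?_
    simp [c.derivationHom_eq n α hα]
  exact LinearMap.congr_fun h β

theorem extDeriv_mul (n : ℕ) (α : c.Forms) (hα : α ∈ c.degree n) (β : c.Forms) :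
    c.extDeriv (α * β) = c.extDeriv α * β + (-1 : ℂ) ^ n • (α * c.extDeriv β) := by
  rw [extDeriv_apply, map_mul, c.derivationHom_eq n α hα, Matrix.mul_apply, Fin.sum_univ_two,
    derivationHom_one_one]
  simp [extDeriv_apply, add_comm]

theorem extDeriv_ofForm_mem (ρ : Γ) : c.extDeriv (c.ofForm ρ) ∈ c.degree (1 + 1) := by
  rw [extDeriv_ofForm]
  induction ρ using c.smul_d_induction with
  | h x y =>
    rw [dOne_smul_d]
    exact c.mul_mem_degree (c.ofForm_mem_degree _) (c.ofForm_mem_degree _)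
  | zero => simp
  | add ρ τ h₁ h₂ =>
    rw [map_add]
    exact add_mem h₁ h₂

theorem extDeriv_mem_degree : ∀ n, ∀ α ∈ c.degree n, c.extDeriv α ∈ c.degree (n + 1) := by
  refine c.degree_induction ?_ ?_ ?_
  · intro x
    rw [extDeriv_ofScalar]
    exact c.ofForm_mem_degree _
  · intro n α ρ hα h
    rw [c.extDeriv_mul n α hα]
    refine add_mem (c.mul_mem_degree h (c.ofForm_mem_degree ρ)) (Submodule.smul_mem _ _ ?_)
    have h2 := c.mul_mem_degree hα (c.extDeriv_ofForm_mem ρ)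
    exact h2
  · intro n α β hα hβ
    rw [map_add]
    exact add_mem hα hβ

theorem extDeriv_extDeriv_ofForm (ρ : Γ) : c.extDeriv (c.extDeriv (c.ofForm ρ)) = 0 := by
  have hd : ∀ x, c.extDeriv (c.ofForm (c.d x)) = 0 := by
    intro x
    have h := c.dOne_smul_d 1 x
    rw [extDeriv_ofForm]
    simpa [d_one] using h
  rw [extDeriv_ofForm]
  induction ρ using c.smul_d_induction with
  | h x y => rw [dOne_smul_d, c.extDeriv_mul 1 _ (c.ofForm_mem_degree _), hd, hd]; simp
  | zero => simp
  | add ρ τ h₁ h₂ => rw [map_add, map_add, h₁, h₂, add_zero]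

theorem extDeriv_extDeriv (α : c.Forms) : c.extDeriv (c.extDeriv α) = 0 := by
  have h : c.extDeriv ∘ₗ c.extDeriv = 0 := by
    refine c.forms_linearMap_ext (c.degree_induction ?_ ?_ ?_)
    · intro x
      have h := c.dOne_smul_d 1 x
      rw [LinearMap.comp_apply, extDeriv_ofScalar, extDeriv_ofForm]
      simpa [d_one] using h
    · intro n α ρ hα h
      rw [LinearMap.comp_apply, LinearMap.zero_apply] at h
      rw [LinearMap.comp_apply, c.extDeriv_mul n α hα, map_add, map_smul,
        c.extDeriv_mul (n + 1) _ (c.extDeriv_mem_degree n α hα), c.extDeriv_mul n α hα, h,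
        extDeriv_extDeriv_ofForm]
      -- The term δα ∧ δρ occurs with the signs (−1)ⁿ⁺¹ and (−1)ⁿ.
      simp [pow_succ]
    · intro n α β hα hβ
      simpa using congr($hα + $hβ)
  exact LinearMap.congr_fun h α

theorem extDeriv_isExteriorDerivative : c.IsExteriorDerivative c.extDeriv :=
  ⟨c.extDeriv_ofScalar, c.extDeriv_mem_degree, c.extDeriv_mul, c.extDeriv_extDeriv⟩

end LeftCovariantFODC

/-! ### Characters, twists and the values of the `X_j` on generators -/

theorem DualPairing.rep_K_pow (P : QuantumParameter) (n : ℕ) :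
    rep P (Uq.K P ^ n) = !![P.r⁻¹ ^ n, 0; 0, P.r ^ n] := by
  induction n with
  | zero => simp [Matrix.one_fin_two]
  | succ n ih => rw [pow_succ, map_mul, ih]; simp [rep, pow_succ]

namespace SLq

variable (P : QuantumParameter)

/-- The character of `𝒪(SL_q(2))` given by `K ^ n`. -/
noncomputable def character (n : ℕ) : SLq P →ₐ[ℂ] ℂ :=
  AlgHom.ofLinearMap (dualPairing P (Uq.K P ^ n)) (by simp [dualPairing_apply_one])
    (fun x y ↦ by simp [dualPairing_apply_mul, Bialgebra.comul_pow])

theorem character_apply (n : ℕ) (x : SLq P) : character P n x = dualPairing P (Uq.K P ^ n) x := rfl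

@[simp] theorem character_A (n : ℕ) : character P n (A P) = P.r⁻¹ ^ n := by
  simp [character_apply, dualPairing_A, DualPairing.rep_K_pow]
@[simp] theorem character_B (n : ℕ) : character P n (B P) = 0 := by
  simp [character_apply, dualPairing_B, DualPairing.rep_K_pow]
@[simp] theorem character_C (n : ℕ) : character P n (C P) = 0 := by
  simp [character_apply, dualPairing_C, DualPairing.rep_K_pow]
@[simp] theorem character_D (n : ℕ) : character P n (D P) = P.r ^ n := by
  simp [character_apply, dualPairing_D, DualPairing.rep_K_pow]

/-- The automorphism `x ↦ ∑ x₁ ⟨K ^ n, x₂⟩` of `𝒪(SL_q(2))`. -/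
noncomputable def twist (n : ℕ) : SLq P →ₐ[ℂ] SLq P :=
  (Algebra.TensorProduct.rid ℂ ℂ (SLq P)).toAlgHom.comp
    ((Algebra.TensorProduct.map (AlgHom.id ℂ _) (character P n)).comp
      (Bialgebra.comulAlgHom ℂ (SLq P)))

@[simp] theorem twist_A (n : ℕ) : twist P n (A P) = P.r⁻¹ ^ n • A P := by simp [twist]
@[simp] theorem twist_B (n : ℕ) : twist P n (B P) = P.r ^ n • B P := by simp [twist]
@[simp] theorem twist_C (n : ℕ) : twist P n (C P) = P.r⁻¹ ^ n • C P := by simp [twist]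
@[simp] theorem twist_D (n : ℕ) : twist P n (D P) = P.r ^ n • D P := by simp [twist]

theorem twist_twist (m n : ℕ) (x : SLq P) : twist P m (twist P n x) = twist P (m + n) x := by
  have h : (twist P m).comp (twist P n) = twist P (m + n) := by
    apply algHom_ext <;> simp [smul_smul, pow_add, mul_comm]
  exact DFunLike.congr_fun h x

open Coalgebra in
theorem twist_eq_sum (n : ℕ) (x : SLq P) : twist P n x = ∑ i ∈ (ℛ ℂ x).index,
    character P n ((ℛ ℂ x).right i) • (ℛ ℂ x).left i := by
  simp only [twist, AlgHom.comp_apply, Bialgebra.comulAlgHom_apply]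
  conv_lhs => rw [← (ℛ ℂ x).eq]
  simp

end SLq

/-- The exponent of the power of `K` in the coproduct of `X_j`. -/
abbrev tangentWeight (j : Fin 3) : ℕ := if j = 1 then 4 else 2

section values
variable (P : QuantumParameter)

theorem tangentFunctional_mul' (j : Fin 3) (x y : SLq P) :
    tangentFunctional P j (x * y) = Coalgebra.counit (R := ℂ) x * tangentFunctional P j y +
      tangentFunctional P j x * SLq.character P (tangentWeight j) y :=
  tangentFunctional_mul P j x y

theorem tangentFunctional_one (j : Fin 3) : tangentFunctional P j 1 = 0 := by
  fin_cases j <;> simp [tangentFunctional, tangentVector, dualPairing_apply_one]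

/-- The normalisations of the X_j make B, A, C dual to X₀, X₁, X₂; on D only X₁ survives, with value
(1 − q⁻²)⁻¹(1 − q²) = −q². -/
theorem rep_tangentVector (j : Fin 3) : DualPairing.rep P (tangentVector P j) =
    ![!![0, 1; 0, 0], !![1, 0; 0, -P.q ^ 2], !![0, 0; 1, 0]] j := by
  have hr := P.r_ne_zero
  have hq := P.q_ne_zero
  have h1 := P.one_sub_inv_ne_zero
  fin_cases j
  · apply matrix_fin_two_ext <;> simp [tangentVector, DualPairing.rep, hr]
  · have e : P.r⁻¹ ^ 4 = (P.q ^ 2)⁻¹ := by rw [← P.r_sq]; ring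
    have e' : P.r ^ 4 = P.q ^ 2 := by rw [← P.r_sq]; ring
    have h2 : (1 - (P.q ^ 2)⁻¹)⁻¹ * (1 - P.q ^ 2) = -P.q ^ 2 := by
      rw [inv_mul_eq_iff_eq_mul₀ h1]; field_simp; ring
    apply matrix_fin_two_ext <;>
    simp [tangentVector, DualPairing.rep_K_pow, Matrix.one_fin_two, e, e', h1, h2]
  · apply matrix_fin_two_ext <;> simp [tangentVector, DualPairing.rep, hr]

theorem tangentFunctional_A (j : Fin 3) : tangentFunctional P j (SLq.A P) = ![0, 1, 0] j := by
  rw [tangentFunctional, dualPairing_A, rep_tangentVector]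
  fin_cases j <;> simp
theorem tangentFunctional_B (j : Fin 3) : tangentFunctional P j (SLq.B P) = ![1, 0, 0] j := by
  rw [tangentFunctional, dualPairing_B, rep_tangentVector]
  fin_cases j <;> simp
theorem tangentFunctional_C (j : Fin 3) : tangentFunctional P j (SLq.C P) = ![0, 0, 1] j := by
  rw [tangentFunctional, dualPairing_C, rep_tangentVector]
  fin_cases j <;> simp
theorem tangentFunctional_D (j : Fin 3) :
    tangentFunctional P j (SLq.D P) = ![0, -P.q ^ 2, 0] j := by
  rw [tangentFunctional, dualPairing_D, rep_tangentVector]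
  fin_cases j <;> simp

end values

/-! ### Calculi with tangent space spanned by the `X_j` -/

namespace LeftCovariantFODC

section general
variable {H : Type*} [Ring H] [HopfAlgebra ℂ H]
  {Γ : Type*} [AddCommGroup Γ] [Module ℂ Γ] [Module H Γ] [Module Hᵐᵒᵖ Γ]
  [IsScalarTower ℂ H Γ] [IsScalarTower ℂ Hᵐᵒᵖ Γ] [SMulCommClass H Hᵐᵒᵖ Γ]
  (c : LeftCovariantFODC H Γ)

/-- A functional vanishing on R + ℂ1 separates any element outside this subspace; within it, ε(x) =
0 removes the constant. -/
theorem mem_idealR_iff_forall_mem_tangentSpace (x : H) :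
    x ∈ c.idealR ↔ Coalgebra.counit (R := ℂ) x = 0 ∧ ∀ X ∈ c.tangentSpace, X x = 0 := by
  refine ⟨fun hx ↦ ⟨hx.1, fun X hX ↦ hX.2 x hx⟩, fun ⟨h0, h⟩ ↦ ?_⟩
  by_contra hx
  have hx' : x ∉ c.idealR ⊔ Submodule.span ℂ {1} := by
    intro hm
    obtain ⟨y, hy, z, hz, rfl⟩ := Submodule.mem_sup.1 hm
    obtain ⟨a, rfl⟩ := Submodule.mem_span_singleton.1 hz
    have hy0 : Coalgebra.counit (R := ℂ) y = 0 := hy.1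
    rw [map_add, hy0, map_smul, Bialgebra.counit_one, zero_add, smul_eq_mul, mul_one] at h0
    rw [h0, zero_smul, add_zero] at hx
    exact hx hy
  obtain ⟨f, hf, hf'⟩ := Submodule.exists_le_ker_of_notMem hx'
  refine hf (h f ⟨hf' (Submodule.mem_sup_right (Submodule.mem_span_singleton_self 1)),
    fun y hy ↦ hf' (Submodule.mem_sup_left hy)⟩)

end general

section quantumGroup

variable {P : QuantumParameter}
  {Γ : Type*} [AddCommGroup Γ] [Module ℂ Γ] [Module (SLq P) Γ] [Module (SLq P)ᵐᵒᵖ Γ]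
  [IsScalarTower ℂ (SLq P) Γ] [IsScalarTower ℂ (SLq P)ᵐᵒᵖ Γ]
  [SMulCommClass (SLq P) (SLq P)ᵐᵒᵖ Γ] (c : LeftCovariantFODC (SLq P) Γ)

/-- The left-invariant forms `ω₀ = ω(B)`, `ω₁ = ω(A)`, `ω₂ = ω(C)`. -/
noncomputable def basisForm : Fin 3 → Γ :=
  ![c.omega (SLq.B P), c.omega (SLq.A P), c.omega (SLq.C P)]

theorem omega_A : c.omega (SLq.A P) = c.basisForm 1 := rfl
theorem omega_B : c.omega (SLq.B P) = c.basisForm 0 := rfl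
theorem omega_C : c.omega (SLq.C P) = c.basisForm 2 := rfl

variable (hT : c.tangentSpace = Submodule.span ℂ (Set.range (tangentFunctional P)))
include hT

theorem mem_idealR_iff (x : SLq P) :
    x ∈ c.idealR ↔ Coalgebra.counit (R := ℂ) x = 0 ∧ ∀ j, tangentFunctional P j x = 0 := by
  rw [mem_idealR_iff_forall_mem_tangentSpace, hT]
  refine and_congr_right fun _ ↦ ⟨fun h j ↦ h _ (Submodule.subset_span ⟨j, rfl⟩), fun h X hX ↦ ?_⟩
  induction hX using Submodule.span_induction with
  | mem X hX =>
    obtain ⟨j, rfl⟩ := hX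
    exact h j
  | zero => rfl
  | add X Y _ _ hX hY => simp [hX, hY]
  | smul a X _ hX => simp [hX]

theorem omega_eq_sum (x : SLq P) :
    c.omega x = ∑ j, tangentFunctional P j x • c.basisForm j := by
  -- Subtracting the dual elements B, A, C kills the X_j. The constant corrects ε and allows for
  -- ε(A) = 1; it does not affect ω.
  have h : x - (Coalgebra.counit (R := ℂ) x - tangentFunctional P 1 x) • 1 -
      tangentFunctional P 0 x • SLq.B P - tangentFunctional P 1 x • SLq.A P -
      tangentFunctional P 2 x • SLq.C P ∈ c.idealR := by
    rw [c.mem_idealR_iff hT]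
    constructor
    · simp
    · intro j
      fin_cases j <;> simp [tangentFunctional_A, tangentFunctional_B, tangentFunctional_C,
        tangentFunctional_one]
  have h' : c.omega _ = 0 := h.2
  simp only [map_sub, map_smul, omega_one, smul_zero, sub_zero] at h'
  rw [Fin.sum_univ_three]
  simp only [basisForm, Matrix.cons_val]
  rw [← sub_eq_zero, ← h']
  abel

theorem omega_eq_zero {x : SLq P} (hx : c.omega x = 0) (j : Fin 3) :
    tangentFunctional P j x = 0 := by
  have h : x - Coalgebra.counit (R := ℂ) x • (1 : SLq P) ∈ c.idealR := by
    simp [idealR, hx, omega_one]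
  simpa [tangentFunctional_one] using ((c.mem_idealR_iff hT _).1 h).2 j

/-- The functional is built on the elements x ω(a). The formula on x dy follows from dy = ∑ y₁
ω(y₂), because ε collapses y₁. -/
theorem exists_coordinate (i : Fin 3) : ∃ φ : Γ →ₗ[ℂ] ℂ,
    (∀ x y : SLq P, φ (x • c.d y) = Coalgebra.counit (R := ℂ) x * tangentFunctional P i y) ∧
    ∀ j, φ (c.basisForm j) = if i = j then 1 else 0 := by
  obtain ⟨φ, hφ⟩ := c.exists_linearMap ((LinearMap.mul ℂ ℂ).compl₁₂
    (Coalgebra.counit (R := ℂ) (A := SLq P)) (tangentFunctional P i))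
    (fun a ha x ↦ by simp [c.omega_eq_zero hT ha])
  refine ⟨φ, fun x y ↦ ?_, fun j ↦ ?_⟩
  · have h := sweedler_counit_left (LinearMap.mul ℂ ℂ) (Coalgebra.counit (R := ℂ) (A := SLq P))
      (tangentFunctional P i) 1 (by simp) y
    rw [sweedler_eq_sum] at h
    rw [d_eq_sweedler, sweedler_eq_sum, Finset.smul_sum, map_sum]
    simp only [AlgHom.toLinearMap_apply, Algebra.lsmul_coe, ← mul_smul, hφ, LinearMap.id_apply,
      LinearMap.compl₁₂_apply, LinearMap.mul_apply', Bialgebra.counit_mul, mul_assoc,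
      ← Finset.mul_sum] at h ⊢
    rw [h, one_mul]
  · have h : ∀ a, φ (c.omega a) = tangentFunctional P i a := by
      intro a
      have := hφ 1 a
      simpa using this
    fin_cases i <;> fin_cases j <;>
    simp [basisForm, h, tangentFunctional_A, tangentFunctional_B, tangentFunctional_C]

theorem isDualBasis_basisForm : c.IsDualBasis (tangentFunctional P) c.basisForm := by
  refine ⟨?_, ?_, c.exists_coordinate hT⟩
  · rw [Fintype.linearIndependent_iff]
    intro g hg i
    obtain ⟨φ, -, hφ⟩ := c.exists_coordinate hT i
    simpa [hφ] using congr(φ $hg)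
  · rw [inv_eq_range]
    apply le_antisymm
    · rw [Submodule.span_le]
      rintro _ ⟨j, rfl⟩
      fin_cases j <;> exact LinearMap.mem_range_self _ _
    · rintro _ ⟨x, rfl⟩
      rw [c.omega_eq_sum hT]
      exact sum_mem fun j _ ↦ Submodule.smul_mem _ _ (Submodule.subset_span ⟨j, rfl⟩)

/-- The pairing formula determines the coordinate functionals on all of Γ, so both families have the
same coordinates. -/
theorem eq_basisForm_of_isDualBasis {θ : Fin 3 → Γ}
    (hθ : c.IsDualBasis (tangentFunctional P) θ) : θ = c.basisForm := by
  ext j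
  have hj : θ j ∈ Submodule.span ℂ (Set.range c.basisForm) := by
    rw [(c.isDualBasis_basisForm hT).span_eq, ← hθ.span_eq]
    exact Submodule.subset_span ⟨j, rfl⟩
  obtain ⟨g, hg⟩ := (Submodule.mem_span_range_iff_exists_fun ℂ).1 hj
  have hgi : ∀ i, g i = if i = j then 1 else 0 := by
    intro i
    obtain ⟨φ, hφ, hφ'⟩ := c.exists_coordinate hT i
    obtain ⟨ψ, hψ, hψ'⟩ := hθ.dual i
    have e : φ = ψ := by
      ext ρ
      induction ρ using c.smul_d_induction with
      | h x y => rw [hφ, hψ]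
      | zero => simp
      | add ρ τ h₁ h₂ => rw [map_add, map_add, h₁, h₂]
    rw [← hψ' j, ← e, ← hg]
    simp [hφ']
  rw [← hg]
  simp [hgi]

theorem omega_D : c.omega (SLq.D P) = -P.q ^ 2 • c.basisForm 1 := by
  simp [c.omega_eq_sum hT, tangentFunctional_D, Fin.sum_univ_three]

open Coalgebra in
-- Take x dual to X_j in `op_smul_omega`. By the coproduct of X_i, the coordinate X_i(x y₂) − ε(x)
-- X_i(y₂) is δ_ij ⟨Kⁿ, y₂⟩.
theorem op_smul_basisForm (j : Fin 3) (y : SLq P) :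
    MulOpposite.op y • c.basisForm j = SLq.twist P (tangentWeight j) y • c.basisForm j := by
  have h : ∀ x, (∀ i, tangentFunctional P i x = if i = j then 1 else 0) →
      MulOpposite.op y • c.basisForm j = SLq.twist P (tangentWeight j) y • c.basisForm j := by
    intro x hx
    have hω : c.omega x = c.basisForm j := by simp [c.omega_eq_sum hT, hx]
    rw [← hω, op_smul_omega, SLq.twist_eq_sum, Finset.sum_smul]
    refine Finset.sum_congr rfl fun i _ ↦ ?_
    rw [smul_assoc, ← smul_comm]
    congr 1
    simp only [c.omega_eq_sum hT, tangentFunctional_mul', hx, Finset.smul_sum,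
      ← Finset.sum_sub_distrib, ← mul_smul, ← sub_smul, add_sub_cancel_left]
    simp
  fin_cases j
  · exact h (SLq.B P) (fun i ↦ by rw [tangentFunctional_B]; fin_cases i <;> simp)
  · exact h (SLq.A P) (fun i ↦ by rw [tangentFunctional_A]; fin_cases i <;> simp)
  · exact h (SLq.C P) (fun i ↦ by rw [tangentFunctional_C]; fin_cases i <;> simp)

end quantumGroup

end LeftCovariantFODC

theorem QuantumParameter.r_pow_four (P : QuantumParameter) : P.r ^ 4 = P.q ^ 2 := by
  rw [← P.r_sq]; ring

namespace LeftCovariantFODC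

variable {P : QuantumParameter}
  {Γ : Type*} [AddCommGroup Γ] [Module ℂ Γ] [Module (SLq P) Γ] [Module (SLq P)ᵐᵒᵖ Γ]
  [IsScalarTower ℂ (SLq P) Γ] [IsScalarTower ℂ (SLq P)ᵐᵒᵖ Γ]
  [SMulCommClass (SLq P) (SLq P)ᵐᵒᵖ Γ] (c : LeftCovariantFODC (SLq P) Γ)
  (hT : c.tangentSpace = Submodule.span ℂ (Set.range (tangentFunctional P)))
include hT

theorem d_generators :
    c.d (SLq.A P) = SLq.B P • c.basisForm 2 + SLq.A P • c.basisForm 1 ∧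
    c.d (SLq.B P) = SLq.A P • c.basisForm 0 - P.q ^ 2 • SLq.B P • c.basisForm 1 ∧
    c.d (SLq.C P) = SLq.C P • c.basisForm 1 + SLq.D P • c.basisForm 2 ∧
    c.d (SLq.D P) = -P.q ^ 2 • SLq.D P • c.basisForm 1 + SLq.C P • c.basisForm 0 := by
  have e : ∀ (x : SLq P) (a : ℂ) (ρ : Γ), x • a • ρ = a • x • ρ := fun x a ρ ↦ smul_comm _ _ _
  rw [d_eq_sweedler]
  refine ⟨?_, ?_, ?_, ?_⟩ <;> simp [sweedler_apply, omega_A, omega_B, omega_C, c.omega_D hT, e]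
  all_goals abel

theorem op_smul_basisForm_generators :
    (∀ j : Fin 3, j = 0 ∨ j = 2 →
      MulOpposite.op (SLq.A P) • c.basisForm j = P.q⁻¹ • SLq.A P • c.basisForm j ∧
      MulOpposite.op (SLq.B P) • c.basisForm j = P.q • SLq.B P • c.basisForm j ∧
      MulOpposite.op (SLq.C P) • c.basisForm j = P.q⁻¹ • SLq.C P • c.basisForm j ∧
      MulOpposite.op (SLq.D P) • c.basisForm j = P.q • SLq.D P • c.basisForm j) ∧
    MulOpposite.op (SLq.A P) • c.basisForm 1 = (P.q ^ 2)⁻¹ • SLq.A P • c.basisForm 1 ∧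
    MulOpposite.op (SLq.B P) • c.basisForm 1 = P.q ^ 2 • SLq.B P • c.basisForm 1 ∧
    MulOpposite.op (SLq.C P) • c.basisForm 1 = (P.q ^ 2)⁻¹ • SLq.C P • c.basisForm 1 ∧
    MulOpposite.op (SLq.D P) • c.basisForm 1 = P.q ^ 2 • SLq.D P • c.basisForm 1 := by
  refine ⟨?_, ?_⟩
  · rintro j (rfl | rfl) <;> simp [c.op_smul_basisForm hT, P.r_sq]
  · simp [c.op_smul_basisForm hT, P.r_pow_four]

theorem basisForm_eq_d :
    c.basisForm 1 = SLq.D P • c.d (SLq.A P) - P.q⁻¹ • SLq.B P • c.d (SLq.C P) ∧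
    c.basisForm 2 = SLq.A P • c.d (SLq.C P) - P.q • SLq.C P • c.d (SLq.A P) ∧
    c.basisForm 0 = SLq.D P • c.d (SLq.B P) - P.q⁻¹ • SLq.B P • c.d (SLq.D P) := by
  have hA : HopfAlgebra.antipode ℂ (SLq.A P) = SLq.D P := by
    change SLq.antipodeMap P _ = _; simp [SLq.antipodeMap]
  have hB : HopfAlgebra.antipode ℂ (SLq.B P) = -P.q⁻¹ • SLq.B P := by
    change SLq.antipodeMap P _ = _; simp [SLq.antipodeMap]
  have hC : HopfAlgebra.antipode ℂ (SLq.C P) = -P.q • SLq.C P := by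
    change SLq.antipodeMap P _ = _; simp [SLq.antipodeMap]
  have hD : HopfAlgebra.antipode ℂ (SLq.D P) = SLq.A P := by
    change SLq.antipodeMap P _ = _; simp [SLq.antipodeMap]
  refine ⟨?_, ?_, ?_⟩
  · simp [← omega_A, omega, hA, hB, sub_eq_add_neg]
  · simp [← omega_C, omega, hC, hD, sub_eq_neg_add]
  · simp [← omega_B, omega, hA, hB, sub_eq_add_neg]

theorem ofForm_omega_eq_sum (x : SLq P) : (c.ofForm ∘ₗ c.omega) x =
    ∑ j, tangentFunctional P j x • c.ofForm (c.basisForm j) := by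
  simp [c.omega_eq_sum hT]

/-- Each relation comes from an element of R: B² and C² give the squares of ω₀ and ω₂, while BC, AB
− B and AC − C give the three exchange rules. The element D + q²A − (1 + q²) then gives the square
of ω₁. The squares appear with the factors q + q⁻¹ or q²(1 + q²), nonzero because q⁴ ≠ 1. -/
theorem wedge_relations :
    (∀ j : Fin 3, c.ofForm (c.basisForm j) * c.ofForm (c.basisForm j) = 0) ∧
    c.ofForm (c.basisForm 2) * c.ofForm (c.basisForm 0) =
      -P.q ^ 2 • (c.ofForm (c.basisForm 0) * c.ofForm (c.basisForm 2)) ∧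
    c.ofForm (c.basisForm 1) * c.ofForm (c.basisForm 0) =
      -P.q ^ 4 • (c.ofForm (c.basisForm 0) * c.ofForm (c.basisForm 1)) ∧
    c.ofForm (c.basisForm 2) * c.ofForm (c.basisForm 1) =
      -P.q ^ 4 • (c.ofForm (c.basisForm 1) * c.ofForm (c.basisForm 2)) := by
  have hq := P.q_ne_zero
  have hq2 := P.one_add_sq_ne_zero
  have hr := P.r_ne_zero
  have hqq : P.q + P.q⁻¹ ≠ 0 := by
    intro h
    apply hq2
    field_simp at h
    linear_combination h
  have hω := c.ofForm_omega_eq_sum hT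
  have hR : ∀ x, Coalgebra.counit (R := ℂ) x = 0 → (∀ j, tangentFunctional P j x = 0) →
      sweedler (LinearMap.mul ℂ c.Forms) (c.ofForm ∘ₗ c.omega) (c.ofForm ∘ₗ c.omega) x = 0 :=
    fun x h h' ↦ c.sweedler_omega_omega x ((c.mem_idealR_iff hT x).2 ⟨h, h'⟩)
  generalize c.ofForm ∘ₗ c.omega = W at hω hR
  have hBB := hR (SLq.B P * SLq.B P) (by simp)
    (fun j ↦ by simp [tangentFunctional_mul', tangentFunctional_B])
  have hCC := hR (SLq.C P * SLq.C P) (by simp)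
    (fun j ↦ by simp [tangentFunctional_mul', tangentFunctional_C])
  have hBC := hR (SLq.B P * SLq.C P) (by simp)
    (fun j ↦ by simp [tangentFunctional_mul', tangentFunctional_B, tangentFunctional_C])
  have hAB := hR (SLq.A P * SLq.B P - SLq.B P) (by simp)
    (fun j ↦ by simp [tangentFunctional_mul', tangentFunctional_A, tangentFunctional_B])
  have hAC := hR (SLq.A P * SLq.C P - SLq.C P) (by simp)
    (fun j ↦ by simp [tangentFunctional_mul', tangentFunctional_A, tangentFunctional_C])
  have hAD := hR (SLq.D P + P.q ^ 2 • SLq.A P - (1 + P.q ^ 2) • 1) (by simp)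
    (fun j ↦ by
      fin_cases j <;> simp [tangentFunctional_one, tangentFunctional_A, tangentFunctional_D])
  simp only [sweedler_apply, map_sub, map_add, map_smul, Bialgebra.comul_mul, SLq.comul_A,
    SLq.comul_B, SLq.comul_C, SLq.comul_D, Bialgebra.comul_one, Algebra.TensorProduct.one_def,
    mul_add, add_mul, Algebra.TensorProduct.tmul_mul_tmul, TensorProduct.lift.tmul,
    LinearMap.compl₁₂_apply, hω, Fin.sum_univ_three, tangentFunctional_mul',
    tangentFunctional_A, tangentFunctional_B, tangentFunctional_C, tangentFunctional_D,
    tangentFunctional_one, SLq.counit_A, SLq.counit_B, SLq.counit_C, SLq.counit_D,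
    SLq.character_A, SLq.character_B, SLq.character_C, SLq.character_D, Matrix.cons_val,
    tangentWeight] at hBB hCC hBC hAB hAC hAD
  simp [P.r_sq, P.r_pow_four] at hBB hCC hBC hAB hAC hAD
  have hBC' : c.ofForm (c.basisForm 2) * c.ofForm (c.basisForm 0) =
      -P.q ^ 2 • (c.ofForm (c.basisForm 0) * c.ofForm (c.basisForm 2)) := by
    have h := congr(P.q • $hBC)
    rw [smul_add, smul_smul, mul_inv_cancel₀ hq, one_smul, smul_zero] at h
    linear_combination (norm := module) h
  refine ⟨?_, hBC', ?_, ?_⟩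
  · intro j
    fin_cases j
    · rw [← add_smul, add_comm] at hBB
      exact (smul_eq_zero.1 hBB).resolve_left hqq
    · have h : (P.q ^ 2 * (1 + P.q ^ 2)) •
          (c.ofForm (c.basisForm 1) * c.ofForm (c.basisForm 1)) = 0 := by
        linear_combination (norm := module) hAD - hBC'
      exact (smul_eq_zero.1 h).resolve_left (mul_ne_zero (pow_ne_zero 2 hq) hq2)
    · rw [← add_smul, add_comm] at hCC
      exact (smul_eq_zero.1 hCC).resolve_left hqq
  · have h := congr(P.q ^ 2 • $hAB)
    simp only [smul_sub, smul_add, add_smul, smul_smul, one_smul, smul_neg, smul_zero,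
      mul_inv_cancel₀ (pow_ne_zero 2 hq)] at h
    linear_combination (norm := module) h
  · have h := congr(P.q ^ 2 • $hAC)
    simp only [smul_sub, smul_add, add_smul, smul_smul, one_smul, smul_neg, smul_zero,
      mul_inv_cancel₀ (pow_ne_zero 2 hq)] at h
    linear_combination (norm := module) h

end LeftCovariantFODC

/-! ### Independence of the two-forms and the Maurer–Cartan equations -/

open Coalgebra in
theorem convMul_apply_eq_sum {H : Type*} [Ring H] [Bialgebra ℂ H]
    (Y Z : WithConv (H →ₗ[ℂ] ℂ)) (x : H) : (Y * Z) x =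
      ∑ i ∈ (ℛ ℂ x).index, Y ((ℛ ℂ x).left i) * Z ((ℛ ℂ x).right i) := by
  rw [LinearMap.convMul_apply, sweedler_mul'_eq, sweedler_eq_sum]
  rfl

/-- This turns the wedge relations into conditions on convolution products of functionals. -/
theorem sweedler_mul_eq_sum {H : Type*} [Ring H] [Bialgebra ℂ H] {R : Type*} [Ring R] [Algebra ℂ R]
    {ι : Type*} [Fintype ι] (Y : ι → WithConv (H →ₗ[ℂ] ℂ)) (w : ι → R) (W : H →ₗ[ℂ] R)
    (hW : ∀ a, W a = ∑ j, Y j a • w j) (x : H) :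
    sweedler (LinearMap.mul ℂ R) W W x = ∑ i, ∑ j, (Y i * Y j) x • (w i * w j) := by
  rw [sweedler_eq_sum]
  simp only [LinearMap.mul_apply', hW, Finset.sum_mul_sum, convMul_apply_eq_sum, Finset.sum_smul,
    smul_mul_smul_comm]
  rw [Finset.sum_comm]
  exact Finset.sum_congr rfl fun i _ ↦ Finset.sum_comm

section operators

variable (P : QuantumParameter)

/-- The operators by which the basis forms act on the free module with basis `1`, `ω₀`, `ω₁`, `ω₂`,
`ω₀ ∧ ω₁`, `ω₀ ∧ ω₂`, `ω₁ ∧ ω₂`. -/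
noncomputable def wedgeOperator (j : Fin 3) : Module.End ℂ (Fin 7 → SLq P) :=
  let t (k : Fin 7) : (Fin 7 → SLq P) →ₗ[ℂ] SLq P :=
    (SLq.twist P (tangentWeight j)).toLinearMap ∘ₗ LinearMap.proj k
  -- Row j is left multiplication by ω_j in the listed basis. Coefficients pass ω_j through the
  -- twist, products are reordered by the wedge relations, and degree three is set to zero.
  LinearMap.pi (![![0, t 0, 0, 0, t 2, t 3, 0],
    ![0, 0, t 0, 0, -P.q ^ 4 • t 1, 0, t 3],
    ![0, 0, 0, t 0, 0, -P.q ^ 2 • t 1, -P.q ^ 4 • t 2]] j)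

theorem wedgeOperator_zero (v : Fin 7 → SLq P) : wedgeOperator P 0 v =
    ![0, SLq.twist P 2 (v 0), 0, 0, SLq.twist P 2 (v 2), SLq.twist P 2 (v 3), 0] := by
  funext k
  fin_cases k <;> rfl

theorem wedgeOperator_one (v : Fin 7 → SLq P) : wedgeOperator P 1 v =
    ![0, 0, SLq.twist P 4 (v 0), 0, -P.q ^ 4 • SLq.twist P 4 (v 1), 0, SLq.twist P 4 (v 3)] := by
  funext k
  fin_cases k <;> rfl

theorem wedgeOperator_two (v : Fin 7 → SLq P) : wedgeOperator P 2 v =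
    ![0, 0, 0, SLq.twist P 2 (v 0), 0, -P.q ^ 2 • SLq.twist P 2 (v 1),
      -P.q ^ 4 • SLq.twist P 2 (v 2)] := by
  funext k
  fin_cases k <;> rfl

theorem wedgeOperator_smul (j : Fin 3) (x : SLq P) (v : Fin 7 → SLq P) :
    wedgeOperator P j (x • v) = SLq.twist P (tangentWeight j) x • wedgeOperator P j v := by
  funext k
  fin_cases j <;>
  simp only [Fin.zero_eta, Fin.mk_one, Fin.reduceFinMk, wedgeOperator_zero, wedgeOperator_one,
    wedgeOperator_two] <;>
  fin_cases k <;> simp [tangentWeight]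

/-- The left multiplication operators. -/
noncomputable abbrev scalarOperator : SLq P →ₐ[ℂ] Module.End ℂ (Fin 7 → SLq P) :=
  Algebra.lsmul ℂ ℂ (Fin 7 → SLq P)

theorem wedgeOperator_mul_scalarOperator (j : Fin 3) (x : SLq P) :
    wedgeOperator P j * scalarOperator P x =
      scalarOperator P (SLq.twist P (tangentWeight j) x) * wedgeOperator P j := by
  refine LinearMap.ext fun v ↦ ?_
  exact wedgeOperator_smul P j x v

/-- The operators obey the wedge relations, so the coefficient of ω₀∧ω₁ is m₀₁ − q⁴m₁₀, and
similarly for the other two; the hypotheses say that these vanish. The diagonal of `m` is free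
because squares vanish. -/
theorem sum_wedgeOperator_eq_zero (m : Fin 3 → Fin 3 → ℂ)
    (h₁ : P.q ^ 2 * m 1 0 - (P.q ^ 2)⁻¹ * m 0 1 = 0)
    (h₂ : P.q ^ 2 * m 2 1 - (P.q ^ 2)⁻¹ * m 1 2 = 0)
    (h₃ : P.q * m 2 0 - P.q⁻¹ * m 0 2 = 0) :
    ∑ i, ∑ j, m i j • (wedgeOperator P i * wedgeOperator P j) = 0 := by
  have hq := P.q_ne_zero
  have e₁ : m 0 1 = P.q ^ 4 * m 1 0 := by field_simp at h₁; linear_combination -h₁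
  have e₂ : m 1 2 = P.q ^ 4 * m 2 1 := by field_simp at h₂; linear_combination -h₂
  have e₃ : m 0 2 = P.q ^ 2 * m 2 0 := by field_simp at h₃; linear_combination -h₃
  refine LinearMap.ext fun v ↦ ?_
  funext k
  simp only [Fin.sum_univ_three, LinearMap.add_apply, LinearMap.smul_apply, Module.End.mul_apply,
    wedgeOperator_zero, wedgeOperator_one, wedgeOperator_two, e₁, e₂, e₃]
  fin_cases k <;> simp [SLq.twist_twist] <;> module

end operators

namespace LeftCovariantFODC

variable {P : QuantumParameter}
  {Γ : Type*} [AddCommGroup Γ] [Module ℂ Γ] [Module (SLq P) Γ] [Module (SLq P)ᵐᵒᵖ Γ]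
  [IsScalarTower ℂ (SLq P) Γ] [IsScalarTower ℂ (SLq P)ᵐᵒᵖ Γ]
  [SMulCommClass (SLq P) (SLq P)ᵐᵒᵖ Γ] (c : LeftCovariantFODC (SLq P) Γ)
  (hT : c.tangentSpace = Submodule.span ℂ (Set.range (tangentFunctional P)))
include hT

theorem exists_formOperator : ∃ F : Γ →ₗ[ℂ] Module.End ℂ (Fin 7 → SLq P),
    ∀ x a, F (x • c.omega a) =
      scalarOperator P x * ∑ j, tangentFunctional P j a • wedgeOperator P j := by
  obtain ⟨F, hF⟩ := c.exists_linearMap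
    ((LinearMap.mul ℂ (Module.End ℂ (Fin 7 → SLq P))).compl₁₂ (scalarOperator P).toLinearMap
      (∑ j, (tangentFunctional P j).smulRight (wedgeOperator P j)))
    (fun a ha x ↦ by simp [c.omega_eq_zero hT ha])
  exact ⟨F, fun x a ↦ by simp [hF, Finset.mul_sum]⟩

/-- For x in R all X_j(x) are zero, so the commutation relations evaluated at x become the
homogeneous conditions of `sum_wedgeOperator_eq_zero` on the numbers (X_iX_j)(x). -/
theorem exists_formsRepresentation :
    ∃ φ : c.Forms →ₐ[ℂ] Module.End ℂ (Fin 7 → SLq P),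
      ∀ j, φ (c.ofForm (c.basisForm j)) = wedgeOperator P j := by
  obtain ⟨F, hF⟩ := c.exists_formOperator hT
  have hF1 : ∀ a, F (c.omega a) = ∑ j, tangentFunctional P j a • wedgeOperator P j := by
    intro a
    have h := hF 1 a
    rwa [one_smul, map_one, one_mul] at h
  have hl : ∀ x ρ, F (x • ρ) = scalarOperator P x * F ρ := by
    intro x ρ
    induction ρ using c.smul_omega_induction with
    | h y a => rw [← mul_smul, hF, hF, map_mul, mul_assoc]
    | zero => simp
    | add ρ τ h₁ h₂ => rw [smul_add, map_add, h₁, h₂, map_add, mul_add]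
  have hb : ∀ j, F (c.basisForm j) = wedgeOperator P j := by
    intro j
    fin_cases j
    · simp [← omega_B, hF1, tangentFunctional_B, Fin.sum_univ_three]
    · simp [← omega_A, hF1, tangentFunctional_A, Fin.sum_univ_three]
    · simp [← omega_C, hF1, tangentFunctional_C, Fin.sum_univ_three]
  have hr : ∀ y ρ, F (MulOpposite.op y • ρ) = F ρ * scalarOperator P y := by
    intro y ρ
    induction ρ using c.smul_omega_induction with
    | h x a =>
      rw [← smul_comm, hl, hl, mul_assoc]
      congr 1
      rw [c.omega_eq_sum hT, Finset.smul_sum, map_sum, map_sum, Finset.sum_mul]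
      refine Finset.sum_congr rfl fun j _ ↦ ?_
      rw [smul_comm, F.map_smul, F.map_smul, c.op_smul_basisForm hT, hl, hb, smul_mul_assoc,
        wedgeOperator_mul_scalarOperator]
    | zero => simp
    | add ρ τ h₁ h₂ => rw [smul_add, map_add, h₁, h₂, map_add, add_mul]
  have hw : ∀ x ∈ c.idealR, sweedler (LinearMap.mul ℂ _) (F ∘ₗ c.omega) (F ∘ₗ c.omega) x = 0 := by
    intro x hx
    have hx' := ((c.mem_idealR_iff hT x).1 hx).2
    rw [sweedler_mul_eq_sum (fun j ↦ WithConv.toConv (tangentFunctional P j)) _ _ hF1]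
    obtain ⟨h₁, h₂, h₃⟩ := tangentFunctional_commutation P
    have h₁ := congr(WithConv.ofConv $h₁ x)
    have h₂ := congr(WithConv.ofConv $h₂ x)
    have h₃ := congr(WithConv.ofConv $h₃ x)
    simp only [WithConv.ofConv_sub, WithConv.ofConv_smul, LinearMap.sub_apply,
      LinearMap.smul_apply, smul_eq_mul, hx', mul_zero] at h₁ h₂ h₃
    exact sum_wedgeOperator_eq_zero P _ h₁ h₂ h₃
  exact ⟨c.formsLift (scalarOperator P) F hl hr hw, fun j ↦ by rw [formsLift_ofForm, hb]⟩

theorem twoForms_independent {a b e : ℂ}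
    (h : a • (c.ofForm (c.basisForm 0) * c.ofForm (c.basisForm 1)) +
      b • (c.ofForm (c.basisForm 0) * c.ofForm (c.basisForm 2)) +
      e • (c.ofForm (c.basisForm 1) * c.ofForm (c.basisForm 2)) = 0) : a = 0 ∧ b = 0 ∧ e = 0 := by
  obtain ⟨φ, hφ⟩ := c.exists_formsRepresentation hT
  -- Acting on the basis vector 1 puts the three coefficients into the slots 4, 5, 6 of the
  -- two-forms; ε then extracts the scalars.
  have h1 := congr(φ $h (fun i ↦ if i = 0 then 1 else 0))
  simp only [map_add, map_smul, map_mul, hφ, map_zero, LinearMap.add_apply, LinearMap.smul_apply,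
    Module.End.mul_apply, wedgeOperator_zero, wedgeOperator_one, wedgeOperator_two] at h1
  have h4 := congr(Coalgebra.counit (R := ℂ) ($h1 4))
  have h5 := congr(Coalgebra.counit (R := ℂ) ($h1 5))
  have h6 := congr(Coalgebra.counit (R := ℂ) ($h1 6))
  simp at h4 h5 h6
  exact ⟨h4, h5, h6⟩

theorem extDeriv_basisForm :
    c.extDeriv (c.ofForm (c.basisForm 0)) =
      (P.q ^ 2 + P.q ^ 4) • (c.ofForm (c.basisForm 0) * c.ofForm (c.basisForm 1)) ∧
    c.extDeriv (c.ofForm (c.basisForm 1)) =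
      -(c.ofForm (c.basisForm 0) * c.ofForm (c.basisForm 2)) ∧
    c.extDeriv (c.ofForm (c.basisForm 2)) =
      (P.q ^ 2 + P.q ^ 4) • (c.ofForm (c.basisForm 1) * c.ofForm (c.basisForm 2)) := by
  obtain ⟨h0, h20, h10, h21⟩ := c.wedge_relations hT
  refine ⟨?_, ?_, ?_⟩
  · rw [extDeriv_ofForm, ← omega_B, dOne_omega]
    simp [sweedler_apply, omega_A, omega_B, c.omega_D hT, h10]
    module
  · rw [extDeriv_ofForm, ← omega_A, dOne_omega]
    simp [sweedler_apply, omega_A, omega_B, omega_C, h0]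
  · rw [extDeriv_ofForm, ← omega_C, dOne_omega]
    simp [sweedler_apply, omega_A, omega_C, c.omega_D hT, h21]
    module

/-- In the two-forms ω₀∧ω₁, ω₀∧ω₂, ω₁∧ω₂ the equation at x splits into three scalar equations, which
are the commutation relations at x up to powers of q. Independence is needed only to derive them
from the equation of forms. -/
theorem maurerCartan_iff (Y : Fin 3 → WithConv (SLq P →ₗ[ℂ] ℂ)) :
    QCommutationRelations P.q Y ↔ ∀ x : SLq P,
      ∑ i, (Y i) x • c.extDeriv (c.ofForm (c.basisForm i)) =
        -∑ i, ∑ j, (Y i * Y j) x • (c.ofForm (c.basisForm i) * c.ofForm (c.basisForm j)) := by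
  have hq := P.q_ne_zero
  obtain ⟨h0, h20, h10, h21⟩ := c.wedge_relations hT
  obtain ⟨d0, d1, d2⟩ := c.extDeriv_basisForm hT
  have key : ∀ x, (∑ i, (Y i) x • c.extDeriv (c.ofForm (c.basisForm i)) =
        -∑ i, ∑ j, (Y i * Y j) x • (c.ofForm (c.basisForm i) * c.ofForm (c.basisForm j))) ↔
      (P.q ^ 2 + P.q ^ 4) * Y 0 x + (Y 0 * Y 1) x - P.q ^ 4 * (Y 1 * Y 0) x = 0 ∧
      -Y 1 x + (Y 0 * Y 2) x - P.q ^ 2 * (Y 2 * Y 0) x = 0 ∧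
      (P.q ^ 2 + P.q ^ 4) * Y 2 x + (Y 1 * Y 2) x - P.q ^ 4 * (Y 2 * Y 1) x = 0 := by
    intro x
    simp only [Fin.sum_univ_three, d0, d1, d2, h0, h20, h10, h21]
    constructor
    · intro h
      apply c.twoForms_independent hT
      linear_combination (norm := module) h
    · rintro ⟨e1, e2, e3⟩
      linear_combination (norm := module)
        e1 • (c.ofForm (c.basisForm 0) * c.ofForm (c.basisForm 1)) +
        e2 • (c.ofForm (c.basisForm 0) * c.ofForm (c.basisForm 2)) +
        e3 • (c.ofForm (c.basisForm 1) * c.ofForm (c.basisForm 2))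
  simp only [key, forall_and]
  -- The two-forms are ordered 01, 02, 12, the commutation relations 01, 12, 02.
  refine Iff.trans ?_ (and_congr_right fun _ ↦ and_comm)
  unfold QCommutationRelations
  refine and_congr ?_ (and_congr ?_ ?_)
  · rw [WithConv.ext_iff, LinearMap.ext_iff]
    refine forall_congr' fun x ↦ ?_
    simp only [WithConv.ofConv_sub, WithConv.ofConv_smul, LinearMap.sub_apply,
      LinearMap.smul_apply, smul_eq_mul]
    constructor
    · intro h
      field_simp at h
      linear_combination -h
    · intro h
      field_simp
      linear_combination -h
  · rw [WithConv.ext_iff, LinearMap.ext_iff]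
    refine forall_congr' fun x ↦ ?_
    simp only [WithConv.ofConv_sub, WithConv.ofConv_smul, LinearMap.sub_apply,
      LinearMap.smul_apply, smul_eq_mul]
    constructor
    · intro h
      field_simp at h
      linear_combination -h
    · intro h
      field_simp
      linear_combination -h
  · rw [WithConv.ext_iff, LinearMap.ext_iff]
    refine forall_congr' fun x ↦ ?_
    simp only [WithConv.ofConv_sub, WithConv.ofConv_smul, LinearMap.sub_apply,
      LinearMap.smul_apply, smul_eq_mul]
    constructor
    · intro h
      field_simp at h
      linear_combination -h
    · intro h
      field_simp
      linear_combination -h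

end LeftCovariantFODC

/-! ### Construction of the calculus -/

section convolutionOperator

variable {H : Type*} [Ring H] [Bialgebra ℂ H]

/-- The operator `x ↦ ∑ X(x₂) x₁` on `H` given by a functional `X`. -/
noncomputable def leftInvariantOperator (X : H →ₗ[ℂ] ℂ) : H →ₗ[ℂ] H :=
  sweedler (LinearMap.lsmul ℂ H).flip LinearMap.id X

open Coalgebra in
theorem leftInvariantOperator_eq_sum (X : H →ₗ[ℂ] ℂ) (x : H) : leftInvariantOperator X x =
    ∑ i ∈ (ℛ ℂ x).index, X ((ℛ ℂ x).right i) • (ℛ ℂ x).left i := by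
  rw [leftInvariantOperator, sweedler_eq_sum]
  rfl

open Coalgebra in
theorem leftInvariantOperator_mul (X f : H →ₗ[ℂ] ℂ)
    (h : ∀ x y, X (x * y) = counit (R := ℂ) x * X y + X x * f y) (x y : H) :
    leftInvariantOperator X (x * y) =
      x * leftInvariantOperator X y + leftInvariantOperator X x * leftInvariantOperator f y := by
  -- The first x on the right-hand side is written as ∑ ε(x₂) x₁, so that both sides are sums over
  -- the same legs.
  have hx : x = ∑ i ∈ (ℛ ℂ x).index, counit (R := ℂ) ((ℛ ℂ x).right i) • (ℛ ℂ x).left i :=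
    (Coalgebra.sum_counit_smul (ℛ ℂ x)).symm.trans (by
      rw [Coalgebra.sum_counit_smul]
      have := sweedler_counit_right (LinearMap.lsmul ℂ H).flip LinearMap.id
        (counit (R := ℂ) (A := H)) 1 (by simp) x
      rw [sweedler_eq_sum] at this
      simpa using this.symm)
  nth_rw 2 [hx]
  rw [leftInvariantOperator, sweedler_mul]
  simp only [sweedler_eq_sum, leftInvariantOperator_eq_sum]
  simp only [LinearMap.flip_apply, LinearMap.lsmul_apply, LinearMap.comp_apply,
    LinearMap.mulRight_apply, LinearMap.id_apply, h, add_smul, Finset.sum_add_distrib,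
    Finset.sum_mul_sum, smul_mul_smul_comm]
  rw [Finset.sum_comm]
  congr 1
  rw [Finset.sum_comm]

/-- By coassociativity the operator touches only the last leg; this is the source of left covariance
of `ThreeDForms.d`. -/
theorem comul_leftInvariantOperator (X : H →ₗ[ℂ] ℂ) (x : H) :
    Coalgebra.comul (R := ℂ) (leftInvariantOperator X x) =
      (leftInvariantOperator X).lTensor H (Coalgebra.comul x) := by
  have e : Coalgebra.comul (R := ℂ) (A := H) =
      sweedler (TensorProduct.mk ℂ H H) LinearMap.id LinearMap.id := by
    ext y
    rw [sweedler_eq_sum]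
    exact (Coalgebra.Repr.arbitrary ℂ y).eq.symm
  have h := LinearMap.congr_fun (sweedler_assoc (LinearMap.lsmul ℂ (H ⊗[ℂ] H)).flip
    (TensorProduct.mk ℂ H H) (TensorProduct.mk ℂ H H) (LinearMap.lsmul ℂ H).flip
    (fun a b r ↦ by simp) LinearMap.id LinearMap.id X) x
  rw [← e] at h
  rw [leftInvariantOperator, map_sweedler Coalgebra.comul _ _ _
    (LinearMap.lsmul ℂ (H ⊗[ℂ] H)).flip Coalgebra.comul X (fun a b ↦ by simp), h,
    sweedler_eq_sum]
  conv_rhs => rw [← (Coalgebra.Repr.arbitrary ℂ x).eq]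
  simp

end convolutionOperator

/-- This is ∑ S(x₁) x₂ X(x₃), which computes the coordinates of ω(x) in the model. -/
theorem sweedler_antipode_leftInvariantOperator {H : Type*} [Ring H] [HopfAlgebra ℂ H]
    (X : H →ₗ[ℂ] ℂ) (x : H) : sweedler (LinearMap.mul ℂ H) (HopfAlgebra.antipode ℂ)
      (leftInvariantOperator X) x = X x • (1 : H) := by
  rw [leftInvariantOperator, ← sweedler_assoc (LinearMap.lsmul ℂ H).flip (LinearMap.mul ℂ H)
    (LinearMap.mul ℂ H) (LinearMap.lsmul ℂ H).flip (fun a b r ↦ by simp),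
    sweedler_counit_left _ _ _ 1 sweedler_antipode_id]
  simp

/-- The bimodule of one-forms of the 3-D calculus: a free left module of rank three. -/
def ThreeDForms (P : QuantumParameter) : Type := Fin 3 → SLq P

namespace ThreeDForms

variable (P : QuantumParameter)

noncomputable instance : AddCommGroup (ThreeDForms P) := inferInstanceAs (AddCommGroup (Fin 3 → SLq P))
noncomputable instance : Module ℂ (ThreeDForms P) := inferInstanceAs (Module ℂ (Fin 3 → SLq P))
noncomputable instance : Module (SLq P) (ThreeDForms P) :=
  inferInstanceAs (Module (SLq P) (Fin 3 → SLq P))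

variable {P}

@[ext] theorem ext {v w : ThreeDForms P} (h : ∀ j, v j = w j) : v = w := funext h

theorem add_apply (v w : ThreeDForms P) (j : Fin 3) : (v + w) j = v j + w j := rfl
theorem zero_apply (j : Fin 3) : (0 : ThreeDForms P) j = 0 := rfl
theorem sub_apply (v w : ThreeDForms P) (j : Fin 3) : (v - w) j = v j - w j := rfl
theorem smul_apply (a : ℂ) (v : ThreeDForms P) (j : Fin 3) : (a • v) j = a • v j := rfl
theorem left_smul_apply (x : SLq P) (v : ThreeDForms P) (j : Fin 3) : (x • v) j = x * v j := rfl

/-- This right action is forced by `op_smul_basisForm`. -/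
noncomputable instance : SMul (SLq P)ᵐᵒᵖ (ThreeDForms P) where
  smul y v := fun j ↦ v j * SLq.twist P (tangentWeight j) y.unop

theorem right_smul_apply (y : (SLq P)ᵐᵒᵖ) (v : ThreeDForms P) (j : Fin 3) :
    (y • v) j = v j * SLq.twist P (tangentWeight j) y.unop := rfl

noncomputable instance : Module (SLq P)ᵐᵒᵖ (ThreeDForms P) where
  one_smul v := by ext j; simp [right_smul_apply]
  mul_smul x y v := by ext j; simp [right_smul_apply, mul_assoc]
  smul_zero x := by ext j; simp [right_smul_apply, zero_apply]
  smul_add x v w := by ext j; simp [right_smul_apply, add_apply, add_mul]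
  add_smul x y v := by ext j; simp [right_smul_apply, add_apply, mul_add]
  zero_smul v := by ext j; simp [right_smul_apply, zero_apply]

instance : IsScalarTower ℂ (SLq P) (ThreeDForms P) :=
  ⟨fun a x v ↦ by ext j; simp [left_smul_apply, smul_apply]⟩

instance : IsScalarTower ℂ (SLq P)ᵐᵒᵖ (ThreeDForms P) :=
  ⟨fun a x v ↦ by ext j; simp [right_smul_apply, smul_apply]⟩

instance : SMulCommClass (SLq P) (SLq P)ᵐᵒᵖ (ThreeDForms P) :=
  ⟨fun x y v ↦ by ext j; simp [right_smul_apply, left_smul_apply, mul_assoc]⟩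

variable (P) in
/-- The differential of the 3-D calculus. -/
noncomputable def d : SLq P →ₗ[ℂ] ThreeDForms P where
  toFun x := fun j ↦ leftInvariantOperator (tangentFunctional P j) x
  map_add' x y := funext fun j ↦ map_add (leftInvariantOperator (tangentFunctional P j)) x y
  map_smul' a x := funext fun j ↦ map_smul (leftInvariantOperator (tangentFunctional P j)) a x

theorem d_apply (x : SLq P) (j : Fin 3) :
    d P x j = leftInvariantOperator (tangentFunctional P j) x := rfl

theorem twist_eq (n : ℕ) (x : SLq P) :
    SLq.twist P n x = leftInvariantOperator (SLq.character P n).toLinearMap x := by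
  rw [SLq.twist_eq_sum, leftInvariantOperator_eq_sum]
  rfl

/-- The character in the product rule for X_j is the one that defines the twist, so the twisted
product rule of each coordinate is the Leibniz rule of the bimodule. -/
theorem d_mul (x y : SLq P) : d P (x * y) = x • d P y + MulOpposite.op y • d P x := by
  ext j
  rw [d_apply, leftInvariantOperator_mul _ (SLq.character P (tangentWeight j)).toLinearMap
    (tangentFunctional_mul' P j), add_apply, left_smul_apply, right_smul_apply, d_apply, d_apply,
    twist_eq, MulOpposite.unop_op]

variable (P) in
/-- The left-linear inclusion `x ↦ x ω_j`. -/
noncomputable def single (j : Fin 3) : SLq P →ₗ[ℂ] ThreeDForms P :=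
  LinearMap.single ℂ (fun _ ↦ SLq P) j

theorem single_apply (j i : Fin 3) (x : SLq P) : single P j x i = if i = j then x else 0 :=
  Pi.single_apply j x i

theorem single_mul (j : Fin 3) (x y : SLq P) : single P j (x * y) = x • single P j y := by
  ext i
  rw [left_smul_apply, single_apply, single_apply]
  split <;> simp

theorem sum_single (v : ThreeDForms P) : ∑ j, single P j (v j) = v := by
  rw [Fin.sum_univ_three]
  ext i
  rw [add_apply, add_apply, single_apply, single_apply, single_apply]
  fin_cases i <;> simp

variable (P) in
/-- The left coaction of the 3-D calculus. -/
noncomputable def coact : ThreeDForms P →ₗ[ℂ] SLq P ⊗[ℂ] ThreeDForms P :=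
  ∑ j, (single P j).lTensor (SLq P) ∘ₗ Coalgebra.comul ∘ₗ LinearMap.proj (φ := fun _ ↦ SLq P) j

theorem coact_apply (v : ThreeDForms P) :
    coact P v = ∑ j, (single P j).lTensor (SLq P) (Coalgebra.comul (v j)) := by
  simp only [coact, LinearMap.sum_apply]
  rfl

theorem lTensor_single_mul (j : Fin 3) (s t : SLq P ⊗[ℂ] SLq P) :
    (single P j).lTensor (SLq P) (s * t) =
      LeftCovariantFODC.tensorAction (SLq P) (ThreeDForms P) s
        ((single P j).lTensor (SLq P) t) := by
  induction s with
  | zero => simp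
  | add a b ha hb => simp only [add_mul, map_add, LinearMap.add_apply, ha, hb]
  | tmul a b =>
    induction t with
    | zero => simp
    | add u v hu hv => simp only [mul_add, map_add, hu, hv]
    | tmul u v => simp [single_mul]

theorem coact_smul_d (x y : SLq P) : coact P (x • d P y) =
    LeftCovariantFODC.tensorAction (SLq P) (ThreeDForms P) (Coalgebra.comul x)
      (TensorProduct.map LinearMap.id (d P) (Coalgebra.comul y)) := by
  have h : ∀ t : SLq P ⊗[ℂ] SLq P, TensorProduct.map LinearMap.id (d P) t =
      ∑ j, (single P j).lTensor (SLq P)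
        ((leftInvariantOperator (tangentFunctional P j)).lTensor (SLq P) t) := by
    intro t
    induction t with
    | zero => simp
    | add a b ha hb => simp only [map_add, ha, hb, Finset.sum_add_distrib]
    | tmul a b =>
      simp only [TensorProduct.map_tmul, LinearMap.lTensor_tmul, LinearMap.id_apply,
        ← TensorProduct.tmul_sum]
      congr 1
      exact (sum_single (d P b)).symm
  rw [coact_apply, h, map_sum]
  refine Finset.sum_congr rfl fun j _ ↦ ?_
  rw [left_smul_apply, Bialgebra.comul_mul, lTensor_single_mul, d_apply,
    comul_leftInvariantOperator]

theorem span_eq_top : Submodule.span ℂ {ρ : ThreeDForms P | ∃ x y z : SLq P,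
    ρ = x • MulOpposite.op z • d P y} = ⊤ := by
  have hm : ∀ x y : SLq P, x • d P y ∈ Submodule.span ℂ {ρ : ThreeDForms P | ∃ x y z : SLq P,
      ρ = x • MulOpposite.op z • d P y} :=
    fun x y ↦ Submodule.subset_span ⟨x, y, 1, by simp⟩
  have hd : ∀ x j, d P x j = TensorProduct.lift ((LinearMap.lsmul ℂ (SLq P)).flip.compl₁₂
      LinearMap.id (tangentFunctional P j)) (Coalgebra.comul x) := fun _ _ ↦ rfl
  -- The next three formulas are x times ω(B), ω(A), ω(C), with ω(a) = ∑ S(a₁) da₂ written out.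
  have h0 : ∀ x, single P 0 x =
      (x * SLq.D P) • d P (SLq.B P) - P.q⁻¹ • (x * SLq.B P) • d P (SLq.D P) := by
    intro x
    ext i
    rw [single_apply, sub_apply, smul_apply, left_smul_apply, left_smul_apply, hd, hd]
    fin_cases i <;> simp [tangentFunctional_B, tangentFunctional_D, mul_assoc, SLq.rel_da,
      SLq.rel_db, mul_add, smul_smul, mul_comm]
  have h1 : ∀ x, single P 1 x =
      (x * SLq.D P) • d P (SLq.A P) - P.q⁻¹ • (x * SLq.B P) • d P (SLq.C P) := by
    intro x
    ext i
    rw [single_apply, sub_apply, smul_apply, left_smul_apply, left_smul_apply, hd, hd]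
    fin_cases i <;> simp [tangentFunctional_A, tangentFunctional_C, mul_assoc, SLq.rel_da,
      SLq.rel_db, mul_add]
  have h2 : ∀ x, single P 2 x =
      (x * SLq.A P) • d P (SLq.C P) - P.q • (x * SLq.C P) • d P (SLq.A P) := by
    intro x
    ext i
    rw [single_apply, sub_apply, smul_apply, left_smul_apply, left_smul_apply, hd, hd]
    fin_cases i <;> simp [tangentFunctional_A, tangentFunctional_C, mul_assoc, SLq.rel_ad,
      SLq.rel_ca, SLq.rel_cb, mul_add]
  rw [eq_top_iff]
  rintro v -
  rw [← sum_single v, Fin.sum_univ_three, h0, h1, h2]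
  exact add_mem (add_mem (sub_mem (hm _ _) (Submodule.smul_mem _ _ (hm _ _)))
    (sub_mem (hm _ _) (Submodule.smul_mem _ _ (hm _ _))))
    (sub_mem (hm _ _) (Submodule.smul_mem _ _ (hm _ _)))

variable (P) in
/-- The 3-D calculus. -/
noncomputable def calculus : LeftCovariantFODC (SLq P) (ThreeDForms P) where
  d := d P
  leibniz := d_mul
  span_eq_top := span_eq_top
  coact := coact P
  coact_smul_d := coact_smul_d

theorem calculus_omega_apply (x : SLq P) (j : Fin 3) :
    (calculus P).omega x j = tangentFunctional P j x • (1 : SLq P) := by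
  rw [← sweedler_antipode_leftInvariantOperator, LeftCovariantFODC.omega_eq]
  exact map_sweedler (LinearMap.proj (φ := fun _ ↦ SLq P) j :
    ThreeDForms P →ₗ[ℂ] SLq P) _ _ _ (LinearMap.mul ℂ (SLq P)) _ _ (fun a b ↦ rfl) x

theorem calculus_tangentSpace : (calculus P).tangentSpace =
    Submodule.span ℂ (Set.range (tangentFunctional P)) := by
  apply le_antisymm
  · intro X hX
    -- The coefficients come from duality: X vanishes at 1 and on R, so it is determined by its
    -- values on B, A, C.
    have h : X = X (SLq.B P) • tangentFunctional P 0 + X (SLq.A P) • tangentFunctional P 1 +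
        X (SLq.C P) • tangentFunctional P 2 := by
      ext x
      have hx : x - (Coalgebra.counit (R := ℂ) x - tangentFunctional P 1 x) • 1 -
          tangentFunctional P 0 x • SLq.B P - tangentFunctional P 1 x • SLq.A P -
          tangentFunctional P 2 x • SLq.C P ∈ (calculus P).idealR := by
        refine ⟨by simp, ?_⟩
        change (calculus P).omega _ = 0
        ext j
        rw [calculus_omega_apply, zero_apply]
        fin_cases j <;> simp [tangentFunctional_A, tangentFunctional_B, tangentFunctional_C,
          tangentFunctional_one]
      have h' := hX.2 _ hx
      simp only [map_sub, map_smul, hX.1, smul_eq_mul, mul_zero, sub_zero] at h'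
      simp only [LinearMap.add_apply, LinearMap.smul_apply, smul_eq_mul]
      linear_combination h'
    rw [h]
    exact add_mem (add_mem (Submodule.smul_mem _ _ (Submodule.subset_span ⟨0, rfl⟩))
      (Submodule.smul_mem _ _ (Submodule.subset_span ⟨1, rfl⟩)))
      (Submodule.smul_mem _ _ (Submodule.subset_span ⟨2, rfl⟩))
  · rw [Submodule.span_le]
    rintro _ ⟨j, rfl⟩
    refine ⟨tangentFunctional_one P j, fun x hx ↦ ?_⟩
    have h0 : (calculus P).omega x = 0 := hx.2
    have h := calculus_omega_apply x j
    rw [h0] at h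
    simpa [zero_apply] using congr(Coalgebra.counit (R := ℂ) $h).symm

end ThreeDForms

/-! ### The main theorem -/

theorem proposition8p2 (P : QuantumParameter) :
    -- the relations of the algebra
    (SLq.A P * SLq.B P = P.q • (SLq.B P * SLq.A P) ∧
      SLq.A P * SLq.C P = P.q • (SLq.C P * SLq.A P) ∧
      SLq.B P * SLq.D P = P.q • (SLq.D P * SLq.B P) ∧
      SLq.C P * SLq.D P = P.q • (SLq.D P * SLq.C P) ∧
      SLq.B P * SLq.C P = SLq.C P * SLq.B P ∧
      SLq.A P * SLq.D P - SLq.D P * SLq.A P = (P.q - P.q⁻¹) • (SLq.B P * SLq.C P) ∧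
      SLq.A P * SLq.D P - P.q • (SLq.B P * SLq.C P) = 1) ∧
    -- the dual pairing and its values on the generators
    (IsDualPairing (dualPairing P) ∧
      (dualPairing P (Uq.K P) (SLq.A P) = P.r⁻¹ ∧ dualPairing P (Uq.K P) (SLq.B P) = 0 ∧
        dualPairing P (Uq.K P) (SLq.C P) = 0 ∧ dualPairing P (Uq.K P) (SLq.D P) = P.r) ∧
      (dualPairing P (Uq.E P) (SLq.A P) = 0 ∧ dualPairing P (Uq.E P) (SLq.B P) = 0 ∧
        dualPairing P (Uq.E P) (SLq.C P) = 1 ∧ dualPairing P (Uq.E P) (SLq.D P) = 0) ∧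
      (dualPairing P (Uq.F P) (SLq.A P) = 0 ∧ dualPairing P (Uq.F P) (SLq.B P) = 1 ∧
        dualPairing P (Uq.F P) (SLq.C P) = 0 ∧ dualPairing P (Uq.F P) (SLq.D P) = 0)) ∧
    -- the generators of the tangent space
    (tangentVector P 0 = P.r⁻¹ • (Uq.F P * Uq.K P) ∧
      tangentVector P 2 = P.r • (Uq.E P * Uq.K P) ∧
      tangentVector P 1 = (1 - (P.q ^ 2)⁻¹)⁻¹ • (1 - Uq.K P ^ 4)) ∧
    -- the Hopf algebra structure
    (Uq.K P * Uq.Kinv P = 1 ∧ Uq.Kinv P * Uq.K P = 1 ∧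
      Coalgebra.comul (R := ℂ) (Uq.K P) = Uq.K P ⊗ₜ Uq.K P ∧
      Coalgebra.comul (R := ℂ) (Uq.E P) = Uq.E P ⊗ₜ Uq.K P + Uq.Kinv P ⊗ₜ Uq.E P ∧
      Coalgebra.comul (R := ℂ) (Uq.F P) = Uq.F P ⊗ₜ Uq.K P + Uq.Kinv P ⊗ₜ Uq.F P ∧
      HopfAlgebra.antipode ℂ (Uq.K P) = Uq.Kinv P ∧
      HopfAlgebra.antipode ℂ (Uq.E P) = -P.q • Uq.E P ∧
      HopfAlgebra.antipode ℂ (Uq.F P) = -P.q⁻¹ • Uq.F P ∧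
      Coalgebra.counit (R := ℂ) (Uq.K P) = 1 ∧
      Coalgebra.counit (R := ℂ) (Uq.E P) = 0 ∧
      Coalgebra.counit (R := ℂ) (Uq.F P) = 0) ∧
    -- the coproducts of the `X_j`, as elements and as functionals
    ((∀ j : Fin 3, Coalgebra.comul (R := ℂ) (tangentVector P j) =
        1 ⊗ₜ tangentVector P j + tangentVector P j ⊗ₜ (Uq.K P ^ (if j = 1 then 4 else 2))) ∧
      ∀ (j : Fin 3) (x y : SLq P), tangentFunctional P j (x * y) =
        Coalgebra.counit x * tangentFunctional P j y +
          tangentFunctional P j x * dualPairing P (Uq.K P ^ (if j = 1 then 4 else 2)) y) ∧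
    -- the commutation relations of the `X_j`, as elements and as functionals
    (QCommutationRelations P.q (tangentVector P) ∧
      QCommutationRelations P.q (R := WithConv (SLq P →ₗ[ℂ] ℂ))
        (fun j ↦ WithConv.toConv (tangentFunctional P j))) ∧
    -- the calculus exists
    (∃ (Γ : Type) (_ : AddCommGroup Γ) (_ : Module ℂ Γ) (_ : Module (SLq P) Γ)
      (_ : Module (SLq P)ᵐᵒᵖ Γ) (_ : IsScalarTower ℂ (SLq P) Γ)
      (_ : IsScalarTower ℂ (SLq P)ᵐᵒᵖ Γ) (_ : SMulCommClass (SLq P) (SLq P)ᵐᵒᵖ Γ)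
      (c : LeftCovariantFODC (SLq P) Γ),
      c.tangentSpace = Submodule.span ℂ (Set.range (tangentFunctional P))) ∧
    -- every left-covariant calculus with this tangent space has the stated properties
    ∀ (Γ : Type*) [AddCommGroup Γ] [Module ℂ Γ] [Module (SLq P) Γ] [Module (SLq P)ᵐᵒᵖ Γ]
      [IsScalarTower ℂ (SLq P) Γ] [IsScalarTower ℂ (SLq P)ᵐᵒᵖ Γ]
      [SMulCommClass (SLq P) (SLq P)ᵐᵒᵖ Γ] (c : LeftCovariantFODC (SLq P) Γ),
      c.tangentSpace = Submodule.span ℂ (Set.range (tangentFunctional P)) →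
      ∃ ω : Fin 3 → Γ,
        -- the dual basis of left-invariant forms exists and is unique
        (c.IsDualBasis (tangentFunctional P) ω ∧
          ∀ ω' : Fin 3 → Γ, c.IsDualBasis (tangentFunctional P) ω' → ω' = ω) ∧
        -- the basis forms and the differentials of the generators
        (ω 0 = c.omega (SLq.B P) ∧ ω 2 = c.omega (SLq.C P) ∧ ω 1 = c.omega (SLq.A P) ∧
          ω 1 = -(P.q ^ 2)⁻¹ • c.omega (SLq.D P) ∧
          c.d (SLq.A P) = SLq.B P • ω 2 + SLq.A P • ω 1 ∧
          c.d (SLq.B P) = SLq.A P • ω 0 - P.q ^ 2 • SLq.B P • ω 1 ∧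
          c.d (SLq.C P) = SLq.C P • ω 1 + SLq.D P • ω 2 ∧
          c.d (SLq.D P) = -P.q ^ 2 • SLq.D P • ω 1 + SLq.C P • ω 0) ∧
        -- the commutation rules between the basis forms and the generators
        ((∀ j : Fin 3, j = 0 ∨ j = 2 →
            MulOpposite.op (SLq.A P) • ω j = P.q⁻¹ • SLq.A P • ω j ∧
            MulOpposite.op (SLq.B P) • ω j = P.q • SLq.B P • ω j ∧
            MulOpposite.op (SLq.C P) • ω j = P.q⁻¹ • SLq.C P • ω j ∧
            MulOpposite.op (SLq.D P) • ω j = P.q • SLq.D P • ω j) ∧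
          MulOpposite.op (SLq.A P) • ω 1 = (P.q ^ 2)⁻¹ • SLq.A P • ω 1 ∧
          MulOpposite.op (SLq.B P) • ω 1 = P.q ^ 2 • SLq.B P • ω 1 ∧
          MulOpposite.op (SLq.C P) • ω 1 = (P.q ^ 2)⁻¹ • SLq.C P • ω 1 ∧
          MulOpposite.op (SLq.D P) • ω 1 = P.q ^ 2 • SLq.D P • ω 1) ∧
        -- the wedge relations
        ((∀ j : Fin 3, c.ofForm (ω j) * c.ofForm (ω j) = 0) ∧
          c.ofForm (ω 2) * c.ofForm (ω 0) = -P.q ^ 2 • (c.ofForm (ω 0) * c.ofForm (ω 2)) ∧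
          c.ofForm (ω 1) * c.ofForm (ω 0) = -P.q ^ 4 • (c.ofForm (ω 0) * c.ofForm (ω 1)) ∧
          c.ofForm (ω 2) * c.ofForm (ω 1) = -P.q ^ 4 • (c.ofForm (ω 1) * c.ofForm (ω 2))) ∧
        -- the basis forms in terms of the differentials of the generators
        (ω 1 = SLq.D P • c.d (SLq.A P) - P.q⁻¹ • SLq.B P • c.d (SLq.C P) ∧
          ω 2 = SLq.A P • c.d (SLq.C P) - P.q • SLq.C P • c.d (SLq.A P) ∧
          ω 0 = SLq.D P • c.d (SLq.B P) - P.q⁻¹ • SLq.B P • c.d (SLq.D P)) ∧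
        -- the exterior derivative exists and is unique; it satisfies the Maurer-Cartan formula,
        -- and the Maurer-Cartan equations are equivalent to the commutation relations
        ∃ δ : c.Forms →ₗ[ℂ] c.Forms,
          (c.IsExteriorDerivative δ ∧ ∀ δ', c.IsExteriorDerivative δ' → δ' = δ) ∧
          (∀ x : SLq P, δ (c.ofForm (c.omega x)) =
            -LinearMap.mul' ℂ c.Forms (TensorProduct.map (c.ofForm ∘ₗ c.omega)
              (c.ofForm ∘ₗ c.omega) (Coalgebra.comul x))) ∧
          ∀ Y : Fin 3 → WithConv (SLq P →ₗ[ℂ] ℂ),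
            QCommutationRelations P.q Y ↔
            ∀ x : SLq P, ∑ i, (Y i) x • δ (c.ofForm (ω i)) =
              -∑ i, ∑ j, (Y i * Y j) x • (c.ofForm (ω i) * c.ofForm (ω j)) := by
  refine ⟨?_, ⟨dualPairing_isDualPairing P, ?_, ?_, ?_⟩, ⟨rfl, rfl, rfl⟩, ?_,
    ⟨comul_tangentVector P, tangentFunctional_mul P⟩,
    ⟨tangentVector_commutation P, tangentFunctional_commutation P⟩, ?_, ?_⟩
  · obtain ⟨h₁, h₂, h₃, h₄, h₅, h₆, h₇⟩ := SLq.isSLqMatrix P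
    exact ⟨h₁, h₂, h₃, h₄, h₅, h₆, h₇⟩
  · simp [dualPairing_A, dualPairing_B, dualPairing_C, dualPairing_D, DualPairing.rep]
  · simp [dualPairing_A, dualPairing_B, dualPairing_C, dualPairing_D, DualPairing.rep]
  · simp [dualPairing_A, dualPairing_B, dualPairing_C, dualPairing_D, DualPairing.rep]
  · refine ⟨Uq.rel_kl P, Uq.rel_lk P, Uq.comul_K, Uq.comul_E, Uq.comul_F, ?_, ?_, ?_,
      Uq.counit_K, Uq.counit_E, Uq.counit_F⟩ <;>
    change Uq.antipodeMap P _ = _ <;> simp [Uq.antipodeMap]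
  · exact ⟨ThreeDForms P, inferInstance, inferInstance, inferInstance, inferInstance,
      inferInstance, inferInstance, inferInstance, ThreeDForms.calculus P,
      ThreeDForms.calculus_tangentSpace⟩
  · intro Γ _ _ _ _ _ _ _ c hT
    have hD : c.basisForm 1 = -(P.q ^ 2)⁻¹ • c.omega (SLq.D P) := by
      rw [c.omega_D hT, smul_smul, neg_mul_neg, inv_mul_cancel₀ (pow_ne_zero 2 P.q_ne_zero),
        one_smul]
    exact ⟨c.basisForm,
      ⟨c.isDualBasis_basisForm hT, fun _ h ↦ c.eq_basisForm_of_isDualBasis hT h⟩,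
      ⟨rfl, rfl, rfl, hD, c.d_generators hT⟩, c.op_smul_basisForm_generators hT,
      c.wedge_relations hT, c.basisForm_eq_d hT, c.extDeriv,
      ⟨c.extDeriv_isExteriorDerivative, fun _ h ↦ c.extDeriv_isExteriorDerivative.unique h⟩,
      fun x ↦ by rw [c.extDeriv_ofForm, c.dOne_omega, sweedler_mul'_eq], c.maurerCartan_iff hT⟩
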